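/- Let $N\in\mathbb{N}\cup\{0\}$, $b>0$, let $P_N$ be a complex polynomial of degree $N$ and let $S_0$ be a sine-type function of type $b$, i.e. an entire function of exponential type for which there are positive constants $c,C,K$ with $$c<|S_0(z)|\,e^{-|\operatorname{Im}z|b}<C,\qquad |\operatorname{Im}z|>K.$$ Let $\{z_n^0\}_{n\ge1}$ be the zeros of $S_0$ and $\{z_n^0\}_{1-N\le n\le0}$ the zeros of $P_N$, both counted with multiplicity, and assume that the zeros of $S_0$ are asymptotically simple and separated: there are $n_0\ge 1$ and $\delta>0$ such that $|z_n^0-z_k^0|\ge\delta$ for all $n\ne k$, $n,k\ge n_0$. Put $S=P_NS_0$, and $\mu_n=z_n^0$ if $z_n^0\neq0$, $\mu_n=-1$ if $z_n^0=0$ $(n\ge1-N)$. For $w\in L_2(-b,b)$ consider the entire function $$\theta(z)=S(z)+\int_{-b}^{b}w(x)e^{izx}\,dx. \tag{5}$$ 1. For fixed $S$, the function $\theta$ is uniquely determined by all of its zeros except any $N$ of them. That is, if $\theta$ and $\tilde\theta$ are of the form (5) with the same $S$, and $\{z_n\}_{n\ge1-N}$, $\{\tilde z_n\}_{n\ge1-N}$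 are any enumerations of their zeros, counted with multiplicity, such that $z_n=\tilde z_n$ for all $n\ge1$, then $\theta=\tilde\theta$. 2. Let $s$ be the (finite) multiplicity of the zero of $S$ at $0$ ($s=0$ if $S(0)\ne0$). The limits $$\alpha=\lim_{z\to0}\frac{S(z)}{z^s},\qquad \gamma=\lim_{z\to0}\frac{d}{dz}\ln\frac{S(z)}{z^s} \tag{12}$$ exist, and with $\beta=s+\gamma$ the following holds for every $\theta$ of the form (5). The zeros of $\theta$, counted with multiplicity, can be enumerated as $\{z_n\}_{n\ge1-N}$ so that $$z_n=z_n^0+\frac{\varkappa_n}{\mu_n^N},\qquad \{\varkappa_n\}_{n\ge1-N}\in l_2, \tag{10}$$ and for every such enumeration and every $z\in\mathbb{C}$ $$\theta(z)=\alpha e^{\beta z}\prod_{n=1-N}^{\infty}\frac{z_n-z}{\mu_n}\exp\Big(\frac{z}{\mu_n}\Big),$$ where the product converges unconditionally. -/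

import Mathlib

open Filter Topology MeasureTheory

noncomputable section

/-- `f` is a sine-type function of type `b`: an entire function of exponential type such that
`c < |f z| exp (-|Im z| b) < C` whenever `|Im z| > K`, for some positive `c`, `C`, `K`. -/
structure IsSineType (b : ℝ) (f : ℂ → ℂ) : Prop where
  entire : Differentiable ℂ f
  exponentialType : ∃ A B : ℝ, ∀ z : ℂ, ‖f z‖ ≤ A * Real.exp (B * ‖z‖)
  twoSided : ∃ c C K : ℝ, 0 < c ∧ 0 < C ∧ 0 < K ∧ ∀ z : ℂ, K < |z.im| →
    c < ‖f z‖ * Real.exp (-|z.im| * b) ∧ ‖f z‖ * Real.exp (-|z.im| * b) < C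

/-- The terms `a n`, `n ∈ I`, are precisely the zeros of `f`, each repeated according to its
multiplicity. -/
def EnumeratesZeros (f : ℂ → ℂ) (I : Set ℤ) (a : ℤ → ℂ) : Prop :=
  ∀ c : ℂ, {n : ℤ | n ∈ I ∧ a n = c}.encard = analyticOrderAt f c

/-- The terms `a n`, `n ≥ 1`, are asymptotically simple and separated. -/
def AsymptoticallySeparated (a : ℤ → ℂ) : Prop :=
  ∃ n₀ : ℤ, 1 ≤ n₀ ∧ ∃ δ : ℝ, 0 < δ ∧ ∀ n k : ℤ, n₀ ≤ n → n₀ ≤ k → n ≠ k → δ ≤ ‖a n - a k‖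

/-- The function `S z = P z * S₀ z`. -/
def principalPart (P : Polynomial ℂ) (S₀ : ℂ → ℂ) (z : ℂ) : ℂ := P.eval z * S₀ z

/-- The function `θ z = P z * S₀ z + ∫_{-b}^b w x exp (i z x) dx`. -/
def theta (b : ℝ) (P : Polynomial ℂ) (S₀ : ℂ → ℂ) (w : ℝ → ℂ) (z : ℂ) : ℂ :=
  principalPart P S₀ z + ∫ x in Set.Ioo (-b) b, w x * Complex.exp (Complex.I * z * (x : ℂ))

/-- `μ n = z⁰ n` if `z⁰ n ≠ 0`, and `μ n = -1` otherwise. -/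
def muSeq (z₀ : ℤ → ℂ) (n : ℤ) : ℂ := if z₀ n = 0 then -1 else z₀ n

/-- `z n = z⁰ n + ϰ n / (μ n) ^ N` for `n ≥ 1 - N`, where `ϰ` is square summable. -/
def HasZeroAsymptotics (N : ℕ) (z₀ z : ℤ → ℂ) : Prop :=
  ∃ κ : Set.Ici (1 - (N : ℤ)) → ℂ, Memℓp κ 2 ∧
    ∀ n : Set.Ici (1 - (N : ℤ)), z n = z₀ n + κ n / muSeq z₀ n ^ N

/-- The factor `((z n - ζ) / μ n) exp (ζ / μ n)`. -/
def zeroFactor (z₀ z : ℤ → ℂ) (ζ : ℂ) (n : ℤ) : ℂ :=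
  (z n - ζ) / muSeq z₀ n * Complex.exp (ζ / muSeq z₀ n)

end

/-! Write `a` for the zeros of `S = P S₀` and `F` for the integral term, so that `θ = S + F`.
Everything rests on one comparison of sizes. Off discs of fixed radius around the zeros of `S₀`, `|S
z|` is at least a constant times `|z| ^ N exp (b |Im z|)` for large `z`
(`IsSineType.exists_le_norm`), whereas `F z = o(exp (b |Im z|))` (`exists_norm_expIntegral_le`).
Hence `θ` obeys the same two-sided bounds as `S`, the logarithmic derivative of `θ` is bounded off
the discs, and `θ / S → 1` up the imaginary axis.

Zeros: near a large simple zero `a n`, `S z = (z - a n) P z g z` with `|P g|` bounded below by a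
multiple of `|a n| ^ N`. A contraction argument gives exactly one simple zero `u n` of `θ` there,
and `|u n - a n| |a n| ^ N` is at most a constant times `|F (u n)|`, which is square summable by a
Plancherel–Pólya inequality (`IsSineType.exists_local_zeros`). The finitely many other zeros are
counted without Rouché's theorem: `θ` and `S` are factored in Hadamard form, and `θ / S → 1` forces
the polynomial factors to have equal degrees.

Product: if `f` is the quotient of `θ` by its genus one product, then `f' / f` is entire, of
quadratic growth, and `o(y)` at `iy`, hence constant. The quotient of the products over `z n` and
over `a n` tends to `1` at `iy`, so `θ / S → 1` makes the factor `A exp (B z)` the same for `θ` as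
for `S`. For `S` the constants are read off at the origin.

Uniqueness: let `q`, `q'` be the monic polynomials of degree `N` whose roots are the zeros of `θ`,
`θ'` with index at most `0`. By Liouville `θ q' = κ θ' q`, so `S (q' - κ q) = κ F' q - F q'`. The
right side is too small on the imaginary axis unless `q' = κ q`; then `κ = 1` and `θ = θ'`. -/

/-! ### Division, growth and lower bounds for entire functions. -/

section EntireFunctions

/-- An entire function can be divided by an entire function with no more zeros. -/
theorem exists_differentiable_mul_eq {A B : ℂ → ℂ} (hA : Differentiable ℂ A)
    (hB : Differentiable ℂ B) (hB0 : ∀ c, analyticOrderAt B c ≠ ⊤)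
    (h : ∀ c, analyticOrderAt B c ≤ analyticOrderAt A c) :
    ∃ f : ℂ → ℂ, Differentiable ℂ f ∧ ∀ z, A z = B z * f z := by
  have key : ∀ c, ∃ F : ℂ → ℂ, AnalyticAt ℂ F c ∧ (∀ᶠ z in 𝓝 c, A z = B z * F z) ∧
      ∀ᶠ z in 𝓝[≠] c, B z ≠ 0 := by
    intro c
    obtain ⟨gB, hgB, hgB0, hBe⟩ := (hB.analyticAt c).analyticOrderAt_ne_top.1 (hB0 c)
    have hle : ((analyticOrderNatAt B c : ℕ) : ℕ∞) ≤ analyticOrderAt A c := by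
      rw [Nat.cast_analyticOrderNatAt (hB0 c)]; exact h c
    obtain ⟨gA, hgA, hAe⟩ := (natCast_le_analyticOrderAt (hA.analyticAt c)).1 hle
    have hne : ∀ᶠ z in 𝓝 c, gB z ≠ 0 := hgB.continuousAt.eventually_ne hgB0
    refine ⟨fun z => gA z / gB z, hgA.div hgB hgB0, ?_, ?_⟩
    · filter_upwards [hBe, hAe, hne] with z h1 h2 h3
      rw [h1, h2, smul_eq_mul, smul_eq_mul]
      field_simp
    · filter_upwards [hBe.filter_mono nhdsWithin_le_nhds, hne.filter_mono nhdsWithin_le_nhds,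
        self_mem_nhdsWithin] with z h1 h3 h4
      rw [h1]
      exact mul_ne_zero (pow_ne_zero _ (sub_ne_zero.2 h4)) h3
  choose F hF hFe hBne using key
  have hself : ∀ z, A z = B z * F z z := fun z => (hFe z).self_of_nhds
  -- The diagonal glues the local quotients: near `c` it coincides with `F c`, because `B` has no
  -- zero in a punctured neighbourhood of `c`.
  refine ⟨fun z => F z z, fun c => ?_, hself⟩
  have : (fun z => F z z) =ᶠ[𝓝 c] F c := by
    filter_upwards [hFe c, eventually_nhdsWithin_iff.1 (hBne c)] with z h1 h2
    by_cases hz : z = c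
    · rw [hz]
    · exact mul_left_cancel₀ (h2 hz) ((hself z).symm.trans h1)
  exact ((hF c).congr this.symm).differentiableAt

theorem analyticOrderAt_finset_prod {ι : Type*} (E : Finset ι) (f : ι → ℂ → ℂ) (c : ℂ)
    (hf : ∀ i ∈ E, AnalyticAt ℂ (f i) c) :
    analyticOrderAt (fun z => ∏ i ∈ E, f i z) c = ∑ i ∈ E, analyticOrderAt (f i) c := by
  classical
  induction E using Finset.induction_on with
  | empty =>
    simp only [Finset.prod_empty, Finset.sum_empty]
    exact analyticAt_const.analyticOrderAt_eq_zero.2 one_ne_zero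
  | insert i E hi ih =>
    have h1 : (fun z => ∏ j ∈ insert i E, f j z) = f i * fun z => ∏ j ∈ E, f j z := by
      ext z; simp [Finset.prod_insert hi]
    have h2 : AnalyticAt ℂ (fun z => ∏ j ∈ E, f j z) c :=
      Finset.analyticAt_fun_prod _ fun j hj => hf j (Finset.mem_insert_of_mem hj)
    rw [h1, analyticOrderAt_mul (hf i (Finset.mem_insert_self _ _)) h2, Finset.sum_insert hi,
      ih fun j hj => hf j (Finset.mem_insert_of_mem hj)]

theorem analyticOrderAt_sub_const (a c : ℂ) [Decidable (a = c)] :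
    analyticOrderAt (fun z : ℂ => z - a) c = if a = c then 1 else 0 := by
  split_ifs with h
  · subst h
    exact analyticOrderAt_id_sub_const_self
  · exact analyticOrderAt_id_sub_const_of_ne (Ne.symm h)

open scoped Classical in
theorem analyticOrderAt_prod_sub {ι : Type*} (E : Finset ι) (a : ι → ℂ) (c : ℂ) :
    analyticOrderAt (fun z => ∏ i ∈ E, (z - a i)) c = ((E.filter (a · = c)).card : ℕ∞) := by
  rw [analyticOrderAt_finset_prod E (fun i z => z - a i) c fun i _ => by fun_prop]
  simp [analyticOrderAt_sub_const]

/-- Dividing `g - g 0` by `z` lowers the growth exponent by one. Two applications bring quadratic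
growth down to Liouville's theorem. -/
theorem norm_dslope_le_of_growth {g : ℂ → ℂ} (hg : Differentiable ℂ g) {C : ℝ} {k : ℕ}
    (hC : ∀ z, ‖g z‖ ≤ C * (1 + ‖z‖) ^ (k + 1)) :
    Differentiable ℂ (dslope g 0) ∧ ∃ C' : ℝ, ∀ z, ‖dslope g 0 z‖ ≤ C' * (1 + ‖z‖) ^ k := by
  have hd : Differentiable ℂ (dslope g 0) := by
    rw [← differentiableOn_univ] at hg ⊢
    exact (Complex.differentiableOn_dslope univ_mem).2 hg
  have hC0 : 0 ≤ C := by simpa using (norm_nonneg _).trans (hC 0)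
  obtain ⟨M, hM⟩ := (isCompact_closedBall (0 : ℂ) 1).exists_bound_of_continuousOn
    hd.continuous.continuousOn
  have hM0 : 0 ≤ M := (norm_nonneg _).trans (hM 0 (by simp))
  refine ⟨hd, M + 4 * C, fun z => ?_⟩
  have h1 : 1 ≤ (1 + ‖z‖) ^ k := one_le_pow₀ (by linarith [norm_nonneg z])
  rcases le_or_gt ‖z‖ 1 with hz | hz
  · have := hM z (by simpa using hz)
    nlinarith
  · have hz0 : z ≠ 0 := by rintro rfl; norm_num at hz
    rw [dslope_of_ne _ hz0, slope_def_field, norm_div, sub_zero, div_le_iff₀ (by linarith)]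
    have h2 : ‖g z - g 0‖ ≤ C * (1 + ‖z‖) ^ (k + 1) + C := by
      refine (norm_sub_le _ _).trans (add_le_add (hC z) ?_)
      simpa using hC 0
    have h3 : C ≤ C * (1 + ‖z‖) ^ (k + 1) :=
      le_mul_of_one_le_right hC0 (one_le_pow₀ (by linarith [norm_nonneg z]))
    have h4 : C * (1 + ‖z‖) ^ (k + 1) ≤ C * (1 + ‖z‖) ^ k * (2 * ‖z‖) := by
      rw [pow_succ, ← mul_assoc]
      exact mul_le_mul_of_nonneg_left (by linarith) (by positivity)
    have h5 : 0 ≤ M * (1 + ‖z‖) ^ k * ‖z‖ := by positivity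
    nlinarith

/-- An entire function of quadratic growth which is `o(y)` on the imaginary axis is constant. -/
theorem eq_const_of_quadratic_growth {g : ℂ → ℂ} (hg : Differentiable ℂ g) {C : ℝ}
    (hC : ∀ z, ‖g z‖ ≤ C * (1 + ‖z‖) ^ 2)
    (ho : Tendsto (fun y : ℝ => g (y * Complex.I) / y) atTop (𝓝 0)) (z : ℂ) : g z = g 0 := by
  obtain ⟨h1, C1, hC1⟩ := norm_dslope_le_of_growth hg hC
  obtain ⟨h2, C2, hC2⟩ := norm_dslope_le_of_growth h1 (k := 0) (by simpa using hC1)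
  obtain ⟨k, hk⟩ := h2.exists_const_forall_eq_of_bounded
    (isBounded_iff_forall_norm_le.2 ⟨C2, by rintro _ ⟨z, rfl⟩; simpa using hC2 z⟩)
  have e0 : ∀ z, g z = g 0 + z * dslope g 0 z := fun z => by
    have := sub_smul_dslope g 0 z
    simp only [sub_zero, smul_eq_mul] at this
    rw [this]; ring
  set m := dslope g 0 0 with hm
  have e1 : ∀ z, dslope g 0 z = m + z * k := fun z => by
    have := sub_smul_dslope (dslope g 0) 0 z
    simp only [sub_zero, smul_eq_mul] at this
    rw [← hk z, this]; ring
  have hinv : Tendsto (fun y : ℝ => ((y : ℂ))⁻¹) atTop (𝓝 0) := by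
    have := (Complex.continuous_ofReal.tendsto 0).comp tendsto_inv_atTop_zero
    simpa [Function.comp_def] using this
  have hy : ∀ᶠ y : ℝ in atTop, (y : ℂ) ≠ 0 := by
    filter_upwards [eventually_gt_atTop 0] with y hy
    exact_mod_cast hy.ne'
  have hI := Complex.I_sq
  -- By now `g z = g 0 + m z + k z ^ 2`; dividing by `y` at `z = iy` kills first `k`, then `m`.
  have l1 : Tendsto (fun y : ℝ => m * Complex.I + y * (Complex.I ^ 2 * k)) atTop (𝓝 0) := by
    have := ho.sub (hinv.const_mul (g 0))
    simp only [mul_zero, sub_zero] at this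
    refine this.congr' ?_
    filter_upwards [hy] with y hy
    rw [e0 (y * Complex.I), e1]
    field_simp
    ring
  have hk0 : k = 0 := by
    have := (l1.mul hinv).sub (hinv.const_mul (m * Complex.I))
    simp only [mul_zero, sub_zero] at this
    have h3 : Tendsto (fun _ : ℝ => Complex.I ^ 2 * k) atTop (𝓝 0) := by
      refine this.congr' ?_
      filter_upwards [hy] with y hy
      field_simp
      ring
    have := tendsto_nhds_unique h3 tendsto_const_nhds
    simpa [hI] using this.symm
  have hm0 : m = 0 := by
    simp only [hk0, mul_zero, add_zero] at l1
    have := tendsto_nhds_unique l1 tendsto_const_nhds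
    simpa using this.symm
  rw [e0 z, e1, hk0, hm0]; simp

/-- A lower bound for a bounded zero-free function on a disc. -/
theorem le_norm_of_ne_zero_on_ball {g : ℂ → ℂ} {p : ℂ} {R M m : ℝ} (hR : 0 < R) (hm : 0 < m)
    (hg : DifferentiableOn ℂ g (Metric.ball p R)) (h0 : ∀ z ∈ Metric.ball p R, g z ≠ 0)
    (hM : ∀ z ∈ Metric.ball p R, ‖g z‖ ≤ M) (hp : m ≤ ‖g p‖) {z : ℂ}
    (hz : z ∈ Metric.ball p (R / 2)) :
    m * Real.exp (-(2 * (Real.log (M / m) + 1))) ≤ ‖g z‖ := by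
  have hpb : p ∈ Metric.ball p R := Metric.mem_ball_self hR
  have hmM : m ≤ M := hp.trans (hM p hpb)
  -- A primitive `h` of `g' / g` with `h p = 0` gives `g = g p * exp h`, so an upper bound for `g`
  -- bounds `Re h` from above, and Borel–Carathéodory turns this into a bound for `|h|`.
  obtain ⟨h, hh0, hh⟩ := ((hg.deriv Metric.isOpen_ball).div hg h0).isExactOn_ball.with_val_at p 0
  have hgd : ∀ w ∈ Metric.ball p R, HasDerivAt g (deriv g w) w := fun w hw =>
    (hg.differentiableAt (Metric.isOpen_ball.mem_nhds hw)).hasDerivAt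
  have hconst : ∀ w ∈ Metric.ball p R, g w = g p * Complex.exp (h w) := by
    have hd : ∀ w ∈ Metric.ball p R,
        HasDerivAt (fun w => g w * Complex.exp (-h w)) 0 w := by
      intro w hw
      have := (hgd w hw).mul (hh w hw).neg.cexp
      refine this.congr_deriv ?_
      have := h0 w hw
      simp only [Pi.div_apply]
      field_simp
      ring
    intro w hw
    have := Metric.isOpen_ball.is_const_of_deriv_eq_zero
      (convex_ball p R).isPreconnected (fun w hw => (hd w hw).differentiableAt.differentiableWithinAt)
      (fun w hw => (hd w hw).deriv) hw hpb
    simp only [hh0, neg_zero, Complex.exp_zero, mul_one] at this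
    rw [← this, mul_assoc, ← Complex.exp_add]
    simp
  -- The summand `1` keeps `L` positive when `M = m`.
  set L := Real.log (M / m) + 1 with hL
  have hLpos : 0 < L := by
    have : 0 ≤ Real.log (M / m) := Real.log_nonneg (by rwa [le_div_iff₀ hm, one_mul])
    linarith
  have hmap : Set.MapsTo (fun ζ => h (p + ζ)) (Metric.ball 0 R) {z | z.re ≤ L} := by
    intro ζ hζ
    have hw : p + ζ ∈ Metric.ball p R := by simpa using hζ
    have h1 := hM _ hw
    rw [hconst _ hw, norm_mul, Complex.norm_exp] at h1
    have h2 : m * Real.exp (h (p + ζ)).re ≤ M :=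
      (mul_le_mul_of_nonneg_right hp (Real.exp_pos _).le).trans h1
    have h3 : (h (p + ζ)).re ≤ Real.log (M / m) := by
      rw [Real.le_log_iff_exp_le (by positivity [hm.trans_le hmM]), le_div_iff₀ hm]
      linarith
    simp only [Set.mem_ofPred_eq]
    linarith
  have hdiff : DifferentiableOn ℂ (fun ζ => h (p + ζ)) (Metric.ball 0 R) := by
    intro ζ hζ
    have hw : p + ζ ∈ Metric.ball p R := by simpa using hζ
    exact ((hh _ hw).differentiableAt.comp ζ (by fun_prop)).differentiableWithinAt
  have hzR : ‖z - p‖ < R / 2 := by simpa [dist_eq_norm] using hz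
  have hbc := Complex.borelCaratheodory_zero hLpos hdiff hmap hR (z := z - p)
    (by simpa using hzR.trans (by linarith)) (by simpa using hh0)
  have hzb : z ∈ Metric.ball p R := Metric.ball_subset_ball (by linarith) hz
  simp only [add_sub_cancel] at hbc
  have h4 : ‖h z‖ ≤ 2 * L := by
    refine hbc.trans ?_
    rw [div_le_iff₀ (by linarith [norm_nonneg (z - p)])]
    nlinarith [norm_nonneg (z - p)]
  rw [hconst z hzb, norm_mul, Complex.norm_exp]
  have h5 : -(2 * L) ≤ (h z).re := by
    have := (Complex.abs_re_le_norm (h z)).trans h4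
    linarith [neg_abs_le (h z).re]
  gcongr

end EntireFunctions

/-! ### Exponentials and polynomials on the imaginary axis. -/

section Asymptotics

theorem tendsto_ofReal_mul_I_cobounded :
    Tendsto (fun y : ℝ => (y : ℂ) * Complex.I) atTop (Bornology.cobounded ℂ) := by
  rw [← tendsto_norm_atTop_iff_cobounded]
  simpa using tendsto_abs_atTop_atTop

/-- Compare the values at `y + t` and at `y`: both tend to `1` and the powers contribute a ratio
tending to `1`, so `exp (d t i) = 1` for every real `t`, and differentiating at `t = 0` gives `d =
0`. What remains is a monomial quotient with a finite nonzero limit. -/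
theorem eq_zero_of_tendsto_exp_mul_pow_div_pow {c d : ℂ} {n m : ℕ}
    (h : Tendsto (fun y : ℝ => c * Complex.exp (d * (y * Complex.I)) * (y : ℂ) ^ n / (y : ℂ) ^ m)
      atTop (𝓝 1)) : d = 0 ∧ n = m := by
  have hd : d = 0 := by
    have key : ∀ t : ℝ, Complex.exp (d * (t * Complex.I)) = 1 := by
      intro t
      have h1 := h.comp (tendsto_atTop_add_const_right atTop t tendsto_id)
      have hq : Tendsto (fun y : ℝ => ((y + t) / y : ℂ)) atTop (𝓝 1) := by
        have h2 : Tendsto (fun y : ℝ => 1 + t * y⁻¹) atTop (𝓝 (1 + t * 0)) :=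
          (tendsto_inv_atTop_zero.const_mul t).const_add 1
        have h3 := (Complex.continuous_ofReal.tendsto _).comp h2
        simp only [mul_zero, add_zero, Complex.ofReal_one] at h3
        refine h3.congr' ?_
        filter_upwards [eventually_gt_atTop 0] with y hy
        have : (y : ℂ) ≠ 0 := by exact_mod_cast hy.ne'
        simp only [Function.comp_apply]
        push_cast
        field_simp
      have h4 := ((h1.div h one_ne_zero).mul ((hq.pow m).div (hq.pow n) (by simp)))
      simp only [one_pow, div_one, mul_one] at h4
      refine tendsto_nhds_unique (tendsto_const_nhds.congr' ?_) h4
      filter_upwards [eventually_gt_atTop 0, eventually_gt_atTop (-t),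
        h.eventually_ne one_ne_zero] with y hy hyt hne
      have hy0 : (y : ℂ) ≠ 0 := by exact_mod_cast hy.ne'
      have hyt0 : (y + t : ℂ) ≠ 0 := by exact_mod_cast (by linarith : y + t ≠ 0)
      have hc : c ≠ 0 := by rintro rfl; simp at hne
      simp only [Function.comp_apply, id, Pi.div_apply, div_pow]
      push_cast
      rw [show d * ((y + t) * Complex.I) = d * (y * Complex.I) + d * (t * Complex.I) by ring,
        Complex.exp_add]
      have := Complex.exp_ne_zero (d * (y * Complex.I))
      field_simp
    have h1 : HasDerivAt (fun t : ℝ => Complex.exp (d * (t * Complex.I)))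
        (Complex.exp (d * ((0 : ℝ) * Complex.I)) * (d * (1 * Complex.I))) 0 :=
      (((Complex.ofRealCLM.hasDerivAt (x := (0 : ℝ))).mul_const Complex.I).const_mul d).cexp
    have h2 : HasDerivAt (fun t : ℝ => Complex.exp (d * (t * Complex.I))) 0 0 :=
      (hasDerivAt_const (0 : ℝ) (1 : ℂ)).congr_of_eventuallyEq (.of_forall key)
    have := h1.unique h2
    simpa using this
  refine ⟨hd, ?_⟩
  subst hd
  simp only [zero_mul, Complex.exp_zero, mul_one] at h
  have hpow : ∀ k l : ℕ, k < l → Tendsto (fun y : ℝ => (y : ℂ) ^ k / (y : ℂ) ^ l) atTop (𝓝 0) := by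
    intro k l hkl
    have := (Complex.continuous_ofReal.tendsto _).comp
      (tendsto_pow_div_pow_atTop_zero (𝕜 := ℝ) hkl)
    refine (this.congr fun y => ?_).trans (by simp)
    simp
  rcases lt_trichotomy n m with hlt | heq | hgt
  · have := (hpow n m hlt).const_mul c
    rw [mul_zero] at this
    exact absurd (tendsto_nhds_unique (this.congr fun y => by ring) h) (by simp)
  · exact heq
  · have h1 := h.mul (hpow m n hgt)
    rw [mul_zero] at h1
    have h2 : Tendsto (fun _ : ℝ => c) atTop (𝓝 0) := by
      refine h1.congr' ?_
      filter_upwards [eventually_gt_atTop 0] with y hy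
      have hy0 : (y : ℂ) ≠ 0 := by exact_mod_cast hy.ne'
      field_simp
    have hc : c = 0 := tendsto_nhds_unique tendsto_const_nhds h2
    subst hc
    simp at h

/-- Polynomials may be replaced by their leading terms. This is the device that both counts the
exceptional zeros (through the degrees) and identifies the exponent in the product formula. -/
theorem eq_zero_of_tendsto_exp_mul_eval_div_eval {c d : ℂ} {p q : Polynomial ℂ} (hp : p ≠ 0)
    (hq : q ≠ 0)
    (h : Tendsto (fun y : ℝ => c * Complex.exp (d * (y * Complex.I)) *
      p.eval (y * Complex.I) / q.eval (y * Complex.I)) atTop (𝓝 1)) :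
    d = 0 ∧ p.natDegree = q.natDegree := by
  have hI := tendsto_ofReal_mul_I_cobounded
  have h1 := (p.isEquivalent_cobounded_leading_monomial.comp_tendsto hI)
  have h2 := (q.isEquivalent_cobounded_leading_monomial.comp_tendsto hI)
  have h3 := ((Asymptotics.IsEquivalent.refl (u := fun y : ℝ =>
    c * Complex.exp (d * (y * Complex.I))) (l := atTop)).mul h1).div h2
  have h4 := h3.tendsto_nhds h
  have hp0 : p.leadingCoeff ≠ 0 := by simpa using hp
  have hq0 : q.leadingCoeff ≠ 0 := by simpa using hq
  have hI0 := Complex.I_ne_zero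
  refine eq_zero_of_tendsto_exp_mul_pow_div_pow (c := c * (p.leadingCoeff * Complex.I ^ p.natDegree)
    / (q.leadingCoeff * Complex.I ^ q.natDegree)) (h4.congr fun y => ?_)
  simp only [Pi.div_apply, Pi.mul_apply, Function.comp_apply, mul_pow]
  have hI0 : Complex.I ^ q.natDegree ≠ 0 := pow_ne_zero _ Complex.I_ne_zero
  rcases eq_or_ne ((y : ℂ) ^ q.natDegree) 0 with hy | hy
  · simp [hy]
  · field_simp

theorem Polynomial.exists_norm_eval_bounds {p : Polynomial ℂ} (hp : p ≠ 0) :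
    ∃ c C R : ℝ, 0 < c ∧ 0 < C ∧ 1 ≤ R ∧ ∀ z : ℂ, R ≤ ‖z‖ →
      c * ‖z‖ ^ p.natDegree ≤ ‖p.eval z‖ ∧ ‖p.eval z‖ ≤ C * ‖z‖ ^ p.natDegree := by
  have h := p.isEquivalent_cobounded_leading_monomial
  have hl : 0 < ‖p.leadingCoeff‖ := by simpa using hp
  obtain ⟨c, hc, h1⟩ := h.isBigO.exists_pos
  obtain ⟨d, hd, h2⟩ := h.isBigO_symm.exists_pos
  obtain ⟨R, -, hR⟩ := (hasBasis_cobounded_norm (E := ℂ)).eventually_iff.1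
    (h1.bound.and h2.bound)
  refine ⟨‖p.leadingCoeff‖ / d, c * ‖p.leadingCoeff‖, max R 1, by positivity, by positivity,
    le_max_right _ _, fun z hz => ?_⟩
  obtain ⟨h3, h4⟩ := hR (le_trans (le_max_left _ _) hz)
  simp only [norm_mul, norm_pow] at h3 h4
  constructor
  · rw [div_mul_eq_mul_div, div_le_iff₀ hd]
    linarith
  · linarith

end Asymptotics

/-! ### Zeros of small perturbations of a linear function. -/

section FixedPoint

/-- A small perturbation of `z - a` has exactly one zero near `a`, and this zero is simple. -/
theorem exists_unique_simple_zero {a : ℂ} {ε : ℝ} (hε : 0 < ε) {h : ℂ → ℂ}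
    (hd : DifferentiableOn ℂ h (Metric.ball a ε)) (hb : ∀ z ∈ Metric.ball a ε, ‖h z‖ ≤ ε / 8) :
    ∃ u ∈ Metric.ball a ε, ∀ c ∈ Metric.ball a ε, ∀ [Decidable (c = u)],
      analyticOrderAt (fun z => z - a + h z) c = if c = u then 1 else 0 := by
  have hsub : Metric.closedBall a (ε / 2) ⊆ Metric.ball a ε :=
    Metric.closedBall_subset_ball (by linarith)
  have hda : ∀ z ∈ Metric.ball a ε, DifferentiableAt ℂ h z := fun z hz =>
    hd.differentiableAt (Metric.isOpen_ball.mem_nhds hz)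
  -- Cauchy's estimate on a circle of radius `ε / 4` turns the bound `ε / 8` into `1 / 2`. Thus `z ↦
  -- a - h z` contracts the half disc, and `1 + h'` cannot vanish there, which makes the zero
  -- simple.
  have hderiv : ∀ z ∈ Metric.closedBall a (ε / 2), ‖deriv h z‖ ≤ 1 / 2 := by
    intro z hz
    have hcb : Metric.closedBall z (ε / 4) ⊆ Metric.ball a ε := by
      refine (Metric.closedBall_subset_closedBall' ?_).trans
        (Metric.closedBall_subset_ball (show 3 * ε / 4 < ε by linarith))
      have : dist z a ≤ ε / 2 := hz
      linarith
    have := Complex.norm_deriv_le_of_forall_mem_sphere_norm_le (C := ε / 8) (f := h) (c := z)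
      (show 0 < ε / 4 by linarith) (hd.diffContOnCl_ball hcb)
      (fun w hw => hb w (hcb (Metric.sphere_subset_closedBall hw)))
    refine this.trans ?_
    rw [div_div_eq_mul_div]
    apply le_of_eq
    field_simp
    norm_num
  have hlip : LipschitzOnWith (1 / 2) (fun z => a - h z) (Metric.closedBall a (ε / 2)) := by
    refine (convex_closedBall a (ε / 2)).lipschitzOnWith_of_nnnorm_deriv_le (𝕜 := ℂ) ?_ ?_
    · intro z hz
      exact (hda z (hsub hz)).const_sub a
    · intro z hz
      have := hderiv z hz
      rw [deriv_const_sub, nnnorm_neg, ← NNReal.coe_le_coe]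
      simpa using this
  have hmaps : Set.MapsTo (fun z => a - h z) (Metric.closedBall a (ε / 2))
      (Metric.closedBall a (ε / 2)) := by
    intro z hz
    have := hb z (hsub hz)
    simp only [Metric.mem_closedBall, dist_eq_norm, sub_sub_cancel_left, norm_neg]
    linarith
  obtain ⟨u, hu, hfix, -⟩ := ContractingWith.exists_fixedPoint'
    (K := 1 / 2) Metric.isClosed_closedBall.isComplete hmaps
    ⟨by rw [← NNReal.coe_lt_coe]; norm_num, hlip.mapsToRestrict hmaps⟩
    (Metric.mem_closedBall_self (by linarith)) (edist_ne_top _ _)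
  have hfix' : a - h u = u := hfix
  refine ⟨u, hsub hu, fun c hc _ => ?_⟩
  have hca : AnalyticAt ℂ (fun z => z - a + h z) c :=
    (by fun_prop : AnalyticAt ℂ (fun z : ℂ => z - a) c).add
      (hd.analyticAt (Metric.isOpen_ball.mem_nhds hc))
  split_ifs with hcu
  · subst hcu
    refine hca.analyticOrderAt_eq_one_of_zero_deriv_ne_zero ?_ ?_
    · linear_combination -hfix'
    · have h1 : HasDerivAt (fun z => z - a + h z) (1 + deriv h c) c :=
        ((hasDerivAt_id c).sub_const a).add (hda c hc).hasDerivAt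
      rw [h1.deriv]
      intro h0
      have h2 := hderiv c hu
      rw [show deriv h c = -1 by linear_combination h0] at h2
      norm_num at h2
  · refine hca.analyticOrderAt_eq_zero.2 fun h0 => hcu ?_
    have hc0 : a - h c = c := by linear_combination -h0
    -- Every zero in the large disc satisfies `|c - a| = |h c| ≤ ε / 8`, so it already lies where
    -- the contraction acts.
    have hcb : c ∈ Metric.closedBall a (ε / 2) := by
      rw [Metric.mem_closedBall, dist_eq_norm, show c - a = -h c by linear_combination -hc0,
        norm_neg]
      linarith [hb c hc]
    have h1 := hlip.dist_le_mul c hcb u hu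
    simp only [hc0, hfix'] at h1
    have h2 : dist c u ≤ 1 / 2 * dist c u := by simpa using h1
    have h3 : dist c u = 0 := le_antisymm (by linarith) dist_nonneg
    exact dist_eq_zero.1 h3

end FixedPoint

/-! ### Separated sequences in a horizontal strip. -/

section SeparatedSequences

variable {a : ℤ → ℂ}

/-- Cells of a sufficiently fine square grid contain at most one term of the sequence. -/
theorem AsymptoticallySeparated.exists_grid (hsep : AsymptoticallySeparated a) {H : ℝ}
    (him : ∀ n, 1 ≤ n → |(a n).im| ≤ H) {η₀ : ℝ} (h0 : 0 < η₀) :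
    ∃ η : ℝ, 0 < η ∧ η ≤ η₀ ∧ ∃ (T : Finset ℤ) (n₀ : ℤ), 1 ≤ n₀ ∧
      (∀ n, n₀ ≤ n → ⌊(a n).im / η⌋ ∈ T) ∧
      Set.InjOn (fun n => (⌊(a n).re / η⌋, ⌊(a n).im / η⌋)) (Set.Ici n₀) := by
  obtain ⟨n₀, hn₀, δ, hδ, hsep⟩ := hsep
  have hη : 0 < min η₀ (δ / 2) := lt_min h0 (by linarith)
  set η := min η₀ (δ / 2)
  have hηδ : η ≤ δ / 2 := min_le_right _ _
  refine ⟨η, hη, min_le_left _ _, Finset.Icc ⌊-H / η⌋ ⌊H / η⌋, n₀, hn₀, fun n hn => ?_, ?_⟩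
  · have := abs_le.1 (him n (hn₀.trans hn))
    rw [Finset.mem_Icc]
    exact ⟨Int.floor_le_floor (by gcongr; exact this.1), Int.floor_le_floor (by gcongr; exact this.2)⟩
  · intro n hn k hk hnk
    by_contra hne
    simp only [Prod.mk.injEq] at hnk
    have hre := Int.abs_sub_lt_one_of_floor_eq_floor hnk.1
    have him' := Int.abs_sub_lt_one_of_floor_eq_floor hnk.2
    rw [← sub_div, abs_div, abs_of_pos hη, div_lt_one hη] at hre him'
    have h1 := Complex.norm_le_abs_re_add_abs_im (a n - a k)
    have h2 := hsep n k hn hk hne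
    simp only [Complex.sub_re, Complex.sub_im] at h1
    linarith

/-- A disc of radius `r` meets a number of grid columns that does not depend on its centre, and only
the rows in `T` are occupied. -/
theorem AsymptoticallySeparated.exists_encard_le (hsep : AsymptoticallySeparated a) {H : ℝ}
    (him : ∀ n, 1 ≤ n → |(a n).im| ≤ H) (r : ℝ) :
    ∃ m : ℕ, ∀ p : ℂ, {n : ℤ | 1 ≤ n ∧ ‖a n - p‖ ≤ r}.encard ≤ m := by
  obtain ⟨η, hη, -, T, n₀, hn₀, hT, hinj⟩ := hsep.exists_grid him one_pos
  refine ⟨(Finset.Ico 1 n₀).card + (⌈2 * r / η⌉₊ + 2) * T.card, fun p => ?_⟩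
  set U : Set ℤ := {n : ℤ | n₀ ≤ n ∧ ‖a n - p‖ ≤ r}
  have hsub : {n : ℤ | 1 ≤ n ∧ ‖a n - p‖ ≤ r} ⊆ (Finset.Ico 1 n₀ : Set ℤ) ∪ U := by
    rintro n ⟨h1, h2⟩
    rcases lt_or_ge n n₀ with h | h
    · left; simp [h1, h]
    · right; exact ⟨h, h2⟩
  have hU : U.encard ≤ ((⌈2 * r / η⌉₊ + 2) * T.card : ℕ) := by
    have himg : (fun n => (⌊(a n).re / η⌋, ⌊(a n).im / η⌋)) '' U ⊆
        ((Finset.Icc ⌊(p.re - r) / η⌋ ⌊(p.re + r) / η⌋ ×ˢ T : Finset (ℤ × ℤ)) : Set (ℤ × ℤ)) := by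
      rintro _ ⟨n, ⟨h1, h2⟩, rfl⟩
      have h3 := (Complex.abs_re_le_norm (a n - p)).trans h2
      rw [Complex.sub_re, abs_le] at h3
      simp only [Finset.coe_product, Set.mem_prod, Finset.mem_coe, Finset.mem_Icc]
      exact ⟨⟨Int.floor_le_floor (by gcongr; linarith),
        Int.floor_le_floor (by gcongr; linarith)⟩, hT n h1⟩
    rw [← (hinj.mono fun n hn => hn.1 : Set.InjOn _ U).encard_image]
    refine (Set.encard_le_encard himg).trans ?_
    rw [Set.encard_coe_eq_coe_finsetCard, Finset.card_product, Nat.cast_le]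
    gcongr
    rw [Int.card_Icc, Int.toNat_le]
    have e1 : ((⌊(p.re + r) / η⌋ + 1 - ⌊(p.re - r) / η⌋ : ℤ) : ℝ) ≤ 2 * r / η + 2 := by
      have h1 := Int.floor_le ((p.re + r) / η)
      have h2 := (Int.lt_floor_add_one ((p.re - r) / η)).le
      have h3 : (p.re + r) / η - (p.re - r) / η = 2 * r / η := by field_simp; ring
      push_cast
      linarith
    have e2 := Nat.le_ceil (2 * r / η)
    have : ((⌊(p.re + r) / η⌋ + 1 - ⌊(p.re - r) / η⌋ : ℤ) : ℝ) ≤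
        (((⌈2 * r / η⌉₊ + 2 : ℕ) : ℤ) : ℝ) := by
      push_cast at e1 ⊢
      linarith
    exact_mod_cast this
  refine (Set.encard_le_encard hsub).trans ((Set.encard_union_le _ _).trans ?_)
  rw [Set.encard_coe_eq_coe_finsetCard, Nat.cast_add]
  gcongr

theorem AsymptoticallySeparated.finite_norm_le (hsep : AsymptoticallySeparated a) {H : ℝ}
    (him : ∀ n, 1 ≤ n → |(a n).im| ≤ H) (R : ℝ) : {n : ℤ | 1 ≤ n ∧ ‖a n‖ ≤ R}.Finite := by
  obtain ⟨m, hm⟩ := hsep.exists_encard_le him R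
  have := hm 0
  simp only [sub_zero] at this
  exact Set.finite_of_encard_le_coe this

theorem AsymptoticallySeparated.exists_forall_le_norm (hsep : AsymptoticallySeparated a) {H : ℝ}
    (him : ∀ n, 1 ≤ n → |(a n).im| ≤ H) (R : ℝ) : ∃ n₁ : ℤ, 1 ≤ n₁ ∧ ∀ n, n₁ ≤ n → R < ‖a n‖ := by
  obtain ⟨M, hM⟩ := (hsep.finite_norm_le him R).bddAbove
  refine ⟨max 1 (M + 1), le_max_left _ _, fun n hn => ?_⟩
  by_contra! h
  have := hM ⟨(le_max_left _ _).trans hn, h⟩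
  have := (le_max_right _ _).trans hn
  omega

theorem summable_Ici_of_summable_Ici {f : ℤ → ℝ} {k l : ℤ}
    (h : Summable fun n : Set.Ici k => f n) : Summable fun n : Set.Ici l => f n := by
  have h' := (summable_subtype_iff_indicator (f := f) (s := Set.Ici k)).1 h
  refine (summable_subtype_iff_indicator (f := f) (s := Set.Ici l)).2 ((summable_congr_cofinite ?_).1 h')
  have hfin : (Set.Icc (min k l) (max k l)).Finite := Set.finite_Icc _ _
  filter_upwards [hfin.compl_mem_cofinite] with n hn
  simp only [Set.mem_compl_iff, Set.mem_Icc, not_and_or, not_le] at hn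
  have : n ∈ Set.Ici k ↔ n ∈ Set.Ici l := by simp only [Set.mem_Ici]; omega
  by_cases hk : n ∈ Set.Ici k
  · rw [Set.indicator_of_mem hk, Set.indicator_of_mem (this.1 hk)]
  · rw [Set.indicator_of_notMem hk, Set.indicator_of_notMem (mt this.2 hk)]

/-- Each column index `i n` is taken at most `T.card` times, so a summable function of the column
stays summable along the sequence. -/
theorem summable_comp_of_injOn_prod {f : ℤ → ℝ} (hf : Summable f) (hf0 : ∀ k, 0 ≤ f k) {i j : ℤ → ℤ}
    {T : Finset ℤ} {n₀ : ℤ} (hT : ∀ n, n₀ ≤ n → j n ∈ T)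
    (hinj : Set.InjOn (fun n => (i n, j n)) (Set.Ici n₀)) :
    Summable fun n : Set.Ici n₀ => f (i n) := by
  have h1 : Summable fun x : ℤ × T => f x.1 * (fun _ : T => (1 : ℝ)) x.2 :=
    hf.mul_of_nonneg Summable.of_finite hf0 fun _ => zero_le_one
  have h2 : Function.Injective fun n : Set.Ici n₀ => (i n, (⟨j n, hT n n.2⟩ : T)) := by
    intro n k hnk
    simp only [Prod.mk.injEq, Subtype.mk.injEq] at hnk
    exact Subtype.ext (hinj n.2 k.2 (Prod.ext hnk.1 hnk.2))
  refine (h1.comp_injective h2).congr fun n => ?_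
  simp

/-- In a strip `|a n|` is comparable with the index of its grid column, and each column holds
boundedly many terms, so the series is dominated by a multiple of `∑ 1 / i ^ 2`. -/
theorem AsymptoticallySeparated.summable_inv_sq (hsep : AsymptoticallySeparated a) {H : ℝ}
    (him : ∀ n, 1 ≤ n → |(a n).im| ≤ H) (k : ℤ) :
    Summable fun n : Set.Ici k => ‖a n‖⁻¹ ^ 2 := by
  obtain ⟨η, hη, -, T, n₀, hn₀, hT, hinj⟩ := hsep.exists_grid him one_pos
  have hs : Summable fun i : ℤ => 4 / η ^ 2 * (1 / (i : ℝ) ^ 2) :=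
    (Real.summable_one_div_int_pow.2 one_lt_two).mul_left _
  have h1 := summable_comp_of_injOn_prod hs (fun _ => by positivity) hT hinj
  refine summable_Ici_of_summable_Ici (f := fun n => ‖a n‖⁻¹ ^ 2) (k := n₀)
    (h1.of_norm_bounded_eventually ?_)
  -- Outside this finite set `|Re a n| > 2 η`, which excludes the column `i = 0`; there the majorant
  -- takes the default value `1 / 0 = 0`.
  have hfin : {n : Set.Ici n₀ | ‖a n‖ ≤ 2 * η + H}.Finite := by
    refine Set.Finite.of_finite_image ((hsep.finite_norm_le him (2 * η + H)).subset ?_)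
      Subtype.val_injective.injOn
    rintro _ ⟨n, hn, rfl⟩
    exact ⟨hn₀.trans n.2, hn⟩
  filter_upwards [hfin.compl_mem_cofinite] with n hn
  simp only [Set.mem_compl_iff, Set.mem_ofPred_eq, not_le] at hn
  have e1 := Complex.norm_le_abs_re_add_abs_im (a n)
  have e2 := him n (hn₀.trans n.2)
  have e3 := Complex.abs_re_le_norm (a n)
  set i := ⌊(a n).re / η⌋ with hi
  have e4 : (i : ℝ) * η ≤ (a n).re := (le_div_iff₀ hη).1 (Int.floor_le _)
  have e5 : (a n).re < (i + 1) * η := (div_lt_iff₀ hη).1 (Int.lt_floor_add_one _)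
  have hre : 2 * η < |(a n).re| := by linarith
  have e6 : |(i : ℝ)| * η ≤ 2 * |(a n).re| := by
    rw [show |(i : ℝ)| * η = |(i : ℝ) * η| by rw [abs_mul, abs_of_pos hη]]
    have h2 : |(i : ℝ) * η - (a n).re| ≤ η := by rw [abs_le]; constructor <;> nlinarith
    have := abs_sub_abs_le_abs_sub ((i : ℝ) * η) (a n).re
    linarith
  have e7 : 0 < |(i : ℝ)| := by
    rw [abs_pos]
    intro h0
    rw [h0] at e4 e5
    have : |(a n).re| ≤ η := abs_le.2 ⟨by linarith, by linarith⟩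
    linarith
  have hpos : 0 < ‖a n‖ := by linarith
  rw [Real.norm_of_nonneg (by positivity), ← sq_abs (i : ℝ), ← one_div, one_div_pow,
    div_mul_div_comm, mul_one, div_le_div_iff₀ (by positivity) (by positivity)]
  have : |(i : ℝ)| * η ≤ 2 * ‖a n‖ := by linarith
  nlinarith [mul_self_le_mul_self (by positivity) this]

/-- Far from the origin, a circle of radius `ε` about one term enters no other disc: late terms are
at distance `δ ≥ 2 ε` from each other, and the early ones are bounded. This lets the maximum
principle carry bounds into the discs. -/
theorem AsymptoticallySeparated.exists_sphere_off_discs (hsep : AsymptoticallySeparated a) :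
    ∃ δ : ℝ, 0 < δ ∧ ∃ n₀ : ℤ, 1 ≤ n₀ ∧
      (∀ n k, n₀ ≤ n → n₀ ≤ k → n ≠ k → δ ≤ ‖a n - a k‖) ∧
      ∀ ε, 0 < ε → 2 * ε ≤ δ → ∃ R : ℝ, ∀ n, 1 ≤ n → ∀ w : ℂ, R ≤ ‖w‖ → ‖w - a n‖ = ε →
        ∀ k, 1 ≤ k → ε ≤ ‖w - a k‖ := by
  obtain ⟨n₀, hn₀, δ, hδ, hsep⟩ := hsep
  refine ⟨δ, hδ, n₀, hn₀, hsep, fun ε hε hεδ => ⟨∑ j ∈ Finset.Ico 1 n₀, ‖a j‖ + ε + 1, ?_⟩⟩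
  have hfew : ∀ w : ℂ, ∑ j ∈ Finset.Ico 1 n₀, ‖a j‖ + ε + 1 ≤ ‖w‖ →
      ∀ k, 1 ≤ k → k < n₀ → ε < ‖w - a k‖ := by
    intro w hw k hk hk'
    have h1 : ‖a k‖ ≤ ∑ j ∈ Finset.Ico 1 n₀, ‖a j‖ :=
      Finset.single_le_sum (f := fun j => ‖a j‖) (fun _ _ => norm_nonneg _)
        (Finset.mem_Ico.2 ⟨hk, hk'⟩)
    have h2 := norm_sub_norm_le w (a k)
    linarith
  intro n hn w hw hwn k hk
  rcases lt_or_ge k n₀ with hk' | hk'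
  · exact (hfew w hw k hk hk').le
  rcases lt_or_ge n n₀ with hn' | hn'
  · exact absurd hwn (hfew w hw n hn hn').ne'
  rcases eq_or_ne n k with rfl | hnk
  · exact hwn.ge
  · have h1 := hsep n k hn' hk' hnk
    have h2 := norm_sub_le_norm_sub_add_norm_sub (a n) w (a k)
    rw [norm_sub_rev (a n) w] at h2
    linarith

/-- A polynomial bound off small discs around the terms of a separated sequence is a polynomial
bound on the whole plane. -/
theorem exists_norm_le_of_off_discs {ε R' : ℝ} (hε : 0 < ε)
    (hsph : ∀ n, 1 ≤ n → ∀ w : ℂ, R' ≤ ‖w‖ → ‖w - a n‖ = ε → ∀ k, 1 ≤ k → ε ≤ ‖w - a k‖)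
    {g : ℂ → ℂ} (hg : Differentiable ℂ g) {R C : ℝ} {k : ℕ}
    (h : ∀ z, R ≤ ‖z‖ → (∀ n, 1 ≤ n → ε ≤ ‖z - a n‖) → ‖g z‖ ≤ C * (1 + ‖z‖) ^ k) :
    ∃ C' : ℝ, ∀ z, ‖g z‖ ≤ C' * (1 + ‖z‖) ^ k := by
  set R₁ := max R R' + 2 * ε
  obtain ⟨M, hM⟩ := (isCompact_closedBall (0 : ℂ) R₁).exists_bound_of_continuousOn
    hg.continuous.continuousOn
  refine ⟨|M| + |C| * (1 + 2 * ε) ^ k, fun z => ?_⟩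
  have hz1 : 1 ≤ (1 + ‖z‖) ^ k := one_le_pow₀ (by linarith [norm_nonneg z])
  have hC : 0 ≤ |C| * (1 + 2 * ε) ^ k := by positivity
  rcases le_or_gt ‖z‖ R₁ with hz | hz
  · have := hM z (by simpa using hz)
    nlinarith [le_abs_self M, abs_nonneg M]
  have hRz : max R R' + 2 * ε < ‖z‖ := hz
  have hgen : ∀ w : ℂ, R ≤ ‖w‖ → (∀ n, 1 ≤ n → ε ≤ ‖w - a n‖) → ‖w‖ ≤ ‖z‖ + 2 * ε →
      ‖g w‖ ≤ |C| * (1 + 2 * ε) ^ k * (1 + ‖z‖) ^ k := by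
    intro w hw hw' hwz
    refine (h w hw hw').trans ?_
    rw [mul_assoc, ← mul_pow]
    gcongr
    · exact le_abs_self C
    · nlinarith [norm_nonneg z]
  have hmain : ‖g z‖ ≤ |C| * (1 + 2 * ε) ^ k * (1 + ‖z‖) ^ k := by
    by_cases hoff : ∀ n, 1 ≤ n → ε ≤ ‖z - a n‖
    · exact hgen z (by linarith [le_max_left R R']) hoff (by linarith)
    push Not at hoff
    obtain ⟨n, hn, hzn⟩ := hoff
    -- Inside an excluded disc the maximum principle applies, its boundary circle being an
    -- admissible place for the hypothesis.
    refine Complex.norm_le_of_forall_mem_frontier_norm_le (U := Metric.ball (a n) ε)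
      Metric.isBounded_ball hg.diffContOnCl ?_ (subset_closure (by simpa [dist_eq_norm] using hzn))
    intro w hw
    rw [frontier_ball _ hε.ne', mem_sphere_iff_norm] at hw
    have h1 : ‖w - z‖ ≤ 2 * ε := by
      have := norm_sub_le_norm_sub_add_norm_sub w (a n) z
      rw [norm_sub_rev (a n) z] at this
      linarith
    have h2 := norm_sub_norm_le z w
    rw [norm_sub_rev] at h2
    have h3 := norm_sub_norm_le w z
    exact hgen w (by linarith [le_max_left R R'])
      (hsph n hn w (by linarith [le_max_right R R']) hw) (by linarith)
  nlinarith [abs_nonneg M]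

end SeparatedSequences

/-! ### Enumerated zeros and finiteness of the order. -/

section ZeroEnumerations

theorem EnumeratesZeros.apply_eq_zero {f : ℂ → ℂ} {I : Set ℤ} {a : ℤ → ℂ}
    (h : EnumeratesZeros f I a) {n : ℤ} (hn : n ∈ I) : f (a n) = 0 := by
  refine apply_eq_zero_of_analyticOrderAt_ne_zero fun h0 => ?_
  rw [← h (a n), Set.encard_eq_zero] at h0
  exact (Set.eq_empty_iff_forall_notMem.1 h0 n) ⟨hn, rfl⟩

theorem Differentiable.analyticOrderAt_ne_top {f : ℂ → ℂ} (hf : Differentiable ℂ f) {z : ℂ}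
    (hz : f z ≠ 0) (c : ℂ) : analyticOrderAt f c ≠ ⊤ := by
  intro h
  have hf' : AnalyticOnNhd ℂ f Set.univ := fun z _ => hf.analyticAt z
  rw [analyticOrderAt_eq_top] at h
  exact hz (congrFun (hf'.eq_of_eventuallyEq (g := 0) (fun _ _ => analyticAt_const) h) z)

end ZeroEnumerations

/-! ### Upper and lower bounds for sine-type functions. -/

section SineType

variable {b : ℝ} {S₀ : ℂ → ℂ} {a : ℤ → ℂ}

/-- Outside a strip the bound is part of the definition; inside it, exponential type is far below
the growth allowed by Phragmén–Lindelöf, so the bound on the two boundary lines extends. -/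
theorem IsSineType.exists_norm_le (hS₀ : IsSineType b S₀) (hb : 0 < b) :
    ∃ C : ℝ, 0 < C ∧ ∀ z, ‖S₀ z‖ ≤ C * Real.exp (b * |z.im|) := by
  obtain ⟨A, B, hAB⟩ := hS₀.exponentialType
  obtain ⟨c, C, K, hc, hC, hK, h⟩ := hS₀.twoSided
  have hout : ∀ z : ℂ, K < |z.im| → ‖S₀ z‖ ≤ C * Real.exp (b * |z.im|) := by
    intro z hz
    have := (h z hz).2.le
    rwa [neg_mul, Real.exp_neg, ← div_eq_mul_inv, div_le_iff₀ (Real.exp_pos _), mul_comm _ b] at this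
  set K' := K + 1
  have hK' : 0 < K' := by positivity
  have hA : 0 ≤ A := by
    have := (norm_nonneg _).trans (hAB 0)
    simpa using this
  refine ⟨C * Real.exp (b * K'), by positivity, fun z => ?_⟩
  rcases lt_or_ge K |z.im| with hz | hz
  · refine (hout z hz).trans ?_
    gcongr
    exact le_mul_of_one_le_right hC.le (Real.one_le_exp (by positivity))
  refine le_trans ?_ (le_mul_of_one_le_right (by positivity) (Real.one_le_exp (by positivity)))
  have hline : ∀ w : ℂ, |w.im| = K' → ‖S₀ w‖ ≤ C * Real.exp (b * K') := by
    intro w hw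
    have := hout w (by rw [hw]; exact lt_add_one K)
    rwa [hw] at this
  have hz' := abs_le.1 (hz.trans (lt_add_one K).le)
  refine PhragmenLindelof.horizontal_strip (a := -K') (b := K') hS₀.entire.diffContOnCl ?_
    (fun w hw => hline w (by rw [hw, abs_neg, abs_of_pos hK']))
    (fun w hw => hline w (by rw [hw, abs_of_pos hK'])) hz'.1 hz'.2
  -- Half of the critical rate `π / (2 K')` for a strip of width `2 K'`.
  have hd : 0 < Real.pi / (4 * K') := by positivity
  set d := Real.pi / (4 * K') with hdd
  refine ⟨d, ?_, |B| * (1 / d + K'), ?_⟩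
  · rw [hdd]
    exact div_lt_div_of_pos_left Real.pi_pos (by linarith) (by linarith)
  refine Asymptotics.IsBigO.of_bound A ?_
  filter_upwards [mem_inf_of_right (mem_principal_self _)] with w hw
  simp only [Set.mem_preimage, Set.mem_Ioo] at hw
  rw [Real.norm_of_nonneg (Real.exp_pos _).le]
  refine (hAB w).trans ?_
  refine mul_le_mul_of_nonneg_left (Real.exp_le_exp.2 ?_) hA
  have h1 : ‖w‖ ≤ |w.re| + K' :=
    (Complex.norm_le_abs_re_add_abs_im w).trans (by gcongr; exact (abs_lt.2 hw).le)
  have h2 : d * |w.re| ≤ Real.exp (d * |w.re|) := by linarith [Real.add_one_le_exp (d * |w.re|)]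
  have h3 : 1 ≤ Real.exp (d * |w.re|) := Real.one_le_exp (by positivity)
  have h4 : |w.re| ≤ 1 / d * Real.exp (d * |w.re|) := by
    rw [one_div, ← div_eq_inv_mul, le_div_iff₀ hd]
    linarith
  calc B * ‖w‖ ≤ |B| * (|w.re| + K') :=
        mul_le_mul (le_abs_self B) h1 (norm_nonneg _) (abs_nonneg _)
    _ ≤ |B| * (1 / d * Real.exp (d * |w.re|) + K' * Real.exp (d * |w.re|)) := by
        gcongr
        exact le_mul_of_one_le_right hK'.le h3
    _ = _ := by ring

theorem IsSineType.exists_abs_im_le (hS₀ : IsSineType b S₀)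
    (hz : EnumeratesZeros S₀ (Set.Ici 1) a) : ∃ H : ℝ, ∀ n, 1 ≤ n → |(a n).im| ≤ H := by
  obtain ⟨c, C, K, hc, hC, hK, h⟩ := hS₀.twoSided
  refine ⟨K, fun n hn => ?_⟩
  by_contra! hlt
  have := (h _ hlt).1
  rw [hz.apply_eq_zero hn] at this
  simp at this
  linarith

open scoped Classical in
/-- Dividing an entire function by its zeros in a disc. -/
theorem EnumeratesZeros.exists_eq_prod_mul {f : ℂ → ℂ} (hf : Differentiable ℂ f)
    {I : Set ℤ} (h : EnumeratesZeros f I a) (E : Finset ℤ)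
    (hE : ∀ n ∈ E, n ∈ I) :
    ∃ G : ℂ → ℂ, Differentiable ℂ G ∧ (∀ z, f z = (∏ n ∈ E, (z - a n)) * G z) ∧
      ∀ c, (∀ n ∈ I, a n = c → n ∈ E) → G c ≠ 0 := by
  have hQ : Differentiable ℂ fun z => ∏ n ∈ E, (z - a n) := by fun_prop
  have hQo := analyticOrderAt_prod_sub E a
  have hle : ∀ c, analyticOrderAt (fun z => ∏ n ∈ E, (z - a n)) c ≤ analyticOrderAt f c := by
    intro c
    rw [hQo, ← h c, ← Set.encard_coe_eq_coe_finsetCard]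
    refine Set.encard_le_encard fun n hn => ?_
    simp only [Finset.coe_filter, Set.mem_ofPred_eq] at hn
    exact ⟨hE n hn.1, hn.2⟩
  obtain ⟨G, hG, hfG⟩ := exists_differentiable_mul_eq hf hQ
    (fun c => by rw [hQo]; exact ENat.natCast_ne_top _) hle
  refine ⟨G, hG, hfG, fun c hc => ?_⟩
  have hmul : analyticOrderAt f c = analyticOrderAt (fun z => ∏ n ∈ E, (z - a n)) c +
      analyticOrderAt G c := by
    rw [← analyticOrderAt_mul (hQ.analyticAt c) (hG.analyticAt c)]
    congr 1
    exact funext hfG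
  have heq : analyticOrderAt f c = analyticOrderAt (fun z => ∏ n ∈ E, (z - a n)) c := by
    rw [hQo, ← h c, ← Set.encard_coe_eq_coe_finsetCard]
    congr 1
    ext n
    simp only [Finset.coe_filter, Set.mem_ofPred_eq]
    exact ⟨fun hn => ⟨hc n hn.1 hn.2, hn.2⟩, fun hn => ⟨hE n hn.1, hn.2⟩⟩
  rw [heq] at hmul
  have h0 : analyticOrderAt G c = 0 := by
    have hfin : analyticOrderAt (fun z => ∏ n ∈ E, (z - a n)) c ≠ ⊤ := by
      rw [hQo]; exact ENat.natCast_ne_top _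
    exact ENat.add_right_injective_of_ne_top hfin (hmul.symm.trans (add_zero _).symm)
  exact (hG.analyticAt c).analyticOrderAt_eq_zero.1 h0

/-- A sine-type function is bounded below off small discs around its zeros. -/
theorem IsSineType.exists_le_norm (hS₀ : IsSineType b S₀) (hb : 0 < b)
    (hz : EnumeratesZeros S₀ (Set.Ici 1) a) (hsep : AsymptoticallySeparated a) {ε : ℝ}
    (hε : 0 < ε) :
    ∃ c : ℝ, 0 < c ∧ ∀ z, (∀ n, 1 ≤ n → ε ≤ ‖z - a n‖) → c * Real.exp (b * |z.im|) ≤ ‖S₀ z‖ := by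
  obtain ⟨H, him⟩ := hS₀.exists_abs_im_le hz
  obtain ⟨C, hC, hup⟩ := hS₀.exists_norm_le hb
  obtain ⟨c, C', K, hc, hC', hK, h⟩ := hS₀.twoSided
  have hout : ∀ z : ℂ, K < |z.im| → c * Real.exp (b * |z.im|) ≤ ‖S₀ z‖ := by
    intro z hz
    have := (h z hz).1.le
    rwa [neg_mul, Real.exp_neg, ← div_eq_mul_inv, le_div_iff₀ (Real.exp_pos _), mul_comm _ b] at this
  -- With `p = Re z + (K + 1) i`, a point of the region where `S₀` is bounded below, any `z` of the
  -- strip satisfies `|z - p| ≤ 2 K + 1 < R / 2`.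
  set R := 4 * K + 4 with hRdef
  have hR1 : 1 ≤ R := by linarith
  have hR : 0 < R := by linarith
  obtain ⟨m, hm⟩ := hsep.exists_encard_le him R
  set M := C * Real.exp (b * (K + 1 + 2 * R)) with hMdef
  set μ := c / R ^ m with hμdef
  have hμ : 0 < μ := by positivity
  -- With `ε' ≤ 1`, a product of at most `m` factors, each at least `ε'`, is at least `ε' ^ m`.
  set ε' := min ε 1
  have hε' : 0 < ε' := lt_min hε one_pos
  set low := ε' ^ m * (μ * Real.exp (-(2 * (Real.log (M / μ) + 1))))
  have hlow : 0 < low := by positivity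
  refine ⟨min c (low * Real.exp (-(b * K))), by positivity, fun z hzoff => ?_⟩
  rcases lt_or_ge K |z.im| with hzK | hzK
  · refine le_trans ?_ (hout z hzK)
    gcongr
    exact min_le_left _ _
  have hgoal : low ≤ ‖S₀ z‖ := by
    set p : ℂ := ⟨z.re, K + 1⟩ with hp
    have hpim : |p.im| = K + 1 := abs_of_pos (by linarith : (0 : ℝ) < K + 1)
    have hSp : c ≤ ‖S₀ p‖ := by
      refine le_trans ?_ (hout p (by rw [hpim]; linarith))
      exact le_mul_of_one_le_right hc.le (Real.one_le_exp (by positivity))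
    have hzp : z ∈ Metric.ball p (R / 2) := by
      rw [Metric.mem_ball, dist_eq_norm]
      have := Complex.norm_le_abs_re_add_abs_im (z - p)
      simp only [hp, Complex.sub_re, Complex.sub_im, sub_self, abs_zero, zero_add] at this
      have h2 := abs_le.1 hzK
      have h3 : |z.im - (K + 1)| ≤ 2 * K + 1 := abs_le.2 ⟨by linarith, by linarith⟩
      linarith
    set U := {n : ℤ | 1 ≤ n ∧ ‖a n - p‖ ≤ R} with hU
    have hfin : U.Finite := Set.finite_of_encard_le_coe (hm p)
    have hcard : hfin.toFinset.card ≤ m := by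
      have := hm p
      rw [← hU, hfin.encard_eq_coe_toFinset_card] at this
      exact_mod_cast this
    set E := hfin.toFinset
    have hE : ∀ n, n ∈ E ↔ 1 ≤ n ∧ ‖a n - p‖ ≤ R := fun n => hfin.mem_toFinset
    -- Dividing by the zeros in the disc leaves a zero-free `G`. It is bounded by the maximum
    -- principle on the circle of radius `2 R`, where every removed factor is at least `R ≥ 1`, and
    -- it is bounded below at `p`; so `le_norm_of_ne_zero_on_ball` bounds it below at `z`,
    -- uniformly.
    obtain ⟨G, hG, hfG, hG0⟩ := hz.exists_eq_prod_mul hS₀.entire E fun n hn => ((hE n).1 hn).1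
    have hGbd : ∀ w ∈ Metric.ball p R, ‖G w‖ ≤ M := by
      intro w hw
      refine Complex.norm_le_of_forall_mem_frontier_norm_le (U := Metric.ball p (2 * R))
        Metric.isBounded_ball hG.diffContOnCl ?_
        (subset_closure (Metric.ball_subset_ball (by linarith) hw))
      intro v hv
      rw [frontier_ball _ (by positivity), mem_sphere_iff_norm] at hv
      have hprod : 1 ≤ ‖∏ n ∈ E, (v - a n)‖ := by
        rw [norm_prod]
        refine Finset.one_le_prod fun n hn => ?_
        have h1 := ((hE n).1 hn).2
        have h2 := norm_sub_le_norm_sub_add_norm_sub v (a n) p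
        linarith
      have hv2 : ‖S₀ v‖ ≤ M := by
        refine (hup v).trans ?_
        have h1 : |v.im| ≤ K + 1 + 2 * R := by
          have h1 := (Complex.abs_im_le_norm (v - p)).trans hv.le
          rw [Complex.sub_im] at h1
          have h2 := abs_sub_abs_le_abs_sub v.im p.im
          linarith
        rw [hMdef]
        gcongr
      rw [hfG, norm_mul] at hv2
      exact (le_mul_of_one_le_left (norm_nonneg _) hprod).trans hv2
    have hGp : μ ≤ ‖G p‖ := by
      rw [hfG, norm_mul, norm_prod] at hSp
      have h1 : ∏ n ∈ E, ‖p - a n‖ ≤ R ^ m := by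
        refine (Finset.prod_le_prod (g := fun _ => R) (fun _ _ => norm_nonneg _)
          fun n hn => ?_).trans ?_
        · rw [norm_sub_rev]; exact ((hE n).1 hn).2
        · rw [Finset.prod_const]; exact pow_le_pow_right₀ hR1 hcard
      rw [hμdef, div_le_iff₀ (by positivity), mul_comm]
      exact hSp.trans (mul_le_mul_of_nonneg_right h1 (norm_nonneg _))
    have hGz := le_norm_of_ne_zero_on_ball hR hμ hG.differentiableOn (fun w hw => hG0 w ?_) hGbd
      hGp hzp
    · rw [hfG, norm_mul, norm_prod]
      refine mul_le_mul ?_ hGz (by positivity) (Finset.prod_nonneg fun _ _ => norm_nonneg _)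
      calc ε' ^ m ≤ ε' ^ E.card := pow_le_pow_of_le_one hε'.le (min_le_right _ _) hcard
        _ = ∏ n ∈ E, ε' := by rw [Finset.prod_const]
        _ ≤ _ := Finset.prod_le_prod (fun _ _ => hε'.le) fun n hn =>
            (min_le_left _ _).trans (hzoff n ((hE n).1 hn).1)
    · intro n hn hnw
      rw [hE]
      refine ⟨hn, ?_⟩
      rw [hnw, ← dist_eq_norm]
      exact (Metric.mem_ball.1 hw).le
  calc min c (low * Real.exp (-(b * K))) * Real.exp (b * |z.im|)
      ≤ low * Real.exp (-(b * K)) * Real.exp (b * K) := by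
        gcongr
        exact min_le_right _ _
    _ = low := by rw [mul_assoc, ← Real.exp_add]; simp
    _ ≤ _ := hgoal

end SineType

/-! ### The integral term: Parseval, Plancherel–Pólya and decay. -/

noncomputable section

/-- The integral `∫_{-b}^b w x exp (i z x) dx` as a function of `z`. -/
def expIntegral (b : ℝ) (w : ℝ → ℂ) (z : ℂ) : ℂ :=
  ∫ x in Set.Ioo (-b) b, w x * Complex.exp (Complex.I * z * (x : ℂ))

section ExpIntegral

variable {b : ℝ} {w : ℝ → ℂ}

theorem norm_cexp_I_mul (z : ℂ) (x : ℝ) :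
    ‖Complex.exp (Complex.I * z * x)‖ = Real.exp (-(z.im * x)) := by
  rw [Complex.norm_exp]
  simp

theorem norm_cexp_I_mul_le (z : ℂ) (x : ℝ) :
    ‖Complex.exp (Complex.I * z * x)‖ ≤ Real.exp (|z.im| * |x|) := by
  rw [norm_cexp_I_mul, Real.exp_le_exp, ← abs_mul]
  exact neg_le_abs _

theorem memLp_integrable (hw : MemLp w 2 (volume.restrict (Set.Ioo (-b) b))) :
    IntegrableOn w (Set.Ioo (-b) b) :=
  hw.integrable (by norm_num)

theorem integrableOn_mul_cexp (hw : IntegrableOn w (Set.Ioo (-b) b)) (z : ℂ) :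
    IntegrableOn (fun x : ℝ => w x * Complex.exp (Complex.I * z * x)) (Set.Ioo (-b) b) := by
  refine Integrable.mul_bdd (c := Real.exp (|z.im| * b)) hw (by fun_prop) ?_
  filter_upwards [ae_restrict_mem measurableSet_Ioo] with x hx
  refine (norm_cexp_I_mul_le z x).trans ?_
  gcongr
  exact (abs_lt.2 hx).le

theorem norm_expIntegral_le (hw : IntegrableOn w (Set.Ioo (-b) b)) (z : ℂ) :
    ‖expIntegral b w z‖ ≤ ∫ x in Set.Ioo (-b) b, ‖w x‖ * Real.exp (|z.im| * |x|) := by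
  refine norm_integral_le_of_norm_le ?_ ?_
  · refine Integrable.mul_bdd (c := Real.exp (|z.im| * b)) hw.norm (by fun_prop) ?_
    filter_upwards [ae_restrict_mem measurableSet_Ioo] with x hx
    rw [Real.norm_of_nonneg (Real.exp_pos _).le]
    gcongr
    exact (abs_lt.2 hx).le
  · filter_upwards [ae_restrict_mem measurableSet_Ioo] with x hx
    rw [norm_mul]
    gcongr
    exact norm_cexp_I_mul_le z x

/-- Taylor expansion about `z`; the derivatives are integrals of the same kind, with `w` multiplied
by powers of `i x`. It carries estimates on a lattice to nearby points. -/
theorem hasSum_expIntegral (hb : 0 < b) (hw : IntegrableOn w (Set.Ioo (-b) b)) (z h : ℂ) :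
    HasSum (fun j : ℕ => h ^ j / (j.factorial : ℂ) *
      expIntegral b (fun x => (Complex.I * x) ^ j * w x) z) (expIntegral b w (z + h)) := by
  have hint : ∀ j : ℕ, IntegrableOn (fun x : ℝ => (Complex.I * x) ^ j * w x) (Set.Ioo (-b) b) := by
    intro j
    refine Integrable.bdd_mul (c := b ^ j) hw (by fun_prop) ?_
    filter_upwards [ae_restrict_mem measurableSet_Ioo] with x hx
    rw [norm_pow, norm_mul, Complex.norm_I, one_mul, Complex.norm_real]
    exact pow_le_pow_left₀ (norm_nonneg _) (abs_lt.2 hx).le j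
  have key := hasSum_integral_of_dominated_convergence (μ := volume.restrict (Set.Ioo (-b) b))
    (F := fun (j : ℕ) (x : ℝ) => h ^ j / (j.factorial : ℂ) *
      ((Complex.I * x) ^ j * w x * Complex.exp (Complex.I * z * x)))
    (f := fun x : ℝ => w x * Complex.exp (Complex.I * (z + h) * x))
    (fun (j : ℕ) (x : ℝ) => (‖h‖ * b) ^ j / (j.factorial : ℝ) * (Real.exp (|z.im| * b) * ‖w x‖))
    (fun j => ((integrableOn_mul_cexp (hint j) z).const_mul _).aestronglyMeasurable) ?_ ?_ ?_ ?_
  · simp only [integral_const_mul] at key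
    exact key
  · intro j
    filter_upwards [ae_restrict_mem measurableSet_Ioo] with x hx
    have hxb : |x| ≤ b := (abs_lt.2 hx).le
    have e1 := norm_cexp_I_mul_le z x
    have e2 : Real.exp (|z.im| * |x|) ≤ Real.exp (|z.im| * b) := by gcongr
    rw [norm_mul, norm_mul, norm_mul, norm_div, norm_pow, norm_pow, norm_mul, Complex.norm_I,
      one_mul, Complex.norm_real, Complex.norm_natCast, Real.norm_eq_abs]
    calc ‖h‖ ^ j / (j.factorial : ℝ) * (|x| ^ j * ‖w x‖ * ‖Complex.exp (Complex.I * z * x)‖)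
        ≤ ‖h‖ ^ j / (j.factorial : ℝ) * (b ^ j * ‖w x‖ * Real.exp (|z.im| * b)) := by
          gcongr
          exact e1.trans e2
      _ = _ := by rw [mul_pow]; ring
  · refine .of_forall fun x => ?_
    exact (Real.summable_pow_div_factorial (‖h‖ * b)).mul_right _
  · simp only [tsum_mul_right]
    exact (hw.norm.const_mul _).const_mul _
  · refine .of_forall fun x => ?_
    have h1 := (NormedSpace.expSeries_div_hasSum_exp (𝔸 := ℂ) (h * (Complex.I * x))).mul_right
      (w x * Complex.exp (Complex.I * z * x))
    rw [← Complex.exp_eq_exp_ℂ] at h1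
    rw [show w x * Complex.exp (Complex.I * (z + h) * x) =
      Complex.exp (h * (Complex.I * x)) * (w x * Complex.exp (Complex.I * z * x)) by
        rw [show Complex.I * (z + h) * x = h * (Complex.I * x) + Complex.I * z * x by ring,
          Complex.exp_add]
        ring]
    exact Eq.mp (congrArg (HasSum · _) (funext fun j => by rw [mul_pow]; ring)) h1

theorem differentiable_expIntegral (hw : IntegrableOn w (Set.Ioo (-b) b)) :
    Differentiable ℂ (expIntegral b w) := by
  intro z
  have hmeas : ∀ ζ : ℂ, AEStronglyMeasurable (fun x : ℝ => w x * Complex.exp (Complex.I * ζ * x))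
      (volume.restrict (Set.Ioo (-b) b)) := fun ζ => (integrableOn_mul_cexp hw ζ).aestronglyMeasurable
  have := (hasDerivAt_integral_of_dominated_loc_of_deriv_le (𝕜 := ℂ)
    (μ := volume.restrict (Set.Ioo (-b) b)) (x₀ := z) (s := Metric.ball z 1)
    (F := fun ζ x => w x * Complex.exp (Complex.I * ζ * x))
    (F' := fun ζ x => w x * (Complex.exp (Complex.I * ζ * x) * (Complex.I * x)))
    (bound := fun x => ‖w x‖ * (Real.exp ((|z.im| + 1) * b) * b))
    (Metric.ball_mem_nhds z one_pos) (.of_forall hmeas) (integrableOn_mul_cexp hw z) ?_ ?_ ?_ ?_).2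
  · exact this.differentiableAt
  · refine (((hmeas z).mul (g := fun x : ℝ => Complex.I * (x : ℂ))
      (by fun_prop : Continuous fun x : ℝ => Complex.I * (x : ℂ)).aestronglyMeasurable)).congr ?_
    exact .of_forall fun x => by simp only [Pi.mul_apply]; ring
  · filter_upwards [ae_restrict_mem measurableSet_Ioo] with x hx ζ hζ
    have hxb : |x| ≤ b := (abs_lt.2 hx).le
    have him : |ζ.im| ≤ |z.im| + 1 := by
      have h1 := (Complex.abs_im_le_norm (ζ - z)).trans (mem_ball_iff_norm.1 hζ).le
      rw [Complex.sub_im] at h1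
      linarith [abs_sub_abs_le_abs_sub ζ.im z.im]
    rw [norm_mul, norm_mul, norm_mul, Complex.norm_I, one_mul, Complex.norm_real, Real.norm_eq_abs]
    gcongr
    refine (norm_cexp_I_mul_le ζ x).trans ?_
    gcongr
  · exact hw.norm.mul_const _
  · refine .of_forall fun x ζ _ => ?_
    have h1 : HasDerivAt (fun ζ : ℂ => Complex.I * ζ * x) (Complex.I * x) ζ := by
      simpa using ((hasDerivAt_id ζ).const_mul Complex.I).mul_const (x : ℂ)
    exact h1.cexp.const_mul (w x)

/-- Extend `w` by zero to an interval of half-length `L = π / η ≥ b`: the values at the points `η k`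
are `2 L` times its Fourier coefficients, and this is Parseval's identity. -/
theorem summable_sq_norm_expIntegral (hw : MemLp w 2 (volume.restrict (Set.Ioo (-b) b)))
    (hb : 0 < b) {η : ℝ} (hη : 0 < η) (hηb : η * b ≤ Real.pi) :
    HasSum (fun k : ℤ => ‖expIntegral b w (η * k)‖ ^ 2)
      (2 * (Real.pi / η) * ∫ x in Set.Ioo (-b) b, ‖w x‖ ^ 2) := by
  have hL : b ≤ Real.pi / η := by rw [le_div_iff₀ hη]; linarith
  set L := Real.pi / η with hLdef
  have hL0 : 0 < L := by positivity
  have hLL : -L < L := by linarith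
  have hsub : Set.Ioo (-b) b ⊆ Set.Ioc (-L) L := fun x hx => ⟨by linarith [hx.1], by linarith [hx.2]⟩
  set W := (Set.Ioo (-b) b).indicator w with hW
  have hWL : MemLp W 2 (volume.restrict (Set.Ioc (-L) L)) :=
    ((memLp_indicator_iff_restrict measurableSet_Ioo).2 hw).restrict _
  have hs := hasSum_sq_fourierCoeffOn hLL hWL
  have hcoef : ∀ k : ℤ, fourierCoeffOn hLL W (-k) =
      ((1 / (2 * L) : ℝ) : ℂ) * expIntegral b w (η * k) := by
    intro k
    rw [fourierCoeffOn_eq_integral, intervalIntegral.integral_of_le hLL.le, neg_neg,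
      show L - -L = 2 * L by ring, Complex.real_smul, expIntegral]
    congr 1
    have h1 : ∀ x : ℝ, fourier k (x : AddCircle (2 * L)) • W x =
        (Set.Ioo (-b) b).indicator
          (fun x : ℝ => w x * Complex.exp (Complex.I * (η * k) * x)) x := by
      intro x
      rw [fourier_coe_apply, hW]
      by_cases hx : x ∈ Set.Ioo (-b) b
      · rw [Set.indicator_of_mem hx, Set.indicator_of_mem hx, smul_eq_mul, mul_comm]
        congr 2
        rw [hLdef]
        have : (η : ℂ) ≠ 0 := by exact_mod_cast hη.ne'
        have : (Real.pi : ℂ) ≠ 0 := by exact_mod_cast Real.pi_ne_zero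
        push_cast
        field_simp
      · simp [Set.indicator_of_notMem hx]
    simp only [h1]
    rw [setIntegral_indicator measurableSet_Ioo, Set.inter_eq_right.2 hsub]
  have hint : ∫ x in (-L)..L, ‖W x‖ ^ 2 = ∫ x in Set.Ioo (-b) b, ‖w x‖ ^ 2 := by
    rw [intervalIntegral.integral_of_le hLL.le]
    have h1 : ∀ x : ℝ, ‖W x‖ ^ 2 = (Set.Ioo (-b) b).indicator (fun x : ℝ => ‖w x‖ ^ 2) x := by
      intro x
      rw [hW]
      by_cases hx : x ∈ Set.Ioo (-b) b
      · rw [Set.indicator_of_mem hx, Set.indicator_of_mem hx]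
      · simp [Set.indicator_of_notMem hx]
    simp only [h1]
    rw [setIntegral_indicator measurableSet_Ioo, Set.inter_eq_right.2 hsub]
  rw [hint, smul_eq_mul] at hs
  have hs2 := ((Equiv.neg ℤ).hasSum_iff.2 hs).mul_left ((2 * L) ^ 2)
  rw [show L - -L = 2 * L by ring] at hs2
  rw [show 2 * L * ∫ x in Set.Ioo (-b) b, ‖w x‖ ^ 2 =
    (2 * L) ^ 2 * ((2 * L)⁻¹ * ∫ x in Set.Ioo (-b) b, ‖w x‖ ^ 2) by field_simp]
  refine Eq.mp (congrArg (HasSum · _) (funext fun k => ?_)) hs2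
  simp only [Function.comp_apply, Equiv.neg_apply]
  rw [hcoef, norm_mul, Complex.norm_real, Real.norm_of_nonneg (by positivity)]
  field_simp

/-- A Plancherel–Pólya inequality. -/
theorem exists_summable_sq_norm_expIntegral_le
    (hw : MemLp w 2 (volume.restrict (Set.Ioo (-b) b))) (hb : 0 < b) {η : ℝ} (hη : 0 < η)
    (hηb : η * b ≤ Real.pi) {H : ℝ} (hH : 0 ≤ H) :
    ∃ G : ℤ → ℝ, Summable G ∧ (∀ k, 0 ≤ G k) ∧
      ∀ (k : ℤ) (z : ℂ), ‖z - η * k‖ ≤ H → ‖expIntegral b w z‖ ^ 2 ≤ G k := by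
  have hwj : ∀ j : ℕ, MemLp (fun x : ℝ => (Complex.I * x) ^ j * w x) 2
      (volume.restrict (Set.Ioo (-b) b)) ∧
      ∫ x in Set.Ioo (-b) b, ‖(Complex.I * x) ^ j * w x‖ ^ 2 ≤
        (b ^ 2) ^ j * ∫ x in Set.Ioo (-b) b, ‖w x‖ ^ 2 := by
    intro j
    have hbd : ∀ x ∈ Set.Ioo (-b) b, ‖(Complex.I * x) ^ j * w x‖ ≤ b ^ j * ‖w x‖ := by
      intro x hx
      rw [norm_mul, norm_pow, norm_mul, Complex.norm_I, one_mul, Complex.norm_real]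
      gcongr
      exact (abs_lt.2 hx).le
    have h1 : MemLp (fun x : ℝ => (Complex.I * x) ^ j * w x) 2
        (volume.restrict (Set.Ioo (-b) b)) := by
      refine (hw.norm.const_mul (b ^ j)).of_le ?_ ?_
      · exact (by fun_prop : Continuous fun x : ℝ => (Complex.I * x) ^ j).aestronglyMeasurable.mul
          hw.aestronglyMeasurable
      · filter_upwards [ae_restrict_mem measurableSet_Ioo] with x hx
        rw [Real.norm_of_nonneg (by positivity)]
        exact hbd x hx
    refine ⟨h1, ?_⟩
    rw [← integral_const_mul]
    refine integral_mono_ae (h1.integrable_norm_pow (by norm_num))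
      ((hw.integrable_norm_pow (by norm_num)).const_mul _) ?_
    filter_upwards [ae_restrict_mem measurableSet_Ioo] with x hx
    calc ‖(Complex.I * x) ^ j * w x‖ ^ 2 ≤ (b ^ j * ‖w x‖) ^ 2 := by
          gcongr
          exact hbd x hx
      _ = _ := by rw [mul_pow, ← pow_mul, ← pow_mul, mul_comm j 2]
  set A := ∫ x in Set.Ioo (-b) b, ‖w x‖ ^ 2
  set c : ℕ → ℤ → ℝ := fun j k => ‖expIntegral b (fun x => (Complex.I * x) ^ j * w x) (η * k)‖
  have hc : ∀ j, HasSum (fun k => c j k ^ 2) _ := fun j =>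
    summable_sq_norm_expIntegral (hwj j).1 hb hη hηb
  set p : ℕ → ℝ := fun j => H ^ j / (j.factorial : ℝ)
  have hp : ∀ j, 0 ≤ p j := fun j => by positivity
  have hps : Summable p := Real.summable_pow_div_factorial H
  -- For fixed `j`, Parseval bounds the sum over `k` by a constant times `b ^ (2 j)`; the weights `H
  -- ^ j / j!` make the sum over `j` converge.
  have hsum2 : Summable fun x : ℤ × ℕ => p x.2 * c x.2 x.1 ^ 2 := by
    rw [← (Equiv.prodComm ℕ ℤ).summable_iff]
    refine (summable_prod_of_nonneg fun x => mul_nonneg (hp x.1) (sq_nonneg _)).2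
      ⟨fun j => (hc j).summable.mul_left (p j), ?_⟩
    refine ((Real.summable_pow_div_factorial (H * b ^ 2)).mul_right
      (2 * (Real.pi / η) * A)).of_nonneg_of_le (fun j => tsum_nonneg fun k => ?_) fun j => ?_
    · exact mul_nonneg (hp j) (sq_nonneg _)
    · simp only [Equiv.prodComm_apply, Prod.swap_prod_mk]
      rw [tsum_mul_left, (hc j).tsum_eq]
      calc p j * (2 * (Real.pi / η) * ∫ x in Set.Ioo (-b) b, ‖(Complex.I * x) ^ j * w x‖ ^ 2)
          ≤ p j * (2 * (Real.pi / η) * ((b ^ 2) ^ j * A)) := by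
            have := hp j
            gcongr
            exact (hwj j).2
        _ = _ := by simp only [p]; rw [mul_pow]; ring
  -- This majorant comes from the Taylor series about `η k` and Cauchy–Schwarz with the weights `p
  -- j`.
  refine ⟨fun k => (∑' j, p j) * ∑' j, p j * c j k ^ 2, hsum2.prod.mul_left _,
    fun k => mul_nonneg (tsum_nonneg hp) (tsum_nonneg fun j => mul_nonneg (hp j) (sq_nonneg _)),
    fun k z hz => ?_⟩
  have hF := hasSum_expIntegral hb (memLp_integrable hw) (η * k) (z - η * k)
  rw [add_sub_cancel] at hF
  refine le_of_tendsto (hF.norm.pow 2) (.of_forall fun s => ?_)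
  have hk : Summable fun j => p j * c j k ^ 2 := hsum2.prod_factor k
  calc ‖∑ j ∈ s, (z - η * k) ^ j / (j.factorial : ℂ) *
        expIntegral b (fun x => (Complex.I * x) ^ j * w x) (η * k)‖ ^ 2
      ≤ (∑ j ∈ s, p j * c j k) ^ 2 := by
        gcongr
        refine norm_sum_le_of_le s fun j _ => ?_
        rw [norm_mul, norm_div, norm_pow, Complex.norm_natCast]
        simp only [p, c]
        gcongr
    _ ≤ (∑ j ∈ s, p j) * ∑ j ∈ s, p j * c j k ^ 2 :=
        Finset.sum_sq_le_sum_mul_sum_of_sq_le_mul s (fun j _ => hp j)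
          (fun j _ => mul_nonneg (hp j) (sq_nonneg _)) fun j _ => le_of_eq (by ring)
    _ ≤ _ := mul_le_mul (hps.sum_le_tsum s fun j _ => hp j)
        (hk.sum_le_tsum s fun j _ => mul_nonneg (hp j) (sq_nonneg _))
        (Finset.sum_nonneg fun j _ => mul_nonneg (hp j) (sq_nonneg _)) (tsum_nonneg hp)

/-- `∫_{-b}^b w x exp (i z x) dx = o (exp (b |Im z|))`. -/
theorem exists_norm_expIntegral_le (hw : MemLp w 2 (volume.restrict (Set.Ioo (-b) b)))
    (hb : 0 < b) {ε : ℝ} (hε : 0 < ε) :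
    ∃ R : ℝ, ∀ z : ℂ, R ≤ ‖z‖ → ‖expIntegral b w z‖ ≤ ε * Real.exp (b * |z.im|) := by
  have hwi := memLp_integrable hw
  -- With `t = |Im z|` this integral bounds `|F z| exp (-b t)`, so dominated convergence settles
  -- large `|Im z|`.
  have h1 : Tendsto (fun t : ℝ => ∫ x in Set.Ioo (-b) b, ‖w x‖ * Real.exp (-(t * (b - |x|))))
      atTop (𝓝 (∫ x in Set.Ioo (-b) b, (0 : ℝ))) := by
    refine tendsto_integral_filter_of_dominated_convergence (fun x => ‖w x‖) ?_ ?_ hwi.norm ?_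
    · refine .of_forall fun t => hwi.norm.aestronglyMeasurable.mul ?_
      exact (by fun_prop : Continuous fun x : ℝ => Real.exp (-(t * (b - |x|)))).aestronglyMeasurable
    · filter_upwards [eventually_ge_atTop 0] with t ht
      filter_upwards [ae_restrict_mem measurableSet_Ioo] with x hx
      rw [Real.norm_of_nonneg (by positivity)]
      refine mul_le_of_le_one_right (norm_nonneg _) (Real.exp_le_one_iff.2 ?_)
      have : |x| < b := abs_lt.2 hx
      have : 0 ≤ t * (b - |x|) := mul_nonneg ht (by linarith)
      linarith
    · filter_upwards [ae_restrict_mem measurableSet_Ioo] with x hx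
      have : 0 < b - |x| := sub_pos.2 (abs_lt.2 hx)
      have := (Real.tendsto_exp_neg_atTop_nhds_zero.comp
        (tendsto_id.atTop_mul_const this)).const_mul ‖w x‖
      simpa using this
  simp only [integral_zero] at h1
  obtain ⟨Y, hY⟩ := eventually_atTop.1 (h1.eventually (gt_mem_nhds hε))
  have hlarge : ∀ z : ℂ, Y ≤ |z.im| → ‖expIntegral b w z‖ ≤ ε * Real.exp (b * |z.im|) := by
    intro z hz
    refine (norm_expIntegral_le hwi z).trans ?_
    have h2 := (hY _ hz).le
    rw [← div_le_iff₀ (Real.exp_pos _), div_eq_inv_mul, ← integral_const_mul]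
    refine (integral_congr_ae (.of_forall fun x => ?_)).trans_le h2
    rw [← Real.exp_neg, mul_left_comm, ← Real.exp_add]
    ring_nf
  -- In the remaining strip the Plancherel–Pólya majorants `G k` are summable, hence below `ε ^ 2`
  -- for all but finitely many cells.
  have hη : 0 < Real.pi / b := by positivity
  set η := Real.pi / b
  obtain ⟨G, hG, hG0, hGF⟩ := exists_summable_sq_norm_expIntegral_le hw hb hη
    (div_mul_cancel₀ _ hb.ne').le (H := η + |Y|) (by positivity)
  have hfin : {k : ℤ | ¬ G k < ε ^ 2}.Finite :=
    (hG.tendsto_cofinite_zero.eventually (gt_mem_nhds (by positivity : 0 < ε ^ 2)))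
  obtain ⟨M, hM⟩ := (hfin.image fun k : ℤ => |(k : ℝ)|).bddAbove
  refine ⟨(|M| + 1) * η + η + |Y|, fun z hz => ?_⟩
  rcases le_or_gt Y |z.im| with hzY | hzY
  · exact hlarge z hzY
  refine le_trans ?_ (le_mul_of_one_le_right hε.le (Real.one_le_exp (by positivity)))
  set k := ⌊z.re / η⌋
  have e4 : (k : ℝ) * η ≤ z.re := (le_div_iff₀ hη).1 (Int.floor_le _)
  have e5 : z.re < (k + 1) * η := (div_lt_iff₀ hη).1 (Int.lt_floor_add_one _)
  have hzk : ‖z - η * k‖ ≤ η + |Y| := by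
    have := Complex.norm_le_abs_re_add_abs_im (z - η * k)
    have h3 : (z - η * k).re = z.re - k * η := by simp; ring
    have h4 : (z - η * k).im = z.im := by simp
    rw [h3, h4] at this
    have h5 : |z.re - k * η| ≤ η := abs_le.2 ⟨by linarith, by linarith⟩
    linarith [le_abs_self Y]
  have hGk : G k < ε ^ 2 := by
    by_contra hcon
    have h6 : |(k : ℝ)| ≤ M := hM ⟨k, hcon, rfl⟩
    have h7 := norm_le_norm_sub_add z (η * k)
    rw [norm_mul, Complex.norm_real, Complex.norm_intCast, Real.norm_of_nonneg hη.le] at h7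
    have h8 : η * |(k : ℝ)| ≤ η * |M| :=
      mul_le_mul_of_nonneg_left (h6.trans (le_abs_self M)) hη.le
    nlinarith
  have := (hGF k z hzk).trans hGk.le
  exact (sq_le_sq₀ (norm_nonneg _) hε.le).1 this

end ExpIntegral

end

/-! ### Two-sided bounds for `θ`. -/

section ThetaBounds

variable {N : ℕ} {b : ℝ} {P : Polynomial ℂ} {S₀ : ℂ → ℂ} {w : ℝ → ℂ} {a : ℤ → ℂ}

theorem theta_eq (z : ℂ) : theta b P S₀ w z = principalPart P S₀ z + expIntegral b w z := rfl

theorem theta_zero : theta b P S₀ 0 = principalPart P S₀ := by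
  ext z
  simp [theta]

theorem IsSineType.differentiable_principalPart (hS₀ : IsSineType b S₀) :
    Differentiable ℂ (principalPart P S₀) :=
  P.differentiable.mul hS₀.entire

theorem IsSineType.differentiable_theta (hS₀ : IsSineType b S₀)
    (hw : MemLp w 2 (volume.restrict (Set.Ioo (-b) b))) : Differentiable ℂ (theta b P S₀ w) :=
  hS₀.differentiable_principalPart.add (differentiable_expIntegral (memLp_integrable hw))

theorem IsSineType.exists_norm_theta_le (hS₀ : IsSineType b S₀) (hb : 0 < b)
    (hP : P.degree = (N : WithBot ℕ)) (hw : MemLp w 2 (volume.restrict (Set.Ioo (-b) b))) :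
    ∃ C R : ℝ, 0 < C ∧ 1 ≤ R ∧ ∀ z, R ≤ ‖z‖ →
      ‖theta b P S₀ w z‖ ≤ C * ‖z‖ ^ N * Real.exp (b * |z.im|) := by
  have hP0 : P ≠ 0 := by rintro rfl; simp at hP
  have hN : P.natDegree = N := Polynomial.natDegree_eq_of_degree_eq_some hP
  obtain ⟨_, C₁, R₁, -, hC₁, hR₁, hPb⟩ := P.exists_norm_eval_bounds hP0
  obtain ⟨C₂, hC₂, hSb⟩ := hS₀.exists_norm_le hb
  obtain ⟨R₃, hF⟩ := exists_norm_expIntegral_le hw hb one_pos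
  refine ⟨C₁ * C₂ + 1, max R₁ R₃, by positivity, hR₁.trans (le_max_left _ _), fun z hz => ?_⟩
  have hz1 : 1 ≤ ‖z‖ := hR₁.trans ((le_max_left _ _).trans hz)
  have h1 := (hPb z ((le_max_left _ _).trans hz)).2
  have h2 := hSb z
  have h3 := hF z ((le_max_right _ _).trans hz)
  rw [hN] at h1
  rw [theta_eq, principalPart]
  have h4 : (1 : ℝ) ≤ ‖z‖ ^ N := one_le_pow₀ hz1
  calc ‖P.eval z * S₀ z + expIntegral b w z‖
      ≤ (C₁ * ‖z‖ ^ N) * (C₂ * Real.exp (b * |z.im|)) + 1 * Real.exp (b * |z.im|) := by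
        refine (norm_add_le _ _).trans (add_le_add ?_ h3)
        rw [norm_mul]
        gcongr
    _ ≤ (C₁ * ‖z‖ ^ N) * (C₂ * Real.exp (b * |z.im|)) + ‖z‖ ^ N * Real.exp (b * |z.im|) := by
        gcongr
    _ = _ := by ring

/-- The integral term eventually costs at most half of the lower bound for `S`. -/
theorem IsSineType.exists_le_norm_theta (hS₀ : IsSineType b S₀) (hb : 0 < b)
    (hP : P.degree = (N : WithBot ℕ)) (hz : EnumeratesZeros S₀ (Set.Ici 1) a)
    (hsep : AsymptoticallySeparated a)
    (hw : MemLp w 2 (volume.restrict (Set.Ioo (-b) b))) {ε : ℝ} (hε : 0 < ε) :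
    ∃ c R : ℝ, 0 < c ∧ 1 ≤ R ∧ ∀ z, R ≤ ‖z‖ → (∀ n, 1 ≤ n → ε ≤ ‖z - a n‖) →
      c * ‖z‖ ^ N * Real.exp (b * |z.im|) ≤ ‖theta b P S₀ w z‖ := by
  have hP0 : P ≠ 0 := by rintro rfl; simp at hP
  have hN : P.natDegree = N := Polynomial.natDegree_eq_of_degree_eq_some hP
  obtain ⟨c₁, _, R₁, hc₁, -, hR₁, hPb⟩ := P.exists_norm_eval_bounds hP0
  obtain ⟨c₂, hc₂, hSb⟩ := hS₀.exists_le_norm hb hz hsep hε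
  obtain ⟨R₃, hF⟩ := exists_norm_expIntegral_le hw hb (show 0 < c₁ * c₂ / 2 by positivity)
  refine ⟨c₁ * c₂ / 2, max R₁ R₃, by positivity, hR₁.trans (le_max_left _ _), fun z hz hoff => ?_⟩
  have hz1 : 1 ≤ ‖z‖ := hR₁.trans ((le_max_left _ _).trans hz)
  have h1 := (hPb z ((le_max_left _ _).trans hz)).1
  have h2 := hSb z hoff
  have h3 := hF z ((le_max_right _ _).trans hz)
  rw [hN] at h1
  rw [theta_eq, principalPart]
  have h4 : (1 : ℝ) ≤ ‖z‖ ^ N := one_le_pow₀ hz1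
  have h5 : (c₁ * ‖z‖ ^ N) * (c₂ * Real.exp (b * |z.im|)) ≤ ‖P.eval z * S₀ z‖ := by
    rw [norm_mul]
    gcongr
  have h6 : c₁ * c₂ / 2 * Real.exp (b * |z.im|) ≤
      c₁ * c₂ / 2 * Real.exp (b * |z.im|) * ‖z‖ ^ N := le_mul_of_one_le_right (by positivity) h4
  have h7 := norm_sub_le_norm_add (P.eval z * S₀ z) (expIntegral b w z)
  nlinarith

/-- Cauchy's estimate on a unit circle bounds `θ'` by the same `|z| ^ N exp (b |Im z|)` that bounds
`θ` below. -/
theorem IsSineType.exists_norm_logDeriv_theta_le (hS₀ : IsSineType b S₀) (hb : 0 < b)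
    (hP : P.degree = (N : WithBot ℕ)) (hz : EnumeratesZeros S₀ (Set.Ici 1) a)
    (hsep : AsymptoticallySeparated a)
    (hw : MemLp w 2 (volume.restrict (Set.Ioo (-b) b))) {ε : ℝ} (hε : 0 < ε) :
    ∃ C R : ℝ, 1 ≤ R ∧ ∀ z, R ≤ ‖z‖ → (∀ n, 1 ≤ n → ε ≤ ‖z - a n‖) →
      theta b P S₀ w z ≠ 0 ∧ ‖logDeriv (theta b P S₀ w) z‖ ≤ C := by
  obtain ⟨C, R₁, hC, hR₁, hup⟩ := hS₀.exists_norm_theta_le hb hP hw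
  obtain ⟨c, R₂, hc, hR₂, hlow⟩ := hS₀.exists_le_norm_theta hb hP hz hsep hw hε
  refine ⟨C * 2 ^ N * Real.exp b / c, max (R₁ + 1) R₂, hR₂.trans (le_max_right _ _),
    fun z hz hoff => ?_⟩
  have hzR1 : R₁ + 1 ≤ ‖z‖ := (le_max_left _ _).trans hz
  have hz1 : 1 ≤ ‖z‖ := by linarith
  have h1 := hlow z ((le_max_right _ _).trans hz) hoff
  have hpos : 0 < c * ‖z‖ ^ N * Real.exp (b * |z.im|) := by positivity
  have hd : ‖deriv (theta b P S₀ w) z‖ ≤ C * (2 * ‖z‖) ^ N * Real.exp (b * (|z.im| + 1)) / 1 := by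
    refine Complex.norm_deriv_le_of_forall_mem_sphere_norm_le one_pos
      (hS₀.differentiable_theta hw).diffContOnCl fun v hv => ?_
    rw [mem_sphere_iff_norm] at hv
    have h2 := norm_sub_norm_le z v
    rw [norm_sub_rev] at h2
    have h3 := norm_sub_norm_le v z
    have h4 := (Complex.abs_im_le_norm (v - z)).trans hv.le
    rw [Complex.sub_im] at h4
    have h5 := abs_sub_abs_le_abs_sub v.im z.im
    refine (hup v (by linarith)).trans ?_
    gcongr <;> linarith
  refine ⟨norm_pos_iff.1 (hpos.trans_le h1), ?_⟩
  rw [logDeriv_apply, norm_div, div_le_iff₀ (hpos.trans_le h1)]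
  calc ‖deriv (theta b P S₀ w) z‖ ≤ C * (2 * ‖z‖) ^ N * Real.exp (b * (|z.im| + 1)) / 1 := hd
    _ = C * 2 ^ N * Real.exp b / c * (c * ‖z‖ ^ N * Real.exp (b * |z.im|)) := by
      rw [mul_pow, mul_add, Real.exp_add, mul_one]
      field_simp
    _ ≤ _ := by gcongr

theorem eventually_off_discs {H : ℝ} (him : ∀ n, 1 ≤ n → |(a n).im| ≤ H) (ε R : ℝ) :
    ∀ᶠ y : ℝ in atTop, R ≤ ‖(y : ℂ) * Complex.I‖ ∧ ∀ n, 1 ≤ n → ε ≤ ‖(y : ℂ) * Complex.I - a n‖ := by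
  filter_upwards [eventually_ge_atTop (H + ε), eventually_ge_atTop |R|] with y hy hyR
  have hy0 : 0 ≤ y := (abs_nonneg R).trans hyR
  refine ⟨?_, fun n hn => ?_⟩
  · simp only [norm_mul, Complex.norm_real, Complex.norm_I, mul_one, Real.norm_eq_abs]
    exact (le_abs_self R).trans (hyR.trans (le_abs_self y))
  · have h1 := Complex.abs_im_le_norm ((y : ℂ) * Complex.I - a n)
    simp only [Complex.sub_im, Complex.im_ofReal_mul, Complex.I_im, mul_one] at h1
    have h2 := abs_le.1 (him n hn)
    linarith [le_abs_self (y - (a n).im)]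

/-- This normalisation at infinity determines both the number of exceptional zeros and the constants
of the product formula. -/
theorem IsSineType.tendsto_theta_div_principalPart (hS₀ : IsSineType b S₀) (hb : 0 < b)
    (hP : P.degree = (N : WithBot ℕ)) (hz : EnumeratesZeros S₀ (Set.Ici 1) a)
    (hsep : AsymptoticallySeparated a)
    (hw : MemLp w 2 (volume.restrict (Set.Ioo (-b) b))) :
    Tendsto (fun y : ℝ => theta b P S₀ w (y * Complex.I) / principalPart P S₀ (y * Complex.I))
      atTop (𝓝 1) := by
  obtain ⟨H, him⟩ := hS₀.exists_abs_im_le hz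
  -- Taking `w = 0` yields the lower bound for `S` itself.
  obtain ⟨c, R, hc, hR, hlow⟩ := hS₀.exists_le_norm_theta (w := 0) hb hP hz hsep
    MemLp.zero one_pos
  rw [theta_zero] at hlow
  rw [Metric.tendsto_nhds]
  intro ε hε
  obtain ⟨R', hF⟩ := exists_norm_expIntegral_le hw hb (show 0 < c * (ε / 2) by positivity)
  filter_upwards [eventually_off_discs him 1 R, eventually_off_discs him 1 R'] with y hy hy'
  have h1 := hlow _ hy.1 hy.2
  have h2 := hF _ hy'.1
  set z := (y : ℂ) * Complex.I
  have hz1 : 1 ≤ ‖z‖ := hR.trans hy.1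
  have hpos : 0 < c * ‖z‖ ^ N * Real.exp (b * |z.im|) := by positivity
  have hne : principalPart P S₀ z ≠ 0 := norm_pos_iff.1 (hpos.trans_le h1)
  rw [theta_eq, add_div, div_self hne, dist_eq_norm, add_sub_cancel_left, norm_div,
    div_lt_iff₀ (norm_pos_iff.2 hne)]
  have h4 : (1 : ℝ) ≤ ‖z‖ ^ N := one_le_pow₀ hz1
  calc ‖expIntegral b w z‖ ≤ c * (ε / 2) * Real.exp (b * |z.im|) := h2
    _ ≤ (ε / 2) * (c * ‖z‖ ^ N * Real.exp (b * |z.im|)) := by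
      have := Real.exp_pos (b * |z.im|)
      have : c * Real.exp (b * |z.im|) ≤ c * Real.exp (b * |z.im|) * ‖z‖ ^ N :=
        le_mul_of_one_le_right (by positivity) h4
      nlinarith
    _ < ε * (c * ‖z‖ ^ N * Real.exp (b * |z.im|)) := by gcongr; linarith
    _ ≤ _ := by gcongr

end ThetaBounds

/-! ### Canonical products of genus one. -/

noncomputable section

section GenusOneProducts

variable {ι : Type*} {μ z : ι → ℂ}

/-- The factor `((z n - ζ) / μ n) exp (ζ / μ n)` of a canonical product of genus one. -/
def genusOneFactor (μ z : ι → ℂ) (n : ι) (ζ : ℂ) : ℂ := (z n - ζ) / μ n * Complex.exp (ζ / μ n)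

/-- The product `∏ ((z n - ζ) / μ n) exp (ζ / μ n)`. -/
def genusOneProduct (μ z : ι → ℂ) (ζ : ℂ) : ℂ := ∏' n, genusOneFactor μ z n ζ

/-- Conditions for the convergence of `∏ ((z n - ζ) / μ n) exp (ζ / μ n)`. -/
structure GenusOneConvergent (μ z : ι → ℂ) : Prop where
  ne_zero : ∀ n, μ n ≠ 0
  summable_inv_sq : Summable fun n => ‖μ n‖⁻¹ ^ 2
  summable_sub : Summable fun n => ‖z n - μ n‖ * ‖μ n‖⁻¹

/-- Here `(1 - t) exp t = 1 + O(t ^ 2)`, while `u = (z n - μ n) / μ n` records that the zero `z n`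
is not the point `μ n` in the exponential. -/
theorem norm_one_sub_mul_cexp_sub_one_le {t : ℂ} (ht : ‖t‖ ≤ 1) (u : ℂ) :
    ‖(1 + u - t) * Complex.exp t - 1‖ ≤ 3 * ‖t‖ ^ 2 + 3 * ‖u‖ := by
  have h1 := Complex.norm_exp_sub_one_sub_id_le ht
  have h2 : ‖Complex.exp t‖ ≤ 3 := by
    refine (Complex.norm_exp_le_exp_norm t).trans ((Real.exp_le_exp.2 ht).trans ?_)
    linarith [Real.exp_one_lt_d9]
  have h3 : ‖(1 - t) * (Complex.exp t - 1 - t)‖ ≤ 2 * ‖t‖ ^ 2 := by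
    rw [norm_mul]
    have : ‖1 - t‖ ≤ 2 := (norm_sub_le _ _).trans (by rw [norm_one]; linarith)
    exact mul_le_mul this h1 (norm_nonneg _) zero_le_two
  calc ‖(1 + u - t) * Complex.exp t - 1‖
      = ‖(1 - t) * (Complex.exp t - 1 - t) - t ^ 2 + u * Complex.exp t‖ := by congr 1; ring
    _ ≤ 2 * ‖t‖ ^ 2 + ‖t‖ ^ 2 + ‖u‖ * 3 := by
      refine (norm_add_le _ _).trans (add_le_add ((norm_sub_le _ _).trans (add_le_add h3 ?_)) ?_)
      · rw [norm_pow]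
      · rw [norm_mul]; gcongr
    _ = _ := by ring

theorem differentiable_genusOneFactor (n : ι) : Differentiable ℂ (genusOneFactor μ z n) := by
  unfold genusOneFactor
  fun_prop

theorem genusOneFactor_eq_zero_iff {n : ι} (hμ : μ n ≠ 0) {ζ : ℂ} :
    genusOneFactor μ z n ζ = 0 ↔ z n = ζ := by
  simp [genusOneFactor, hμ, sub_eq_zero]

namespace GenusOneConvergent

theorem comp_injective (h : GenusOneConvergent μ z) {κ : Type*} {i : κ → ι}
    (hi : Function.Injective i) : GenusOneConvergent (μ ∘ i) (z ∘ i) where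
  ne_zero n := h.ne_zero (i n)
  summable_inv_sq := h.summable_inv_sq.comp_injective hi
  summable_sub := h.summable_sub.comp_injective hi

theorem exists_bound (h : GenusOneConvergent μ z) (R : ℝ) :
    ∃ u : ι → ℝ, Summable u ∧
      ∀ᶠ n in cofinite, ∀ ζ ∈ Metric.ball (0 : ℂ) R, ‖genusOneFactor μ z n ζ - 1‖ ≤ u n := by
  refine ⟨fun n => 3 * (R ^ 2 * ‖μ n‖⁻¹ ^ 2) + 3 * (‖z n - μ n‖ * ‖μ n‖⁻¹),
    ((h.summable_inv_sq.mul_left _).mul_left _).add (h.summable_sub.mul_left _), ?_⟩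
  have h1 := (h.summable_inv_sq.mul_left (R ^ 2)).tendsto_cofinite_zero.eventually
    (gt_mem_nhds one_pos)
  filter_upwards [h1] with n hn ζ hζ
  rw [mem_ball_zero_iff] at hζ
  have hμ := h.ne_zero n
  have hle : ‖ζ / μ n‖ ≤ R * ‖μ n‖⁻¹ := by
    rw [norm_div, div_eq_mul_inv]
    gcongr
  have hR : 0 ≤ R * ‖μ n‖⁻¹ := (norm_nonneg _).trans hle
  have ht : ‖ζ / μ n‖ ≤ 1 := by
    refine hle.trans ?_
    rw [← mul_pow] at hn
    nlinarith
  have h2 := norm_one_sub_mul_cexp_sub_one_le ht ((z n - μ n) / μ n)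
  have h3 : 1 + (z n - μ n) / μ n - ζ / μ n = (z n - ζ) / μ n := by field_simp; ring
  rw [h3, norm_div (z n - μ n), div_eq_mul_inv ‖z n - μ n‖] at h2
  refine h2.trans ?_
  rw [← mul_pow]
  gcongr

theorem summable_norm_sub_one (h : GenusOneConvergent μ z) (ζ : ℂ) :
    Summable fun n => ‖genusOneFactor μ z n ζ - 1‖ := by
  obtain ⟨u, hu, hb⟩ := h.exists_bound (‖ζ‖ + 1)
  refine hu.of_norm_bounded_eventually ?_
  filter_upwards [hb] with n hn
  rw [norm_norm]
  exact hn ζ (by simp)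

theorem multipliable (h : GenusOneConvergent μ z) (ζ : ℂ) :
    Multipliable fun n => genusOneFactor μ z n ζ := by
  have := multipliable_one_add_of_summable (h.summable_norm_sub_one ζ)
  simpa using this

theorem multipliableLocallyUniformlyOn (h : GenusOneConvergent μ z) (R : ℝ) :
    MultipliableLocallyUniformlyOn (genusOneFactor μ z) (Metric.ball 0 R) := by
  obtain ⟨u, hu, hb⟩ := h.exists_bound R
  have := hu.multipliableLocallyUniformlyOn_one_add Metric.isOpen_ball hb
    fun n => ((differentiable_genusOneFactor n).sub_const 1).continuous.continuousOn
  simpa using this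

theorem differentiable (h : GenusOneConvergent μ z) : Differentiable ℂ (genusOneProduct μ z) := by
  intro ζ
  have h1 := (h.multipliableLocallyUniformlyOn (‖ζ‖ + 1)).hasProdLocallyUniformlyOn
  have h2 : DifferentiableOn ℂ (genusOneProduct μ z) (Metric.ball 0 (‖ζ‖ + 1)) := by
    refine TendstoLocallyUniformlyOn.differentiableOn h1 (.of_forall fun s => ?_)
      Metric.isOpen_ball
    have := fun n => differentiable_genusOneFactor (μ := μ) (z := z) n
    exact (by fun_prop : Differentiable ℂ fun ζ => ∏ i ∈ s, genusOneFactor μ z i ζ).differentiableOn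
  exact h2.differentiableAt (Metric.isOpen_ball.mem_nhds (by simp))

theorem product_ne_zero (h : GenusOneConvergent μ z) {ζ : ℂ} (hζ : ∀ n, z n ≠ ζ) :
    genusOneProduct μ z ζ ≠ 0 := by
  have := tprod_one_add_ne_zero_of_summable (f := fun n => genusOneFactor μ z n ζ - 1)
    (fun n => by
      rw [add_sub_cancel]
      exact mt (genusOneFactor_eq_zero_iff (h.ne_zero n)).1 (hζ n)) (h.summable_norm_sub_one ζ)
  simpa [genusOneProduct] using this

theorem finite_eq (h : GenusOneConvergent μ z) (c : ℂ) : {n | z n = c}.Finite := by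
  have h1 := (h.summable_norm_sub_one c).tendsto_cofinite_zero.eventually (gt_mem_nhds one_pos)
  refine Set.Finite.subset h1 fun n hn => ?_
  have h2 : genusOneFactor μ z n c = 0 := (genusOneFactor_eq_zero_iff (h.ne_zero n)).2 hn
  simp [h2]

theorem product_eq_mul (h : GenusOneConvergent μ z) (E : Finset ι) (ζ : ℂ) :
    genusOneProduct μ z ζ = (∏ n ∈ E, genusOneFactor μ z n ζ) *
      genusOneProduct (μ ∘ ((↑) : ((E : Set ι)ᶜ : Set ι) → ι)) (z ∘ (↑)) ζ := by
  have h1 := Multipliable.tprod_mul_tprod_compl (f := fun n => genusOneFactor μ z n ζ)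
    (s := (E : Set ι)) ((h.comp_injective Subtype.val_injective).multipliable ζ)
    ((h.comp_injective Subtype.val_injective).multipliable ζ)
  rw [genusOneProduct, ← h1]
  congr 1
  exact Finset.tprod_subtype E fun n => genusOneFactor μ z n ζ

/-- Only finitely many factors vanish at `c`, each to first order; the product of the others is a
convergent product without a zero at `c`. -/
theorem analyticOrderAt_product (h : GenusOneConvergent μ z) (c : ℂ) :
    analyticOrderAt (genusOneProduct μ z) c = {n | z n = c}.encard := by
  set E := (h.finite_eq c).toFinset with hE
  have hmem : ∀ n, n ∈ E ↔ z n = c := fun n => (h.finite_eq c).mem_toFinset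
  have h' := h.comp_injective (i := ((↑) : ((E : Set ι)ᶜ : Set ι) → ι)) Subtype.val_injective
  have hord : ∀ n ∈ E, analyticOrderAt (genusOneFactor μ z n) c = 1 := by
    intro n hn
    have h1 : genusOneFactor μ z n = (fun ζ => ζ - z n) * fun ζ => -Complex.exp (ζ / μ n) / μ n := by
      ext ζ
      simp only [genusOneFactor, Pi.mul_apply]
      ring
    have h2 : AnalyticAt ℂ (fun ζ => -Complex.exp (ζ / μ n) / μ n) c :=
      Differentiable.analyticAt (by fun_prop) c
    classical
    rw [h1, analyticOrderAt_mul (by fun_prop) h2, analyticOrderAt_sub_const,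
      if_pos ((hmem n).1 hn), h2.analyticOrderAt_eq_zero.2, add_zero]
    exact div_ne_zero (neg_ne_zero.2 (Complex.exp_ne_zero _)) (h.ne_zero n)
  have hprod : Differentiable ℂ fun ζ => ∏ n ∈ E, genusOneFactor μ z n ζ := by
    have := fun n => differentiable_genusOneFactor (μ := μ) (z := z) n
    fun_prop
  have heq : genusOneProduct μ z = (fun ζ => ∏ n ∈ E, genusOneFactor μ z n ζ) *
      genusOneProduct (μ ∘ ((↑) : ((E : Set ι)ᶜ : Set ι) → ι)) (z ∘ (↑)) :=
    funext fun ζ => h.product_eq_mul E ζ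
  have h0 : genusOneProduct (μ ∘ ((↑) : ((E : Set ι)ᶜ : Set ι) → ι)) (z ∘ (↑)) c ≠ 0 :=
    h'.product_ne_zero fun n hn => n.2 (by simpa [hmem] using hn)
  rw [heq, analyticOrderAt_mul (hprod.analyticAt c) (h'.differentiable.analyticAt c),
    (h'.differentiable.analyticAt c).analyticOrderAt_eq_zero.2 h0, add_zero,
    analyticOrderAt_finset_prod E _ c fun n _ => (differentiable_genusOneFactor n).analyticAt c,
    Finset.sum_congr rfl hord, (h.finite_eq c).encard_eq_coe_toFinset_card]
  simp [hE]

theorem logDeriv_factor {n : ι} (hμ : μ n ≠ 0) {ζ : ℂ} (hζ : z n ≠ ζ) :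
    logDeriv (genusOneFactor μ z n) ζ = (z n - μ n - ζ) / (μ n * (z n - ζ)) := by
  have h1 : HasDerivAt (genusOneFactor μ z n)
      (-1 / μ n * Complex.exp (ζ / μ n) +
        (z n - ζ) / μ n * (Complex.exp (ζ / μ n) * (1 / μ n))) ζ :=
    (((hasDerivAt_id ζ).const_sub (z n)).div_const (μ n)).mul
      ((hasDerivAt_id ζ).div_const (μ n)).cexp
  rw [logDeriv_apply, h1.deriv, genusOneFactor]
  have h2 := sub_ne_zero.2 hζ
  have h3 := Complex.exp_ne_zero (ζ / μ n)
  field_simp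
  ring

/-- The `n`-th term of the logarithmic derivative, away from the zeros. -/
theorem norm_logDeriv_factor_le (h : GenusOneConvergent μ z) {D : ℝ} (hD : ∀ n, ‖z n - μ n‖ ≤ D)
    {ε : ℝ} (hε : 0 < ε) {ζ : ℂ} (hζ : ∀ n, ε ≤ ‖z n - ζ‖) (n : ι) :
    ‖logDeriv (genusOneFactor μ z n) ζ‖ ≤
      (D + ‖ζ‖) * (1 + (D + ‖ζ‖) / ε) * ‖μ n‖⁻¹ ^ 2 := by
  have hpos : 0 < ‖z n - ζ‖ := hε.trans_le (hζ n)
  have hμ : 0 < ‖μ n‖ := norm_pos_iff.2 (h.ne_zero n)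
  rw [logDeriv_factor (h.ne_zero n) (by rintro rfl; simp at hpos), norm_div, norm_mul]
  have hDn := hD n
  have h1 : ‖z n - μ n - ζ‖ ≤ D + ‖ζ‖ := (norm_sub_le _ _).trans (by linarith)
  have hD0 : 0 ≤ D + ‖ζ‖ := (norm_nonneg _).trans h1
  have h2 : ‖μ n‖ ≤ ‖z n - ζ‖ * (1 + (D + ‖ζ‖) / ε) := by
    have h3 : ‖μ n‖ ≤ ‖z n - ζ‖ + (D + ‖ζ‖) := by
      have := norm_sub_le (z n - ζ) (z n - μ n - ζ)
      rw [show z n - ζ - (z n - μ n - ζ) = μ n by ring] at this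
      linarith
    have h4 : D + ‖ζ‖ ≤ ‖z n - ζ‖ * ((D + ‖ζ‖) / ε) := by
      rw [mul_div_assoc', le_div_iff₀ hε, mul_comm]
      exact mul_le_mul_of_nonneg_right (hζ n) hD0
    linarith
  have h5 : 1 / ‖z n - ζ‖ ≤ (1 + (D + ‖ζ‖) / ε) * ‖μ n‖⁻¹ := by
    rw [← div_eq_mul_inv, div_le_div_iff₀ hpos hμ]
    linarith
  calc ‖z n - μ n - ζ‖ / (‖μ n‖ * ‖z n - ζ‖)
      = ‖z n - μ n - ζ‖ * ‖μ n‖⁻¹ * (1 / ‖z n - ζ‖) := by field_simp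
    _ ≤ (D + ‖ζ‖) * ‖μ n‖⁻¹ * ((1 + (D + ‖ζ‖) / ε) * ‖μ n‖⁻¹) := by gcongr
    _ = _ := by ring

theorem logDeriv_product (h : GenusOneConvergent μ z) {D : ℝ} (hD : ∀ n, ‖z n - μ n‖ ≤ D)
    {ε : ℝ} (hε : 0 < ε) {ζ : ℂ} (hζ : ∀ n, ε ≤ ‖z n - ζ‖) :
    logDeriv (genusOneProduct μ z) ζ = ∑' n, logDeriv (genusOneFactor μ z n) ζ := by
  have hne : ∀ n, z n ≠ ζ := fun n hn => by
    have := hζ n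
    rw [hn, sub_self, norm_zero] at this
    linarith
  refine logDeriv_tprod_eq_tsum Metric.isOpen_ball (s := Metric.ball 0 (‖ζ‖ + 1)) (by simp)
    (fun n => mt (genusOneFactor_eq_zero_iff (h.ne_zero n)).1 (hne n))
    (fun n => (differentiable_genusOneFactor n).differentiableOn) ?_
    (h.multipliableLocallyUniformlyOn _) (h.product_ne_zero hne)
  exact (h.summable_inv_sq.mul_left _).of_norm_bounded (h.norm_logDeriv_factor_le hD hε hζ)

theorem norm_logDeriv_product_le (h : GenusOneConvergent μ z) {D : ℝ} (hD : ∀ n, ‖z n - μ n‖ ≤ D)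
    {ε : ℝ} (hε : 0 < ε) {ζ : ℂ} (hζ : ∀ n, ε ≤ ‖z n - ζ‖) :
    ‖logDeriv (genusOneProduct μ z) ζ‖ ≤
      (D + ‖ζ‖) * (1 + (D + ‖ζ‖) / ε) * ∑' n, ‖μ n‖⁻¹ ^ 2 := by
  rw [h.logDeriv_product hD hε hζ, ← tsum_mul_left]
  exact tsum_of_norm_bounded (h.summable_inv_sq.mul_left _).hasSum
    (h.norm_logDeriv_factor_le hD hε hζ)

theorem le_norm_sub_mul_I {H : ℝ} (hH : ∀ n, |(z n).im| ≤ H) {y : ℝ} (hy : H + 1 ≤ y) (n : ι) :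
    y - H ≤ ‖z n - y * Complex.I‖ ∧ 1 ≤ ‖z n - y * Complex.I‖ := by
  have h1 := Complex.abs_im_le_norm (z n - y * Complex.I)
  simp only [Complex.sub_im, Complex.im_ofReal_mul, Complex.I_im, mul_one] at h1
  have h2 := abs_le.1 (hH n)
  have h3 := neg_abs_le ((z n).im - y)
  constructor <;> linarith

/-- A bound uniform in `y`, needed for dominated convergence: `|μ n| ≤ |Re z n| + H + D`, and `|z n
- iy|` exceeds both `|Re z n|` and `1`. -/
theorem inv_norm_sub_mul_I_le (h : GenusOneConvergent μ z) {D H : ℝ} (hD : ∀ n, ‖z n - μ n‖ ≤ D)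
    (hH : ∀ n, |(z n).im| ≤ H) {y : ℝ} (hy : H + 1 ≤ y) (n : ι) :
    ‖z n - y * Complex.I‖⁻¹ ≤ (D + H + 1) * ‖μ n‖⁻¹ := by
  have h1 := (le_norm_sub_mul_I hH hy n).2
  have hμ : 0 < ‖μ n‖ := norm_pos_iff.2 (h.ne_zero n)
  have hD0 : 0 ≤ D := (norm_nonneg _).trans (hD n)
  have hH0 : 0 ≤ H := (abs_nonneg _).trans (hH n)
  rw [← div_eq_mul_inv, ← one_div, div_le_div_iff₀ (by linarith) hμ, one_mul]
  have h2 : ‖μ n‖ ≤ ‖z n‖ + D := by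
    have := norm_sub_norm_le (μ n) (z n)
    rw [norm_sub_rev] at this
    linarith [hD n]
  have h3 := Complex.norm_le_abs_re_add_abs_im (z n)
  have h4 := Complex.abs_re_le_norm (z n - y * Complex.I)
  simp only [Complex.sub_re, Complex.re_ofReal_mul, Complex.I_re, mul_zero, sub_zero] at h4
  nlinarith [hH n]

theorem tendsto_inv_norm_sub_mul_I {H : ℝ} (hH : ∀ n, |(z n).im| ≤ H) (n : ι) :
    Tendsto (fun y : ℝ => ‖z n - y * Complex.I‖⁻¹) atTop (𝓝 0) := by
  refine Tendsto.inv_tendsto_atTop (tendsto_atTop_mono' atTop ?_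
    (tendsto_atTop_add_const_right atTop (-H) tendsto_id))
  filter_upwards [eventually_ge_atTop (H + 1)] with y hy
  simpa [sub_eq_add_neg] using (le_norm_sub_mul_I hH hy n).1

/-- Each term, divided by `y`, is at most a constant times `|μ n|⁻¹ |z n - iy|⁻¹`: it tends to zero
and is dominated by a multiple of `|μ n|⁻²`. -/
theorem tendsto_logDeriv_product_div (h : GenusOneConvergent μ z) {D H : ℝ}
    (hD : ∀ n, ‖z n - μ n‖ ≤ D) (hH : ∀ n, |(z n).im| ≤ H) :
    Tendsto (fun y : ℝ => logDeriv (genusOneProduct μ z) (y * Complex.I) / y) atTop (𝓝 0) := by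
  rcases isEmpty_or_nonempty ι with hι | ⟨⟨n₀⟩⟩
  · have : genusOneProduct μ z = fun _ => 1 := by ext; simp [genusOneProduct]
    simp [this, logDeriv_apply]
  have hD0 : 0 ≤ D := (norm_nonneg _).trans (hD n₀)
  have hterm : ∀ y : ℝ, H + 1 ≤ y → 1 ≤ y → ∀ n,
      ‖logDeriv (genusOneFactor μ z n) (y * Complex.I) / y‖ ≤
        (D + 1) * ‖μ n‖⁻¹ * ‖z n - y * Complex.I‖⁻¹ := by
    intro y hy hy1 n
    have h1 := (le_norm_sub_mul_I hH hy n).2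
    have hy0 : 0 < y := by linarith
    rw [logDeriv_factor (h.ne_zero n) (by intro he; rw [he, sub_self, norm_zero] at h1; linarith),
      norm_div, norm_div, norm_mul, Complex.norm_real, Real.norm_of_nonneg hy0.le]
    have h2 : ‖z n - μ n - y * Complex.I‖ ≤ (D + 1) * y := by
      refine (norm_sub_le _ _).trans ?_
      rw [norm_mul, Complex.norm_I, Complex.norm_real, Real.norm_of_nonneg hy0.le, mul_one]
      nlinarith [hD n]
    calc ‖z n - μ n - y * Complex.I‖ / (‖μ n‖ * ‖z n - y * Complex.I‖) / y
        ≤ (D + 1) * y / (‖μ n‖ * ‖z n - y * Complex.I‖) / y := by gcongr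
      _ = _ := by field_simp
  have hlim : Tendsto (fun y : ℝ => ∑' n, logDeriv (genusOneFactor μ z n) (y * Complex.I) / y)
      atTop (𝓝 (∑' _ : ι, (0 : ℂ))) := by
    refine tendsto_tsum_of_dominated_convergence
      (bound := fun n => (D + 1) * (D + H + 1) * ‖μ n‖⁻¹ ^ 2) (h.summable_inv_sq.mul_left _) ?_ ?_
    · intro n
      refine squeeze_zero_norm' (a := fun y : ℝ => (D + 1) * ‖μ n‖⁻¹ * ‖z n - y * Complex.I‖⁻¹) ?_ ?_
      · filter_upwards [eventually_ge_atTop (H + 1), eventually_ge_atTop 1] with y hy hy1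
        exact hterm y hy hy1 n
      · simpa using (tendsto_inv_norm_sub_mul_I hH n).const_mul ((D + 1) * ‖μ n‖⁻¹)
    · filter_upwards [eventually_ge_atTop (H + 1), eventually_ge_atTop 1] with y hy hy1 n
      refine (hterm y hy hy1 n).trans ?_
      have := h.inv_norm_sub_mul_I_le hD hH hy n
      calc (D + 1) * ‖μ n‖⁻¹ * ‖z n - y * Complex.I‖⁻¹
          ≤ (D + 1) * ‖μ n‖⁻¹ * ((D + H + 1) * ‖μ n‖⁻¹) := by gcongr
        _ = _ := by ring
  rw [tsum_zero] at hlim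
  refine hlim.congr' ?_
  filter_upwards [eventually_ge_atTop (H + 1)] with y hy
  rw [h.logDeriv_product hD one_pos fun n => (le_norm_sub_mul_I hH hy n).2, tsum_div_const]

/-- Two products whose zeros are close are asymptotically equal on the imaginary axis. -/
theorem tendsto_product_div_product {z' : ι → ℂ} (h : GenusOneConvergent μ z)
    (h' : GenusOneConvergent μ z') {D H : ℝ} (hD : ∀ n, ‖z' n - μ n‖ ≤ D)
    (hH : ∀ n, |(z' n).im| ≤ H) :
    Tendsto (fun y : ℝ => genusOneProduct μ z (y * Complex.I) / genusOneProduct μ z' (y * Complex.I))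
      atTop (𝓝 1) := by
  -- Both products use the same `μ`, so the exponentials cancel and the quotient of the `n`-th
  -- factors is `1 + v y n`.
  set v : ℝ → ι → ℂ := fun y n => (z n - z' n) / (z' n - y * Complex.I) with hv
  have hs : Summable fun n => ‖z n - z' n‖ * ‖μ n‖⁻¹ := by
    refine (h.summable_sub.add h'.summable_sub).of_nonneg_of_le (fun n => by positivity) fun n => ?_
    rw [← add_mul]
    gcongr
    have := norm_sub_le (z n - μ n) (z' n - μ n)
    rwa [sub_sub_sub_cancel_right] at this
  have hbd : ∀ y : ℝ, H + 1 ≤ y → ∀ n, ‖v y n‖ ≤ (D + H + 1) * (‖z n - z' n‖ * ‖μ n‖⁻¹) := by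
    intro y hy n
    rw [hv]
    simp only
    rw [norm_div, div_eq_mul_inv]
    calc ‖z n - z' n‖ * ‖z' n - y * Complex.I‖⁻¹
        ≤ ‖z n - z' n‖ * ((D + H + 1) * ‖μ n‖⁻¹) := by
          gcongr
          exact h'.inv_norm_sub_mul_I_le hD hH hy n
      _ = _ := by ring
  have hlim : Tendsto (fun y => ∏' n, (1 + v y n)) atTop (𝓝 (∏' _ : ι, (1 + (0 : ℂ)))) := by
    refine tendsto_tprod_one_add_of_dominated_convergence (hs.mul_left (D + H + 1)) ?_ ?_
    · intro n
      rw [tendsto_zero_iff_norm_tendsto_zero]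
      have := (tendsto_inv_norm_sub_mul_I hH n).const_mul ‖z n - z' n‖
      simp only [hv, div_eq_mul_inv]
      simpa using this
    · filter_upwards [eventually_ge_atTop (H + 1)] with y hy n using hbd y hy n
  simp only [add_zero, tprod_one] at hlim
  refine hlim.congr' ?_
  filter_upwards [eventually_ge_atTop (H + 1)] with y hy
  have hne : ∀ n, z' n ≠ y * Complex.I := fun n hn => by
    have := (le_norm_sub_mul_I hH hy n).2
    rw [hn, sub_self, norm_zero] at this
    linarith
  rw [eq_div_iff (h'.product_ne_zero hne), genusOneProduct, genusOneProduct,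
    ← Multipliable.tprod_mul]
  · refine tprod_congr fun n => ?_
    have := sub_ne_zero.2 (hne n)
    simp only [hv, genusOneFactor]
    field_simp
    ring
  · exact multipliable_one_add_of_summable
      ((hs.mul_left (D + H + 1)).of_nonneg_of_le (fun n => norm_nonneg _) (hbd y hy))
  · exact h'.multipliable _

end GenusOneConvergent

end GenusOneProducts

end

/-! ### Hadamard factorization. -/

section Hadamard

/-- A special case of Hadamard's factorization theorem: the logarithmic derivative is bounded off
small discs around the terms of `a`. -/
theorem GenusOneConvergent.exists_eq_exp_mul_product {ι : Type*} {μ z : ι → ℂ}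
    (h : GenusOneConvergent μ z) {D H : ℝ} (hD0 : 0 ≤ D)
    (hD : ∀ n, ‖z n - μ n‖ ≤ D) (hH : ∀ n, |(z n).im| ≤ H)
    {a : ℤ → ℂ} {H' : ℝ} (him : ∀ n, 1 ≤ n → |(a n).im| ≤ H') {ε ε' R R' C : ℝ} (hε : 0 < ε)
    (hε' : 0 < ε')
    (hsph : ∀ n, 1 ≤ n → ∀ w : ℂ, R' ≤ ‖w‖ → ‖w - a n‖ = ε → ∀ k, 1 ≤ k → ε ≤ ‖w - a k‖)
    (hoff : ∀ ζ, R ≤ ‖ζ‖ → (∀ n, 1 ≤ n → ε ≤ ‖ζ - a n‖) → ∀ n, ε' ≤ ‖z n - ζ‖)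
    {T : ℂ → ℂ} (hT : Differentiable ℂ T)
    (hord : ∀ c, analyticOrderAt T c = {n | z n = c}.encard)
    (hlog : ∀ ζ, R ≤ ‖ζ‖ → (∀ n, 1 ≤ n → ε ≤ ‖ζ - a n‖) → ‖logDeriv T ζ‖ ≤ C) :
    ∃ A B : ℂ, A ≠ 0 ∧ ∀ ζ, T ζ = A * Complex.exp (B * ζ) * genusOneProduct μ z ζ := by
  have hdiff := h.differentiable
  have hpo := h.analyticOrderAt_product
  have hfin : ∀ c, analyticOrderAt (genusOneProduct μ z) c ≠ ⊤ := fun c => by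
    rw [hpo, Set.encard_ne_top_iff]
    exact h.finite_eq c
  obtain ⟨f, hf, hTf⟩ := exists_differentiable_mul_eq hT hdiff hfin
    (fun c => by rw [hpo, hord])
  have hf0 : ∀ c, f c ≠ 0 := by
    intro c
    have hmul : analyticOrderAt T c = analyticOrderAt (genusOneProduct μ z) c +
        analyticOrderAt f c := by
      rw [← analyticOrderAt_mul (hdiff.analyticAt c) (hf.analyticAt c)]
      congr 1
      exact funext hTf
    rw [hord, ← hpo] at hmul
    have h0 : analyticOrderAt f c = 0 :=
      ENat.add_right_injective_of_ne_top (hfin c) (hmul.symm.trans (add_zero _).symm)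
    exact (hf.analyticAt c).analyticOrderAt_eq_zero.1 h0
  -- The quotient `f` has no zeros, so `f' / f` is entire. It grows at most quadratically off the
  -- discs, hence everywhere, and is `o(y)` at `iy`; it is therefore constant.
  have hg : Differentiable ℂ (logDeriv f) := by
    have h1 : Differentiable ℂ (deriv f) := fun c => (hf.analyticAt c).deriv.differentiableAt
    exact h1.div hf hf0
  have hsub : ∀ ζ, R ≤ ‖ζ‖ → (∀ n, 1 ≤ n → ε ≤ ‖ζ - a n‖) →
      logDeriv f ζ = logDeriv T ζ - logDeriv (genusOneProduct μ z) ζ := by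
    intro ζ h1 h2
    have hne : genusOneProduct μ z ζ ≠ 0 := h.product_ne_zero fun n hn => by
      have := hoff ζ h1 h2 n
      rw [hn, sub_self, norm_zero] at this
      linarith
    rw [show T = fun z' => genusOneProduct μ z z' * f z' from funext hTf,
      logDeriv_mul ζ hne (hf0 ζ) (hdiff ζ) (hf ζ)]
    ring
  have hbd : ∀ ζ, R ≤ ‖ζ‖ → (∀ n, 1 ≤ n → ε ≤ ‖ζ - a n‖) → ‖logDeriv f ζ‖ ≤
      (|C| + (D + 1) * (1 + (D + 1) / ε') * ∑' n, ‖μ n‖⁻¹ ^ 2) * (1 + ‖ζ‖) ^ 2 := by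
    intro ζ h1 h2
    rw [hsub ζ h1 h2]
    have h3 := hlog ζ h1 h2
    have h4 := h.norm_logDeriv_product_le hD hε' (hoff ζ h1 h2)
    have hA : 0 ≤ ∑' n, ‖μ n‖⁻¹ ^ 2 := tsum_nonneg fun n => by positivity
    have h5 : |C| ≤ |C| * (1 + ‖ζ‖) ^ 2 :=
      le_mul_of_one_le_right (abs_nonneg _) (one_le_pow₀ (by linarith [norm_nonneg ζ]))
    have hDζ : D + ‖ζ‖ ≤ (D + 1) * (1 + ‖ζ‖) := by
      nlinarith [norm_nonneg ζ]
    have h6 : (D + ‖ζ‖) * (1 + (D + ‖ζ‖) / ε') ≤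
        ((D + 1) * (1 + ‖ζ‖)) * ((1 + (D + 1) / ε') * (1 + ‖ζ‖)) := by
      have h7 : 1 + ((D + 1) * (1 + ‖ζ‖)) / ε' ≤ (1 + (D + 1) / ε') * (1 + ‖ζ‖) := by
        rw [mul_div_right_comm, add_mul, one_mul]
        linarith [norm_nonneg ζ]
      refine mul_le_mul hDζ (le_trans ?_ h7) (by positivity) (by positivity)
      gcongr
    calc ‖logDeriv T ζ - logDeriv (genusOneProduct μ z) ζ‖
        ≤ |C| + (D + ‖ζ‖) * (1 + (D + ‖ζ‖) / ε') * ∑' n, ‖μ n‖⁻¹ ^ 2 :=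
          (norm_sub_le _ _).trans (add_le_add (h3.trans (le_abs_self C)) h4)
      _ ≤ |C| * (1 + ‖ζ‖) ^ 2 + ((D + 1) * (1 + ‖ζ‖)) * ((1 + (D + 1) / ε') * (1 + ‖ζ‖)) *
          ∑' n, ‖μ n‖⁻¹ ^ 2 := by gcongr
      _ = _ := by ring
  obtain ⟨C', hC'⟩ := exists_norm_le_of_off_discs hε hsph hg hbd
  have hlim : Tendsto (fun y : ℝ => logDeriv f (y * Complex.I) / y) atTop (𝓝 0) := by
    have h1 := h.tendsto_logDeriv_product_div hD hH
    have h2 : Tendsto (fun y : ℝ => logDeriv T (y * Complex.I) / y) atTop (𝓝 0) := by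
      refine squeeze_zero_norm' (a := fun y : ℝ => C * y⁻¹) ?_
        (by simpa using tendsto_inv_atTop_zero.const_mul C)
      filter_upwards [eventually_off_discs him ε R, eventually_gt_atTop 0] with y hy hy0
      rw [norm_div, Complex.norm_real, Real.norm_of_nonneg hy0.le, div_eq_mul_inv]
      gcongr
      exact hlog _ hy.1 hy.2
    have h3 := h2.sub h1
    rw [sub_zero] at h3
    refine h3.congr' ?_
    filter_upwards [eventually_off_discs him ε R] with y hy
    rw [hsub _ hy.1 hy.2, sub_div]
  have hconst := eq_const_of_quadratic_growth hg hC' hlim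
  set B := logDeriv f 0
  have hderiv : ∀ ζ, HasDerivAt (fun ζ => f ζ * Complex.exp (-(B * ζ))) 0 ζ := by
    intro ζ
    have h1 := (hf ζ).hasDerivAt.mul (((hasDerivAt_id ζ).const_mul B).neg).cexp
    refine h1.congr_deriv ?_
    have h2 : deriv f ζ = B * f ζ := by
      rw [← hconst ζ, logDeriv_apply, div_mul_cancel₀ _ (hf0 ζ)]
    simp only [id, h2]
    ring
  refine ⟨f 0, B, hf0 0, fun ζ => ?_⟩
  have h1 := is_const_of_deriv_eq_zero (fun ζ => (hderiv ζ).differentiableAt)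
    (fun ζ => (hderiv ζ).deriv) ζ 0
  simp only [mul_zero, neg_zero, Complex.exp_zero, mul_one] at h1
  rw [hTf ζ, ← h1, mul_assoc (f ζ), ← Complex.exp_add, neg_add_cancel, Complex.exp_zero, mul_one,
    mul_comm]

end Hadamard

/-! ### Sequences close to the zeros of `S`. -/

section ZeroAsymptotics

variable {N : ℕ} {a z : ℤ → ℂ} {H : ℝ}

theorem muSeq_ne_zero (a : ℤ → ℂ) (n : ℤ) : muSeq a n ≠ 0 := by
  unfold muSeq
  split_ifs with h
  · simp
  · exact h

theorem muSeq_of_ne_zero {n : ℤ} (h : a n ≠ 0) : muSeq a n = a n := if_neg h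

theorem norm_sub_muSeq_le (a : ℤ → ℂ) (n : ℤ) : ‖a n - muSeq a n‖ ≤ 1 := by
  unfold muSeq
  split_ifs with h
  · simp [h]
  · simp

theorem AsymptoticallySeparated.finite_Ici_norm_le (hsep : AsymptoticallySeparated a)
    (him : ∀ n, 1 ≤ n → |(a n).im| ≤ H) (k : ℤ) (R : ℝ) : {n : Set.Ici k | ‖a n‖ ≤ R}.Finite := by
  refine Set.Finite.of_finite_image (((hsep.finite_norm_le him R).union
    (Set.finite_Ico k 1)).subset ?_) Subtype.val_injective.injOn
  rintro _ ⟨n, hn, rfl⟩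
  rcases lt_or_ge (n : ℤ) 1 with h | h
  · exact Or.inr ⟨n.2, h⟩
  · exact Or.inl ⟨h, hn⟩

theorem exists_forall_Ici_le {k l : ℤ} {f : ℤ → ℝ} {B : ℝ} (h : ∀ n, l ≤ n → f n ≤ B) :
    ∃ B' : ℝ, 0 ≤ B' ∧ ∀ n, k ≤ n → f n ≤ B' := by
  refine ⟨|B| + ∑ n ∈ Finset.Ico k l, |f n|, by positivity, fun n hn => ?_⟩
  have h0 : 0 ≤ ∑ n ∈ Finset.Ico k l, |f n| := Finset.sum_nonneg fun _ _ => abs_nonneg _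
  rcases lt_or_ge n l with h' | h'
  · have := Finset.single_le_sum (f := fun n => |f n|) (fun _ _ => abs_nonneg _)
      (Finset.mem_Ico.2 ⟨hn, h'⟩)
    linarith [le_abs_self (f n), abs_nonneg B]
  · linarith [h n h', le_abs_self B]

theorem summable_inv_muSeq_sq (hsep : AsymptoticallySeparated a)
    (him : ∀ n, 1 ≤ n → |(a n).im| ≤ H) (k : ℤ) :
    Summable fun n : Set.Ici k => ‖muSeq a n‖⁻¹ ^ 2 := by
  refine (summable_congr_cofinite ?_).1 (hsep.summable_inv_sq him k)
  filter_upwards [(hsep.finite_Ici_norm_le him k 0).compl_mem_cofinite] with n hn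
  simp only [Set.mem_compl_iff, Set.mem_ofPred_eq, norm_le_zero_iff] at hn
  rw [muSeq_of_ne_zero hn]

theorem exists_inv_norm_muSeq_le (hsep : AsymptoticallySeparated a)
    (him : ∀ n, 1 ≤ n → |(a n).im| ≤ H) (k : ℤ) :
    ∃ B : ℝ, 0 ≤ B ∧ ∀ n, k ≤ n → ‖muSeq a n‖⁻¹ ≤ B := by
  obtain ⟨n₁, -, h⟩ := hsep.exists_forall_le_norm him 1
  refine exists_forall_Ici_le (l := n₁) (B := 1) fun n hn => ?_
  have h1 := h n hn
  rw [muSeq_of_ne_zero (norm_pos_iff.1 (by linarith))]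
  exact inv_le_one_of_one_le₀ h1.le

theorem HasZeroAsymptotics.summable_sq (h : HasZeroAsymptotics N a z)
    (hsep : AsymptoticallySeparated a) (him : ∀ n, 1 ≤ n → |(a n).im| ≤ H) :
    Summable fun n : Set.Ici (1 - (N : ℤ)) => ‖z n - a n‖ ^ 2 := by
  obtain ⟨κ, hκ, hz⟩ := h
  obtain ⟨B, hB0, hB⟩ := exists_inv_norm_muSeq_le hsep him (1 - (N : ℤ))
  have h1 := hκ.summable (by norm_num)
  simp only [ENNReal.toReal_ofNat, Real.rpow_ofNat] at h1
  refine (h1.mul_left ((B ^ N) ^ 2)).of_nonneg_of_le (fun n => by positivity) fun n => ?_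
  rw [hz n, add_sub_cancel_left, norm_div, norm_pow, ← mul_pow, div_eq_inv_mul, ← inv_pow]
  gcongr
  exact hB n n.2

/-- Both `z n - a n` and `1 / μ n` are square summable, so their product is summable. The finitely
many indices with `a n = 0`, where `μ n = -1`, are harmless. -/
theorem genusOneConvergent_of_summable_sq (hsep : AsymptoticallySeparated a)
    (him : ∀ n, 1 ≤ n → |(a n).im| ≤ H) {k : ℤ}
    (hz : Summable fun n : Set.Ici k => ‖z n - a n‖ ^ 2) :
    GenusOneConvergent (fun n : Set.Ici k => muSeq a n) fun n => z n where
  ne_zero n := muSeq_ne_zero a n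
  summable_inv_sq := summable_inv_muSeq_sq hsep him k
  summable_sub := by
    refine (hz.add (summable_inv_muSeq_sq hsep him k)).of_norm_bounded_eventually ?_
    filter_upwards [(hsep.finite_Ici_norm_le him k 0).compl_mem_cofinite] with n hn
    simp only [Set.mem_compl_iff, Set.mem_ofPred_eq, norm_le_zero_iff] at hn
    rw [muSeq_of_ne_zero hn, Real.norm_of_nonneg (by positivity)]
    nlinarith [sq_nonneg (‖z n - a n‖ - ‖a n‖⁻¹), sq_nonneg (‖z n - a n‖ + ‖a n‖⁻¹)]

theorem exists_norm_sub_muSeq_le {k : ℤ}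
    (hz : Summable fun n : Set.Ici k => ‖z n - a n‖ ^ 2) :
    ∃ D : ℝ, 0 ≤ D ∧ ∀ n : Set.Ici k, ‖z n - a n‖ ≤ D ∧ ‖z n - muSeq a n‖ ≤ D := by
  set A := ∑' n : Set.Ici k, ‖z n - a n‖ ^ 2
  have h1 : ∀ n : Set.Ici k, ‖z n - a n‖ ≤ A + 1 := fun n => by
    have := hz.le_tsum n fun m _ => by positivity
    nlinarith [sq_nonneg (‖z n - a n‖ - 1)]
  have hA : 0 ≤ A := tsum_nonneg fun n => by positivity
  refine ⟨A + 2, by positivity, fun n => ⟨by linarith [h1 n], ?_⟩⟩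
  have := norm_sub_le_norm_sub_add_norm_sub (z n) (a n) (muSeq a n)
  linarith [h1 n, norm_sub_muSeq_le a n]

theorem exists_abs_im_le_of_summable_sq (him : ∀ n, 1 ≤ n → |(a n).im| ≤ H) {k : ℤ}
    (hz : Summable fun n : Set.Ici k => ‖z n - a n‖ ^ 2) :
    ∃ H' : ℝ, ∀ n : Set.Ici k, |(z n).im| ≤ H' := by
  obtain ⟨D, -, hD⟩ := exists_norm_sub_muSeq_le hz
  obtain ⟨H', -, hH'⟩ := exists_forall_Ici_le (k := k) him
  refine ⟨D + H', fun n => ?_⟩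
  have h1 := (Complex.abs_im_le_norm (z n - a n)).trans (hD n).1
  rw [Complex.sub_im] at h1
  linarith [abs_sub_abs_le_abs_sub (z n).im (a n).im, hH' n n.2]

/-- All but finitely many `z n` lie within `ε / 2` of `a n`; the others are bounded and are avoided
by taking `ζ` large. -/
theorem exists_le_norm_sub_of_off_discs {k : ℤ}
    (hz : Summable fun n : Set.Ici k => ‖z n - a n‖ ^ 2) {ε : ℝ} (hε : 0 < ε) :
    ∃ R : ℝ, ∀ ζ, R ≤ ‖ζ‖ → (∀ n, 1 ≤ n → ε ≤ ‖ζ - a n‖) →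
      ∀ n : Set.Ici k, ε / 2 ≤ ‖z n - ζ‖ := by
  have hfin : {n : Set.Ici k | ¬ ‖z n - a n‖ ^ 2 < (ε / 2) ^ 2}.Finite :=
    hz.tendsto_cofinite_zero.eventually (gt_mem_nhds (by positivity : 0 < (ε / 2) ^ 2))
  have hfin2 : ({n : Set.Ici k | ¬ ‖z n - a n‖ ^ 2 < (ε / 2) ^ 2} ∪ {n | (n : ℤ) < 1}).Finite := by
    refine hfin.union (Set.Finite.of_finite_image ((Set.finite_Ico k 1).subset ?_)
      Subtype.val_injective.injOn)
    rintro _ ⟨n, hn, rfl⟩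
    exact ⟨n.2, hn⟩
  obtain ⟨M, hM⟩ := (hfin2.image fun n : Set.Ici k => ‖z n‖).bddAbove
  refine ⟨M + ε / 2, fun ζ hζ hoff n => ?_⟩
  by_cases hn : n ∈ ({n : Set.Ici k | ¬ ‖z n - a n‖ ^ 2 < (ε / 2) ^ 2} ∪ {n | (n : ℤ) < 1})
  · have h1 : ‖z n‖ ≤ M := hM ⟨n, hn, rfl⟩
    have h2 := norm_sub_norm_le ζ (z n)
    rw [norm_sub_rev] at h2
    linarith
  · simp only [Set.mem_union, Set.mem_ofPred_eq, not_or, not_lt] at hn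
    have h1 := (sq_lt_sq₀ (norm_nonneg _) (half_pos hε).le).1 (not_le.1 hn.1)
    have h2 := hoff n hn.2
    have h3 := norm_sub_le_norm_sub_add_norm_sub ζ (z n) (a n)
    rw [norm_sub_rev ζ (z n)] at h3
    linarith

theorem encard_subtype_eq {k : ℤ} (c : ℂ) :
    {n : Set.Ici k | z n = c}.encard = {n : ℤ | n ∈ Set.Ici k ∧ z n = c}.encard := by
  rw [← Subtype.val_injective.encard_image]
  congr 1
  ext n
  simp [and_comm]

/-- Factorization of an entire function whose zeros are close to the terms of `a`. -/
theorem exists_eq_exp_mul_product_of_summable_sq (hsep : AsymptoticallySeparated a)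
    (him : ∀ n, 1 ≤ n → |(a n).im| ≤ H) {k : ℤ}
    (hz : Summable fun n : Set.Ici k => ‖z n - a n‖ ^ 2) {T : ℂ → ℂ} (hT : Differentiable ℂ T)
    (hTz : EnumeratesZeros T (Set.Ici k) z)
    (hlog : ∀ ε, 0 < ε → ∃ C R : ℝ, ∀ ζ, R ≤ ‖ζ‖ → (∀ n, 1 ≤ n → ε ≤ ‖ζ - a n‖) →
      ‖logDeriv T ζ‖ ≤ C) :
    ∃ A B : ℂ, A ≠ 0 ∧ ∀ ζ, T ζ = A * Complex.exp (B * ζ) *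
      genusOneProduct (fun n : Set.Ici k => muSeq a n) (fun n => z n) ζ := by
  obtain ⟨δ, hδ, n₀, hn₀, -, hsph⟩ := hsep.exists_sphere_off_discs
  obtain ⟨R', hR'⟩ := hsph (δ / 2) (by positivity) (by linarith)
  obtain ⟨D, hD0, hD⟩ := exists_norm_sub_muSeq_le hz
  obtain ⟨H', hH'⟩ := exists_abs_im_le_of_summable_sq him hz
  obtain ⟨R₁, hoff⟩ := exists_le_norm_sub_of_off_discs hz (half_pos hδ)
  obtain ⟨C, R₂, hlog⟩ := hlog (δ / 2) (half_pos hδ)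
  exact (genusOneConvergent_of_summable_sq hsep him hz).exists_eq_exp_mul_product hD0
    (fun n => (hD n).2) hH' him (half_pos hδ) (half_pos (half_pos hδ)) hR'
    (R := max R₁ R₂) (fun ζ h => hoff ζ ((le_max_left _ _).trans h)) hT
    (fun c => by rw [encard_subtype_eq, hTz c])
    fun ζ h => hlog ζ ((le_max_right _ _).trans h)

theorem tendsto_genusOneProduct_div (hsep : AsymptoticallySeparated a)
    (him : ∀ n, 1 ≤ n → |(a n).im| ≤ H) {k : ℤ}
    (hz : Summable fun n : Set.Ici k => ‖z n - a n‖ ^ 2) :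
    Tendsto (fun y : ℝ =>
      genusOneProduct (fun n : Set.Ici k => muSeq a n) (fun n => z n) (y * Complex.I) /
      genusOneProduct (fun n : Set.Ici k => muSeq a n) (fun n => a n) (y * Complex.I))
      atTop (𝓝 1) := by
  have ha : Summable fun n : Set.Ici k => ‖a n - a n‖ ^ 2 := by simp
  obtain ⟨H', hH'⟩ := exists_abs_im_le_of_summable_sq him ha
  exact (genusOneConvergent_of_summable_sq hsep him hz).tendsto_product_div_product
    (genusOneConvergent_of_summable_sq hsep him ha) (fun n => norm_sub_muSeq_le a n) hH'

end ZeroAsymptotics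

/-! ### Zeros of `θ` near the large zeros of `S₀`. -/

section LocalZeros

variable {N : ℕ} {b : ℝ} {P : Polynomial ℂ} {S₀ : ℂ → ℂ} {w : ℝ → ℂ} {a : ℤ → ℂ}

/-- The quotient `g` has no zero in the closed disc, so the maximum principle for `1 / g` carries
the lower bound inward from the circle. The point is that `c` does not depend on `n`. -/
theorem IsSineType.exists_le_norm_div_sub (hS₀ : IsSineType b S₀) (hb : 0 < b)
    (hz : EnumeratesZeros S₀ (Set.Ici 1) a) (hsep : AsymptoticallySeparated a) {ε : ℝ}
    (hε : 0 < ε) :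
    ∃ c : ℝ, 0 < c ∧ ∀ n, 1 ≤ n → (∀ k, 1 ≤ k → k ≠ n → ε < ‖a n - a k‖) →
      (∀ v, ‖v - a n‖ = ε → ∀ k, 1 ≤ k → ε ≤ ‖v - a k‖) →
      ∃ g : ℂ → ℂ, Differentiable ℂ g ∧ (∀ z, S₀ z = (z - a n) * g z) ∧
        ∀ z ∈ Metric.ball (a n) ε, c ≤ ‖g z‖ := by
  obtain ⟨c, hc, hlow⟩ := hS₀.exists_le_norm hb hz hsep hε
  refine ⟨c / ε, by positivity, fun n hn hiso hsph => ?_⟩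
  obtain ⟨g, hg, hSg, hg0⟩ := hz.exists_eq_prod_mul hS₀.entire {n}
    fun k hk => by rw [Finset.mem_singleton] at hk; subst hk; exact hn
  simp only [Finset.prod_singleton, Finset.mem_singleton] at hSg hg0
  refine ⟨g, hg, hSg, fun z hz => ?_⟩
  have hne : ∀ v ∈ Metric.closedBall (a n) ε, g v ≠ 0 := by
    intro v hv
    refine hg0 v fun k hk hkv => ?_
    by_contra hkn
    have h1 := hiso k hk hkn
    rw [mem_closedBall_iff_norm, norm_sub_rev, ← hkv] at hv
    linarith
  have hcl : closure (Metric.ball (a n) ε) = Metric.closedBall (a n) ε := closure_ball _ hε.ne'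
  have h1 : ‖(g z)⁻¹‖ ≤ ε / c := by
    refine Complex.norm_le_of_forall_mem_frontier_norm_le (f := fun z => (g z)⁻¹)
      (U := Metric.ball (a n) ε) Metric.isBounded_ball
      (hg.diffContOnCl.inv fun v hv => hne v (hcl ▸ hv)) ?_ (subset_closure hz)
    intro v hv
    rw [frontier_ball _ hε.ne'] at hv
    have h2 := hne v (Metric.sphere_subset_closedBall hv)
    rw [mem_sphere_iff_norm] at hv
    have h3 := hlow v (hsph v hv)
    rw [hSg, norm_mul, hv] at h3
    have h4 : c ≤ ε * ‖g v‖ :=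
      (le_mul_of_one_le_right hc.le (Real.one_le_exp (by positivity))).trans h3
    rw [norm_inv, inv_eq_one_div, div_le_div_iff₀ (norm_pos_iff.2 h2) hc]
    linarith
  have h2 : 0 < ‖g z‖ := norm_pos_iff.2 (hne z (Metric.ball_subset_closedBall hz))
  rw [norm_inv, inv_eq_one_div, div_le_div_iff₀ h2 hc] at h1
  rw [div_le_iff₀ hε]
  linarith

open scoped Classical in
/-- For large `n`, the function `θ` has exactly one zero `u n` near `a n`; this zero is simple. -/
theorem IsSineType.exists_local_zeros (hS₀ : IsSineType b S₀) (hb : 0 < b)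
    (hP : P.degree = (N : WithBot ℕ)) (hz : EnumeratesZeros S₀ (Set.Ici 1) a)
    (hsep : AsymptoticallySeparated a)
    (hw : MemLp w 2 (volume.restrict (Set.Ioo (-b) b))) :
    ∃ (ε : ℝ) (n₁ : ℤ) (u : ℤ → ℂ) (R : ℝ), 0 < ε ∧ 1 ≤ n₁ ∧ (∀ n, n₁ ≤ n → 1 ≤ ‖a n‖) ∧
      (∀ n, n₁ ≤ n → u n ∈ Metric.ball (a n) ε) ∧
      (∀ n, n₁ ≤ n → ∀ c ∈ Metric.ball (a n) ε,
        analyticOrderAt (theta b P S₀ w) c = if c = u n then 1 else 0) ∧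
      (∀ n k, n₁ ≤ n → n₁ ≤ k → n ≠ k →
        Disjoint (Metric.ball (a n) ε) (Metric.ball (a k) ε)) ∧
      (∀ ζ, R ≤ ‖ζ‖ → (∀ n, n₁ ≤ n → ε ≤ ‖ζ - a n‖) → theta b P S₀ w ζ ≠ 0) ∧
      Summable fun n : Set.Ici n₁ => (‖u n - a n‖ * ‖a n‖ ^ N) ^ 2 := by
  have hP0 : P ≠ 0 := by rintro rfl; simp at hP
  have hN : P.natDegree = N := Polynomial.natDegree_eq_of_degree_eq_some hP
  obtain ⟨H, him⟩ := hS₀.exists_abs_im_le hz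
  have hH0 : 0 ≤ H := (abs_nonneg _).trans (him 1 le_rfl)
  obtain ⟨δ, hδ, n₀, hn₀, hδsep, hsph⟩ := hsep.exists_sphere_off_discs
  set ε := δ / 2 with hεdef
  have hε : 0 < ε := half_pos hδ
  obtain ⟨R', hR'⟩ := hsph ε hε (by linarith)
  obtain ⟨c₁, hc₁, hg⟩ := hS₀.exists_le_norm_div_sub hb hz hsep hε
  obtain ⟨cP, _, RP, hcP, -, hRP, hPb⟩ := P.exists_norm_eval_bounds hP0
  rw [hN] at hPb
  -- Chosen so that `|F / (P g)| ≤ ε / 8` on the disc, as `exists_unique_simple_zero` requires; `H +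
  -- ε` bounds `|Im v|` there.
  set ε₁ := cP * c₁ * (ε / 8) / Real.exp (b * (H + ε)) with hε₁
  obtain ⟨RF, hF⟩ := exists_norm_expIntegral_le hw hb (show 0 < ε₁ by positivity)
  obtain ⟨cθ, Rθ, hcθ, hRθ, hθ⟩ := hS₀.exists_le_norm_theta hb hP hz hsep hw hε
  set B := ∑ j ∈ Finset.Ico 1 n₀, ‖a j‖ with hB
  have hBle : ∀ k, 1 ≤ k → k < n₀ → ‖a k‖ ≤ B := fun k hk hk' =>
    Finset.single_le_sum (f := fun j => ‖a j‖) (fun _ _ => norm_nonneg _)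
      (Finset.mem_Ico.2 ⟨hk, hk'⟩)
  obtain ⟨n₂, hn₂, hlarge⟩ := hsep.exists_forall_le_norm him
    (|R'| + RP + |RF| + B + 2 * ε + 1)
  have hB0 : 0 ≤ B := Finset.sum_nonneg fun _ _ => norm_nonneg _
  set n₁ := max n₀ n₂
  have hn₁ : 1 ≤ n₁ := hn₀.trans (le_max_left _ _)
  have hn₁0 : ∀ n, n₁ ≤ n → n₀ ≤ n := fun n hn => (le_max_left _ _).trans hn
  have hlarge' : ∀ n, n₁ ≤ n → |R'| + RP + |RF| + B + 2 * ε + 1 < ‖a n‖ :=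
    fun n hn => hlarge n ((le_max_right _ _).trans hn)
  have hiso : ∀ n, n₁ ≤ n → ∀ k, 1 ≤ k → k ≠ n → ε < ‖a n - a k‖ := by
    intro n hn k hk hkn
    rcases lt_or_ge k n₀ with h | h
    · have := norm_sub_norm_le (a n) (a k)
      linarith [hlarge' n hn, hBle k hk h, abs_nonneg R', abs_nonneg RF]
    · linarith [hδsep n k (hn₁0 n hn) h hkn.symm]
  have hlocal : ∀ n, n₁ ≤ n → ∃ u ∈ Metric.ball (a n) ε,
      (∀ c ∈ Metric.ball (a n) ε,
        analyticOrderAt (theta b P S₀ w) c = if c = u then 1 else 0) ∧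
      ‖u - a n‖ * ‖a n‖ ^ N ≤ 2 ^ N / (cP * c₁) * ‖expIntegral b w u‖ := by
    intro n hn
    have hRan := hlarge' n hn
    have hball : ∀ v ∈ Metric.closedBall (a n) ε, |R'| + RP + |RF| + 1 ≤ ‖v‖ ∧
        ‖a n‖ ≤ 2 * ‖v‖ ∧ |v.im| ≤ H + ε := by
      intro v hv
      rw [mem_closedBall_iff_norm] at hv
      have h1 := norm_sub_norm_le (a n) v
      rw [norm_sub_rev] at h1
      have h2 := (Complex.abs_im_le_norm (v - a n)).trans hv
      rw [Complex.sub_im] at h2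
      have h3 := abs_sub_abs_le_abs_sub v.im (a n).im
      have h4 := him n (hn₁.trans hn)
      refine ⟨?_, ?_, ?_⟩ <;> linarith [abs_nonneg R', abs_nonneg RF]
    obtain ⟨g, hgd, hSg, hgl⟩ := hg n (hn₁.trans hn) (hiso n hn) fun v hv =>
      hR' n (hn₁.trans hn) v (by
        linarith [(hball v (mem_closedBall_iff_norm.2 hv.le)).1, le_abs_self R', abs_nonneg RF]) hv
    have hPl : ∀ v ∈ Metric.ball (a n) ε, cP * ‖v‖ ^ N ≤ ‖P.eval v‖ ∧ 1 ≤ ‖v‖ := by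
      intro v hv
      have h1 := (hball v (Metric.ball_subset_closedBall hv)).1
      have h2 : RP ≤ ‖v‖ := by linarith [abs_nonneg R', abs_nonneg RF]
      exact ⟨(hPb v h2).1, hRP.trans h2⟩
    have hPg : ∀ v ∈ Metric.ball (a n) ε, cP * ‖v‖ ^ N * c₁ ≤ ‖P.eval v * g v‖ := by
      intro v hv
      rw [norm_mul]
      have := hPl v hv
      exact mul_le_mul this.1 (hgl v hv) hc₁.le (norm_nonneg _)
    have hPg0 : ∀ v ∈ Metric.ball (a n) ε, P.eval v * g v ≠ 0 := by
      intro v hv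
      have h1 := hPg v hv
      have h2 := (hPl v hv).2
      exact norm_pos_iff.1 (lt_of_lt_of_le (by positivity) h1)
    have hPgd : Differentiable ℂ fun v => P.eval v * g v := P.differentiable.mul hgd
    have hFd := differentiable_expIntegral (b := b) (memLp_integrable hw)
    obtain ⟨u, hu, hord⟩ := exists_unique_simple_zero hε
      (h := fun v => expIntegral b w v / (P.eval v * g v))
      (hFd.differentiableOn.div hPgd.differentiableOn hPg0) (by
        intro v hv
        have h1 := hPg v hv
        have h2 := (hPl v hv).2
        have h3 := hball v (Metric.ball_subset_closedBall hv)
        have h4 := hF v (by linarith [abs_nonneg R', le_abs_self RF])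
        have h5 : Real.exp (b * |v.im|) ≤ Real.exp (b * (H + ε)) := by gcongr; exact h3.2.2
        have h6 : (1 : ℝ) ≤ ‖v‖ ^ N := one_le_pow₀ h2
        rw [norm_div, div_le_iff₀ (norm_pos_iff.2 (hPg0 v hv))]
        calc ‖expIntegral b w v‖ ≤ ε₁ * Real.exp (b * (H + ε)) :=
              h4.trans (mul_le_mul_of_nonneg_left h5 (by positivity))
          _ = ε / 8 * (cP * 1 * c₁) := by rw [hε₁]; field_simp
          _ ≤ ε / 8 * (cP * ‖v‖ ^ N * c₁) := by gcongr
          _ ≤ _ := by gcongr)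
    have hθeq : ∀ v ∈ Metric.ball (a n) ε, theta b P S₀ w v =
        (P.eval v * g v) * (v - a n + expIntegral b w v / (P.eval v * g v)) := by
      intro v hv
      rw [theta_eq, principalPart, hSg, mul_add, mul_div_cancel₀ _ (hPg0 v hv)]
      ring
    have hordθ : ∀ c ∈ Metric.ball (a n) ε,
        analyticOrderAt (theta b P S₀ w) c = if c = u then 1 else 0 := by
      intro c hc
      have hev : theta b P S₀ w =ᶠ[𝓝 c] (fun v => P.eval v * g v) *
          fun v => v - a n + expIntegral b w v / (P.eval v * g v) := by
        filter_upwards [Metric.isOpen_ball.mem_nhds hc] with v hv using hθeq v hv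
      have han : AnalyticAt ℂ (fun v => v - a n + expIntegral b w v / (P.eval v * g v)) c :=
        (Differentiable.analyticAt (by fun_prop) c).add
          ((hFd.analyticAt c).div (hPgd.analyticAt c) (hPg0 c hc))
      rw [analyticOrderAt_congr hev, analyticOrderAt_mul (hPgd.analyticAt c) han, hord c hc,
        (hPgd.analyticAt c).analyticOrderAt_eq_zero.2 (hPg0 c hc), zero_add]
    refine ⟨u, hu, hordθ, ?_⟩
    -- At the zero, `F u = -P u g u (u - a n)`, so the lower bound for `P g` controls the
    -- displacement of the zero; the factor `2 ^ N` comes from `|a n| ≤ 2 |u|`.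
    have hu0 : theta b P S₀ w u = 0 := by
      refine apply_eq_zero_of_analyticOrderAt_ne_zero ?_
      rw [hordθ u hu, if_pos rfl]
      exact one_ne_zero
    have hFu : expIntegral b w u = -((P.eval u * g u) * (u - a n)) := by
      rw [theta_eq, principalPart, hSg] at hu0
      linear_combination hu0
    have h1 := hPg u hu
    have h2 := (hball u (Metric.ball_subset_closedBall hu)).2.1
    rw [hFu, norm_neg, norm_mul]
    calc ‖u - a n‖ * ‖a n‖ ^ N ≤ ‖u - a n‖ * (2 * ‖u‖) ^ N := by gcongr
      _ = 2 ^ N / (cP * c₁) * ((cP * ‖u‖ ^ N * c₁) * ‖u - a n‖) := by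
        rw [mul_pow]; field_simp
      _ ≤ _ := by gcongr
  choose! u hu hord hul using hlocal
  refine ⟨ε, n₁, u, Rθ + ∑ j ∈ Finset.Ico 1 n₁, ‖a j‖ + ε, hε, hn₁, fun n hn => ?_, hu, hord, ?_,
    ?_, ?_⟩
  · linarith [hlarge' n hn, abs_nonneg R', abs_nonneg RF]
  · intro n k hn hk hnk
    refine Metric.ball_disjoint_ball ?_
    rw [dist_eq_norm]
    linarith [hδsep n k (hn₁0 n hn) (hn₁0 k hk) hnk]
  · intro ζ hζ hoff
    have hS0 : 0 ≤ ∑ j ∈ Finset.Ico 1 n₁, ‖a j‖ := Finset.sum_nonneg fun _ _ => norm_nonneg _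
    have h1 := hθ ζ (by linarith) fun k hk => ?_
    · have h2 : 0 < ‖ζ‖ := by linarith
      exact norm_pos_iff.1 (lt_of_lt_of_le (by positivity) h1)
    · rcases lt_or_ge k n₁ with h | h
      · have h3 : ‖a k‖ ≤ ∑ j ∈ Finset.Ico 1 n₁, ‖a j‖ :=
          Finset.single_le_sum (f := fun j => ‖a j‖) (fun _ _ => norm_nonneg _)
            (Finset.mem_Ico.2 ⟨hk, h⟩)
        have h4 := norm_sub_norm_le ζ (a k)
        linarith
      · exact hoff k h
  -- The grid step is at most `π / b`, as Plancherel–Pólya needs; `u n` stays within a fixed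
  -- distance of the lattice point of its column.
  · obtain ⟨η, hη, hηb, T, n₃, hn₃, hT, hinj⟩ := hsep.exists_grid him
      (show 0 < Real.pi / b by positivity)
    obtain ⟨G, hG, hG0, hGF⟩ := exists_summable_sq_norm_expIntegral_le hw hb hη
      ((le_div_iff₀ hb).1 hηb) (show 0 ≤ ε + η + H by positivity)
    have h1 : Summable fun n : Set.Ici n₁ => G ⌊(a n).re / η⌋ :=
      summable_Ici_of_summable_Ici (f := fun n => G ⌊(a n).re / η⌋)
        (summable_comp_of_injOn_prod hG hG0 hT hinj)
    refine (h1.mul_left ((2 ^ N / (cP * c₁)) ^ 2)).of_nonneg_of_le (fun n => by positivity)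
      fun n => ?_
    have hnear : ‖u n - η * (⌊(a n).re / η⌋ : ℤ)‖ ≤ ε + η + H := by
      set k := ⌊(a n).re / η⌋
      have e4 : (k : ℝ) * η ≤ (a n).re := (le_div_iff₀ hη).1 (Int.floor_le _)
      have e5 : (a n).re < (k + 1) * η := (div_lt_iff₀ hη).1 (Int.lt_floor_add_one _)
      have h2 := Complex.norm_le_abs_re_add_abs_im (a n - η * k)
      have h3 : (a n - η * k).re = (a n).re - k * η := by simp; ring
      have h4 : (a n - η * k).im = (a n).im := by simp
      rw [h3, h4] at h2
      have h5 : |(a n).re - k * η| ≤ η := abs_le.2 ⟨by linarith, by linarith⟩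
      have h6 := norm_sub_le_norm_sub_add_norm_sub (u n) (a n) (η * k)
      have h7 : ‖u n - a n‖ < ε := mem_ball_iff_norm.1 (hu n n.2)
      linarith [him n (hn₁.trans n.2)]
    calc (‖u n - a n‖ * ‖a n‖ ^ N) ^ 2
        ≤ (2 ^ N / (cP * c₁) * ‖expIntegral b w (u n)‖) ^ 2 := by
          exact pow_le_pow_left₀ (by positivity) (hul n n.2) 2
      _ = (2 ^ N / (cP * c₁)) ^ 2 * ‖expIntegral b w (u n)‖ ^ 2 := mul_pow _ _ _
      _ ≤ _ := by
          gcongr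
          exact hGF _ _ hnear

end LocalZeros

/-! ### Bookkeeping for multisets of zeros. -/

section Existence

theorem Differentiable.finite_zeros_inter {f : ℂ → ℂ} (hf : Differentiable ℂ f)
    (hf0 : ∀ c, analyticOrderAt f c ≠ ⊤) {K : Set ℂ} (hK : IsCompact K) :
    {z | z ∈ K ∧ f z = 0}.Finite := by
  by_contra hinf
  obtain ⟨c, -, hc⟩ := Set.Infinite.exists_accPt_of_subset_isCompact hinf hK fun z hz => hz.1
  refine hf0 c (analyticOrderAt_eq_top.2 ?_)
  refine ((hf.analyticAt c).eventually_eq_zero_or_eventually_ne_zero).resolve_right fun h => ?_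
  rw [accPt_iff_frequently_nhdsNE] at hc
  obtain ⟨z, hz, hz'⟩ := (hc.and_eventually h).exists
  exact hz' hz.2

open scoped Classical in
theorem encard_Ici_eq_add {k l : ℤ} (hkl : k ≤ l) (f u : ℤ → ℂ) (c : ℂ) :
    {n : ℤ | n ∈ Set.Ici k ∧ (if n < l then f n else u n) = c}.encard =
      (((Finset.Ico k l).filter (f · = c)).card : ℕ∞) +
        {n : ℤ | n ∈ Set.Ici l ∧ u n = c}.encard := by
  rw [← Set.encard_coe_eq_coe_finsetCard, ← Set.encard_union_eq]
  · congr 1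
    ext n
    simp only [Set.mem_Ici, Set.mem_ofPred_eq, Finset.coe_filter, Finset.mem_Ico, Set.mem_union]
    rcases lt_or_ge n l with h | h
    · simp [h, h.not_ge]
    · simp [h, h.not_gt, hkl.trans h]
  · rw [Set.disjoint_left]
    rintro n hn hn'
    simp only [Finset.coe_filter, Finset.mem_Ico, Set.mem_ofPred_eq, Set.mem_Ici] at hn hn'
    omega

/-- Relabels a finite multiset by any index set of the right size; it gives the exceptional zeros
integer indices. -/
theorem Finset.exists_card_filter_eq {ι κ α : Type*} [Inhabited α] [DecidableEq κ] [DecidableEq α]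
    {E : Finset ι} {F : Finset κ} (h : E.card = F.card) (r : ι → α) :
    ∃ f : κ → α, ∀ c, (F.filter (f · = c)).card = (E.filter (r · = c)).card := by
  let e := Finset.equivOfCardEq h
  refine ⟨fun n => if hn : n ∈ F then r (e.symm ⟨n, hn⟩) else default, fun c => ?_⟩
  refine (Finset.card_bij (fun x hx => (e ⟨x, (Finset.mem_filter.1 hx).1⟩ : κ)) ?_ ?_ ?_).symm
  · intro x hx
    have hx' := Finset.mem_filter.1 hx
    simp [hx'.2]
  · intro x hx y hy hxy
    simpa using e.injective (Subtype.ext hxy)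
  · intro n hn
    obtain ⟨hn1, hn2⟩ := Finset.mem_filter.1 hn
    simp only [dif_pos hn1] at hn2
    exact ⟨e.symm ⟨n, hn1⟩, Finset.mem_filter.2 ⟨(e.symm ⟨n, hn1⟩).2, hn2⟩, by simp⟩

open scoped Classical in
theorem card_filter_sigma_fst (Z : Finset ℂ) (m : ℂ → ℕ) (c : ℂ) :
    ((Z.sigma fun c => Finset.range (m c)).filter (Sigma.fst · = c)).card =
      if c ∈ Z then m c else 0 := by
  rw [Finset.card_filter, Finset.sum_sigma]
  rw [← Finset.sum_ite_eq' Z c m]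
  refine Finset.sum_congr rfl fun x _ => ?_
  split_ifs with h <;> simp [h]

variable {N : ℕ} {b : ℝ} {P : Polynomial ℂ} {S₀ : ℂ → ℂ} {w : ℝ → ℂ} {a : ℤ → ℂ} {H : ℝ}

theorem IsSineType.enumeratesZeros_principalPart (hS₀ : IsSineType b S₀)
    (hzP : EnumeratesZeros (fun z => P.eval z) (Set.Icc (1 - (N : ℤ)) 0) a)
    (hz : EnumeratesZeros S₀ (Set.Ici 1) a) :
    EnumeratesZeros (principalPart P S₀) (Set.Ici (1 - (N : ℤ))) a := by
  intro c
  have h1 : analyticOrderAt (principalPart P S₀) c =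
      analyticOrderAt (fun z => P.eval z) c + analyticOrderAt S₀ c :=
    analyticOrderAt_mul (P.differentiable.analyticAt c) (hS₀.entire.analyticAt c)
  rw [h1, ← hzP c, ← hz c, ← Set.encard_union_eq]
  · congr 1
    ext n
    simp only [Set.mem_Ici, Set.mem_ofPred_eq, Set.mem_Icc, Set.mem_union]
    by_cases hc : a n = c <;> simp only [hc, and_true, and_false, or_self]
    omega
  · rw [Set.disjoint_left]
    rintro n ⟨hn, -⟩ ⟨hn', -⟩
    simp only [Set.mem_Icc, Set.mem_Ici] at hn hn'
    omega

theorem norm_logDeriv_prod_sub_le {ι : Type*} (E : Finset ι) (r : ι → ℂ) {ζ : ℂ}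
    (h : ∀ x ∈ E, 1 ≤ ‖ζ - r x‖) : ‖logDeriv (fun z => ∏ x ∈ E, (z - r x)) ζ‖ ≤ E.card := by
  have h0 : ∀ x ∈ E, ζ - r x ≠ 0 := fun x hx => norm_pos_iff.1 (by linarith [h x hx])
  rw [logDeriv_prod (f := fun x z => z - r x) h0 fun x _ => by fun_prop]
  refine (norm_sum_le _ _).trans ?_
  rw [← nsmul_one, ← Finset.sum_const]
  refine Finset.sum_le_sum fun x hx => ?_
  rw [logDeriv_apply, deriv_sub_const, deriv_id'', norm_div, norm_one]
  exact (div_le_one (by linarith [h x hx])).2 (h x hx)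

open scoped Classical in
/-- Factorization of an entire function whose zeros, except for finitely many of them, are close
to the terms of `a`. -/
theorem exists_eq_prod_mul_exp_mul_product (hsep : AsymptoticallySeparated a)
    (him : ∀ n, 1 ≤ n → |(a n).im| ≤ H) {k : ℤ} {u : ℤ → ℂ}
    (hu : Summable fun n : Set.Ici k => ‖u n - a n‖ ^ 2) {T : ℂ → ℂ} (hT : Differentiable ℂ T)
    {ι : Type*} (E : Finset ι) (r : ι → ℂ)
    (hTz : ∀ c, analyticOrderAt T c = ((E.filter (r · = c)).card : ℕ∞) +
      {n : ℤ | n ∈ Set.Ici k ∧ u n = c}.encard)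
    (hlog : ∀ ε, 0 < ε → ∃ C R : ℝ, ∀ ζ, R ≤ ‖ζ‖ → (∀ n, 1 ≤ n → ε ≤ ‖ζ - a n‖) →
      T ζ ≠ 0 ∧ ‖logDeriv T ζ‖ ≤ C) :
    ∃ A B : ℂ, A ≠ 0 ∧ ∀ ζ, T ζ = (∏ x ∈ E, (ζ - r x)) * (A * Complex.exp (B * ζ) *
      genusOneProduct (fun n : Set.Ici k => muSeq a n) (fun n => u n) ζ) := by
  have hQ : Differentiable ℂ fun z => ∏ x ∈ E, (z - r x) := by fun_prop
  have hQo := analyticOrderAt_prod_sub E r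
  have hQt : ∀ c, analyticOrderAt (fun z => ∏ x ∈ E, (z - r x)) c ≠ ⊤ := fun c => by
    rw [hQo]; exact ENat.natCast_ne_top _
  obtain ⟨U, hU, hTU⟩ := exists_differentiable_mul_eq hT hQ hQt fun c => by
    rw [hQo, hTz]; exact le_self_add
  have hUz : EnumeratesZeros U (Set.Ici k) u := by
    intro c
    have h1 : analyticOrderAt T c = analyticOrderAt (fun z => ∏ x ∈ E, (z - r x)) c +
        analyticOrderAt U c := by
      rw [← analyticOrderAt_mul (hQ.analyticAt c) (hU.analyticAt c)]
      exact congrArg (analyticOrderAt · c) (funext hTU)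
    rw [hTz, hQo] at h1
    exact ENat.add_right_injective_of_ne_top (ENat.natCast_ne_top _) h1
  -- Far out, the logarithmic derivative of the polynomial factor is at most `E.card`, so removing
  -- that factor preserves the bound.
  obtain ⟨A, B, hA, hAB⟩ := exists_eq_exp_mul_product_of_summable_sq hsep him hu hU hUz (by
    intro ε hε
    obtain ⟨C, R, h⟩ := hlog ε hε
    refine ⟨C + E.card, max R (1 + ∑ x ∈ E, ‖r x‖), fun ζ hζ hoff => ?_⟩
    obtain ⟨h1, h2⟩ := h ζ ((le_max_left _ _).trans hζ) hoff
    have h3 := (le_max_right _ _).trans hζ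
    have h4 : ∀ x ∈ E, 1 ≤ ‖ζ - r x‖ := fun x hx => by
      have h5 := Finset.single_le_sum (f := fun x => ‖r x‖) (fun _ _ => norm_nonneg _) hx
      have h6 := norm_sub_norm_le ζ (r x)
      linarith
    have h5 := norm_logDeriv_prod_sub_le E r h4
    rw [hTU] at h1
    have h6 := logDeriv_mul ζ (left_ne_zero_of_mul h1) (right_ne_zero_of_mul h1) (hQ ζ) (hU ζ)
    rw [← show T = fun z => (∏ x ∈ E, (z - r x)) * U z from funext hTU] at h6
    rw [← sub_eq_iff_eq_add'.2 h6]
    exact (norm_sub_le _ _).trans (add_le_add h2 h5))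
  exact ⟨A, B, hA, fun ζ => by rw [hTU, hAB]⟩

end Existence

/-! ### Counting the exceptional zeros of `θ`. -/

section Existence

variable {N : ℕ} {b : ℝ} {P : Polynomial ℂ} {S₀ : ℂ → ℂ} {w : ℝ → ℂ} {a : ℤ → ℂ}

theorem IsSineType.analyticOrderAt_theta_ne_top (hS₀ : IsSineType b S₀) (hb : 0 < b)
    (hP : P.degree = (N : WithBot ℕ)) (hz : EnumeratesZeros S₀ (Set.Ici 1) a)
    (hsep : AsymptoticallySeparated a)
    (hw : MemLp w 2 (volume.restrict (Set.Ioo (-b) b))) (c : ℂ) :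
    analyticOrderAt (theta b P S₀ w) c ≠ ⊤ := by
  obtain ⟨H, him⟩ := hS₀.exists_abs_im_le hz
  obtain ⟨C, R, -, h⟩ := hS₀.exists_norm_logDeriv_theta_le hb hP hz hsep hw one_pos
  obtain ⟨y, hy⟩ := (eventually_off_discs him 1 R).exists
  exact (hS₀.differentiable_theta hw).analyticOrderAt_ne_top (h _ hy.1 hy.2).1 c

open scoped Classical in
/-- The zeros of `θ` are the points `u n` with `n ≥ n₁` and as many other points as there are
indices `n < n₁`. -/
theorem IsSineType.exists_zeros (hS₀ : IsSineType b S₀) (hb : 0 < b)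
    (hP : P.degree = (N : WithBot ℕ)) (hz : EnumeratesZeros S₀ (Set.Ici 1) a)
    (hsep : AsymptoticallySeparated a)
    (hw : MemLp w 2 (volume.restrict (Set.Ioo (-b) b))) :
    ∃ (n₁ : ℤ) (u : ℤ → ℂ) (E : Finset (Σ _ : ℂ, ℕ)), 1 ≤ n₁ ∧ (∀ n, n₁ ≤ n → 1 ≤ ‖a n‖) ∧
      (Summable fun n : Set.Ici n₁ => (‖u n - a n‖ * ‖a n‖ ^ N) ^ 2) ∧
      ∀ c, analyticOrderAt (theta b P S₀ w) c = ((E.filter (Sigma.fst · = c)).card : ℕ∞) +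
        {n : ℤ | n ∈ Set.Ici n₁ ∧ u n = c}.encard := by
  obtain ⟨ε, n₁, u, R, hε, hn₁, ha1, hu, hord, hdisj, hne, hsum⟩ :=
    hS₀.exists_local_zeros hb hP hz hsep hw
  have hθ := hS₀.differentiable_theta (P := P) hw
  have htop := hS₀.analyticOrderAt_theta_ne_top hb hP hz hsep hw
  have hK : IsCompact (Metric.closedBall (0 : ℂ) R \ ⋃ n ∈ Set.Ici n₁, Metric.ball (a n) ε) :=
    (isCompact_closedBall 0 R).diff (isOpen_biUnion fun n _ => Metric.isOpen_ball)
  -- Zeros outside all the discs satisfy `|z| < R`, so they lie in a compact set and are finite in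
  -- number.
  set Z := (hθ.finite_zeros_inter htop hK).toFinset with hZ
  have hmem : ∀ c, c ∈ Z ↔ theta b P S₀ w c = 0 ∧ ∀ n, n₁ ≤ n → c ∉ Metric.ball (a n) ε := by
    intro c
    simp only [hZ, Set.Finite.mem_toFinset, Set.mem_ofPred_eq, Set.mem_sdiff, Set.mem_iUnion,
      Set.mem_Ici, not_exists, mem_closedBall_zero_iff, exists_prop, not_and]
    refine ⟨fun h => ⟨h.2, h.1.2⟩, fun h => ⟨⟨?_, h.2⟩, h.1⟩⟩
    by_contra! hR
    refine hne c hR.le (fun n hn => ?_) h.1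
    simpa [dist_eq_norm] using h.2 n hn
  refine ⟨n₁, u, Z.sigma fun c => Finset.range (analyticOrderNatAt (theta b P S₀ w) c), hn₁, ha1,
    hsum, fun c => ?_⟩
  rw [card_filter_sigma_fst]
  by_cases hc : ∃ n, n₁ ≤ n ∧ c ∈ Metric.ball (a n) ε
  · obtain ⟨n, hn, hcn⟩ := hc
    rw [if_neg fun h => ((hmem c).1 h).2 n hn hcn, hord n hn c hcn, Nat.cast_zero, zero_add]
    have huniq : ∀ k, n₁ ≤ k → u k = c → k = n := fun k hk hkc => by
      by_contra hkn
      exact Set.disjoint_left.1 (hdisj k n hk hn hkn) (hkc ▸ hu k hk) hcn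
    split_ifs with h
    · rw [eq_comm, Set.encard_eq_one]
      refine ⟨n, Set.eq_singleton_iff_unique_mem.2 ⟨⟨hn, h.symm⟩, fun k hk => ?_⟩⟩
      exact huniq k hk.1 hk.2
    · rw [eq_comm, Set.encard_eq_zero, Set.eq_empty_iff_forall_notMem]
      exact fun k hk => h (huniq k hk.1 hk.2 ▸ hk.2.symm)
  · push Not at hc
    have hempty : {n : ℤ | n ∈ Set.Ici n₁ ∧ u n = c}.encard = 0 := by
      rw [Set.encard_eq_zero, Set.eq_empty_iff_forall_notMem]
      exact fun k hk => hc k hk.1 (hk.2 ▸ hu k hk.1)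
    rw [hempty, add_zero]
    split_ifs with h
    · exact (Nat.cast_analyticOrderNatAt (htop c)).symm
    · rw [Nat.cast_zero, (hθ.analyticAt c).analyticOrderAt_eq_zero]
      exact fun h0 => h ((hmem c).2 ⟨h0, hc⟩)

open scoped Classical in
/-- Comparison of the numbers of exceptional zeros of `θ` and `S`. -/
theorem IsSineType.card_eq_of_analyticOrderAt_eq (hS₀ : IsSineType b S₀) (hb : 0 < b)
    (hP : P.degree = (N : WithBot ℕ)) (hz : EnumeratesZeros S₀ (Set.Ici 1) a)
    (hsep : AsymptoticallySeparated a)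
    (hw : MemLp w 2 (volume.restrict (Set.Ioo (-b) b))) {k : ℤ} {u : ℤ → ℂ}
    (hu : Summable fun n : Set.Ici k => ‖u n - a n‖ ^ 2)
    {ι κ : Type*} {E : Finset ι} {F : Finset κ} {r : ι → ℂ} {q : κ → ℂ}
    (hE : ∀ c, analyticOrderAt (theta b P S₀ w) c = ((E.filter (r · = c)).card : ℕ∞) +
      {n : ℤ | n ∈ Set.Ici k ∧ u n = c}.encard)
    (hF : ∀ c, analyticOrderAt (principalPart P S₀) c = ((F.filter (q · = c)).card : ℕ∞) +
      {n : ℤ | n ∈ Set.Ici k ∧ a n = c}.encard) : E.card = F.card := by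
  obtain ⟨H, him⟩ := hS₀.exists_abs_im_le hz
  have ha : Summable fun n : Set.Ici k => ‖a n - a n‖ ^ 2 := by simp
  have hw0 : MemLp (0 : ℝ → ℂ) 2 (volume.restrict (Set.Ioo (-b) b)) := MemLp.zero
  obtain ⟨A, B, hA, hAB⟩ := exists_eq_prod_mul_exp_mul_product hsep him hu
    (hS₀.differentiable_theta hw) E r hE fun ε hε => by
      obtain ⟨C, R, -, h⟩ := hS₀.exists_norm_logDeriv_theta_le hb hP hz hsep hw hε
      exact ⟨C, R, h⟩
  obtain ⟨A₀, B₀, hA₀, hAB₀⟩ := exists_eq_prod_mul_exp_mul_product hsep him ha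
    (hS₀.differentiable_principalPart) F q hF fun ε hε => by
      obtain ⟨C, R, -, h⟩ := hS₀.exists_norm_logDeriv_theta_le hb hP hz hsep hw0 hε
      rw [theta_zero] at h
      exact ⟨C, R, h⟩
  obtain ⟨C, R, -, hne⟩ := hS₀.exists_norm_logDeriv_theta_le hb hP hz hsep hw one_pos
  obtain ⟨C₀, R₀, -, hne₀⟩ := hS₀.exists_norm_logDeriv_theta_le hb hP hz hsep hw0 one_pos
  rw [theta_zero] at hne₀
  -- Dividing `θ / S → 1` by the quotient of the infinite products, which also tends to `1`, leaves
  -- a constant, an exponential and two polynomials, whose degrees must agree.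
  have h1 := (hS₀.tendsto_theta_div_principalPart hb hP hz hsep hw).div
    (tendsto_genusOneProduct_div hsep him hu) one_ne_zero
  rw [div_one] at h1
  have h2 := eq_zero_of_tendsto_exp_mul_eval_div_eval (c := A / A₀) (d := B - B₀)
    (p := ∏ x ∈ E, (Polynomial.X - Polynomial.C (r x)))
    (q := ∏ x ∈ F, (Polynomial.X - Polynomial.C (q x)))
    (Polynomial.monic_prod_X_sub_C _ _).ne_zero (Polynomial.monic_prod_X_sub_C _ _).ne_zero
    (h1.congr' ?_)
  · simpa using h2.2
  filter_upwards [eventually_off_discs him 1 (max R R₀)] with y hy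
  have h3 := (hne _ ((le_max_left _ _).trans hy.1) hy.2).1
  have h4 := (hne₀ _ ((le_max_right _ _).trans hy.1) hy.2).1
  simp only [Pi.div_apply, Polynomial.eval_prod, Polynomial.eval_sub, Polynomial.eval_X,
    Polynomial.eval_C]
  rw [hAB] at h3 ⊢
  rw [hAB₀] at h4 ⊢
  have h5 := right_ne_zero_of_mul (right_ne_zero_of_mul h3)
  have h6 := right_ne_zero_of_mul (right_ne_zero_of_mul h4)
  have h7 := left_ne_zero_of_mul h4
  rw [sub_mul, Complex.exp_sub]
  field_simp

/-- The zeros `u n` keep their indices `n ≥ n₁`. The others exactly fill the indices from `1 - N` to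
`n₁ - 1`, since `S` has that many zeros left over; finitely many terms do not affect square
summability. -/
theorem IsSineType.exists_enumeratesZeros_theta (hS₀ : IsSineType b S₀) (hb : 0 < b)
    (hP : P.degree = (N : WithBot ℕ))
    (hzP : EnumeratesZeros (fun z => P.eval z) (Set.Icc (1 - (N : ℤ)) 0) a)
    (hz : EnumeratesZeros S₀ (Set.Ici 1) a) (hsep : AsymptoticallySeparated a)
    (hw : MemLp w 2 (volume.restrict (Set.Ioo (-b) b))) :
    ∃ z : ℤ → ℂ, EnumeratesZeros (theta b P S₀ w) (Set.Ici (1 - (N : ℤ))) z ∧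
      HasZeroAsymptotics N a z := by
  classical
  obtain ⟨n₁, u, E, hn₁, ha1, hsum, hE⟩ := hS₀.exists_zeros hb hP hz hsep hw
  have hk : 1 - (N : ℤ) ≤ n₁ := by omega
  have hu : Summable fun n : Set.Ici n₁ => ‖u n - a n‖ ^ 2 := by
    refine hsum.of_nonneg_of_le (fun n => by positivity) fun n => ?_
    refine pow_le_pow_left₀ (norm_nonneg _) ?_ 2
    exact le_mul_of_one_le_right (norm_nonneg _) (one_le_pow₀ (ha1 n n.2))
  have hcard : E.card = (Finset.Ico (1 - (N : ℤ)) n₁).card := by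
    refine hS₀.card_eq_of_analyticOrderAt_eq hb hP hz hsep hw hu hE (q := a) fun c => ?_
    rw [← hS₀.enumeratesZeros_principalPart hzP hz c, ← encard_Ici_eq_add hk a a c]
    simp only [ite_self]
  obtain ⟨f, hf⟩ := Finset.exists_card_filter_eq hcard Sigma.fst
  refine ⟨fun n => if n < n₁ then f n else u n, fun c => ?_,
    fun n => ((if (n : ℤ) < n₁ then f n else u n) - a n) * muSeq a n ^ N, ?_, fun n => ?_⟩
  · rw [encard_Ici_eq_add hk, hE, hf]
  · refine memℓp_gen ?_
    simp only [ENNReal.toReal_ofNat, Real.rpow_ofNat]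
    refine summable_Ici_of_summable_Ici (k := n₁)
      (f := fun n => ‖((if n < n₁ then f n else u n) - a n) * muSeq a n ^ N‖ ^ 2) ?_
    refine hsum.congr fun n => ?_
    have h1 : a n ≠ 0 := norm_pos_iff.1 (by linarith [ha1 n n.2])
    rw [if_neg (not_lt.2 n.2), muSeq_of_ne_zero h1, norm_mul, norm_pow]
  · rw [mul_div_cancel_right₀ _ (pow_ne_zero _ (muSeq_ne_zero a n))]
    ring

end Existence

/-! ### The product formula and its constants. -/

section ProductFormula

variable {N : ℕ} {b : ℝ} {P : Polynomial ℂ} {S₀ : ℂ → ℂ} {w : ℝ → ℂ} {a z : ℤ → ℂ}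

theorem IsSineType.exists_theta_eq (hS₀ : IsSineType b S₀) (hb : 0 < b)
    (hP : P.degree = (N : WithBot ℕ)) (hz : EnumeratesZeros S₀ (Set.Ici 1) a)
    (hsep : AsymptoticallySeparated a) (hw : MemLp w 2 (volume.restrict (Set.Ioo (-b) b)))
    {k : ℤ} (hzθ : EnumeratesZeros (theta b P S₀ w) (Set.Ici k) z)
    (hs : Summable fun n : Set.Ici k => ‖z n - a n‖ ^ 2) :
    ∃ A B : ℂ, A ≠ 0 ∧ ∀ ζ, theta b P S₀ w ζ = A * Complex.exp (B * ζ) *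
      genusOneProduct (fun n : Set.Ici k => muSeq a n) (fun n => z n) ζ := by
  obtain ⟨H, him⟩ := hS₀.exists_abs_im_le hz
  refine exists_eq_exp_mul_product_of_summable_sq hsep him hs (hS₀.differentiable_theta hw) hzθ ?_
  intro ε hε
  obtain ⟨C, R, -, h⟩ := hS₀.exists_norm_logDeriv_theta_le hb hP hz hsep hw hε
  exact ⟨C, R, fun ζ h1 h2 => (h ζ h1 h2).2⟩

/-- The exponential factor in the factorization does not depend on `w`. -/
theorem IsSineType.theta_eq_exp_mul_product (hS₀ : IsSineType b S₀) (hb : 0 < b)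
    (hP : P.degree = (N : WithBot ℕ)) (hz : EnumeratesZeros S₀ (Set.Ici 1) a)
    (hsep : AsymptoticallySeparated a) (hw : MemLp w 2 (volume.restrict (Set.Ioo (-b) b)))
    {k : ℤ} (hzθ : EnumeratesZeros (theta b P S₀ w) (Set.Ici k) z)
    (hs : Summable fun n : Set.Ici k => ‖z n - a n‖ ^ 2) {A₀ B₀ : ℂ} (hA₀ : A₀ ≠ 0)
    (hAB₀ : ∀ ζ, principalPart P S₀ ζ = A₀ * Complex.exp (B₀ * ζ) *
      genusOneProduct (fun n : Set.Ici k => muSeq a n) (fun n => a n) ζ) (ζ : ℂ) :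
    theta b P S₀ w ζ = A₀ * Complex.exp (B₀ * ζ) *
      genusOneProduct (fun n : Set.Ici k => muSeq a n) (fun n => z n) ζ := by
  obtain ⟨H, him⟩ := hS₀.exists_abs_im_le hz
  have hw0 : MemLp (0 : ℝ → ℂ) 2 (volume.restrict (Set.Ioo (-b) b)) := MemLp.zero
  obtain ⟨A, B, hA, hAB⟩ := hS₀.exists_theta_eq hb hP hz hsep hw hzθ hs
  obtain ⟨C, R, -, hne⟩ := hS₀.exists_norm_logDeriv_theta_le hb hP hz hsep hw one_pos
  obtain ⟨C₀, R₀, -, hne₀⟩ := hS₀.exists_norm_logDeriv_theta_le hb hP hz hsep hw0 one_pos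
  rw [theta_zero] at hne₀
  have h1 := (hS₀.tendsto_theta_div_principalPart hb hP hz hsep hw).div
    (tendsto_genusOneProduct_div hsep him hs) one_ne_zero
  rw [div_one] at h1
  -- Once the products are divided out, only the exponential factors remain, and their quotient
  -- tends to `1`; hence `B = B₀` and `A = A₀`.
  have h2 : Tendsto (fun y : ℝ => A / A₀ * Complex.exp ((B - B₀) * (y * Complex.I))) atTop
      (𝓝 1) := by
    refine h1.congr' ?_
    filter_upwards [eventually_off_discs him 1 (max R R₀)] with y hy
    have h3 := (hne _ ((le_max_left _ _).trans hy.1) hy.2).1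
    have h4 := (hne₀ _ ((le_max_right _ _).trans hy.1) hy.2).1
    simp only [Pi.div_apply]
    rw [hAB] at h3 ⊢
    rw [hAB₀] at h4 ⊢
    have h5 := right_ne_zero_of_mul h3
    have h6 := right_ne_zero_of_mul h4
    rw [sub_mul, Complex.exp_sub]
    field_simp
  have h3 := (eq_zero_of_tendsto_exp_mul_eval_div_eval (c := A / A₀) (d := B - B₀)
    (one_ne_zero (α := Polynomial ℂ)) (one_ne_zero (α := Polynomial ℂ)) (by simpa using h2)).1
  simp only [h3, zero_mul, Complex.exp_zero, mul_one] at h2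
  have h4 := tendsto_nhds_unique h2 tendsto_const_nhds
  rw [hAB, sub_eq_zero.1 h3, (div_eq_one_iff_eq hA₀).1 h4.symm]

/-- The behaviour at the origin of a product of genus one. -/
theorem exists_genusOneProduct_eq_pow_mul {H : ℝ} (hsep : AsymptoticallySeparated a)
    (him : ∀ n, 1 ≤ n → |(a n).im| ≤ H) (k : ℤ) :
    ∃ (s : ℕ) (G : ℂ → ℂ), Differentiable ℂ G ∧ G 0 = 1 ∧ deriv G 0 = 0 ∧
      ({n : ℤ | n ∈ Set.Ici k ∧ a n = 0}.encard = s) ∧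
      ∀ ζ, genusOneProduct (fun n : Set.Ici k => muSeq a n) (fun n => a n) ζ =
        ζ ^ s * Complex.exp (-(s * ζ)) * G ζ := by
  have ha : Summable fun n : Set.Ici k => ‖a n - a n‖ ^ 2 := by simp
  have hconv := genusOneConvergent_of_summable_sq hsep him ha
  set E := (hconv.finite_eq 0).toFinset with hE
  have hmem : ∀ n, n ∈ E ↔ a n = 0 := fun n => (hconv.finite_eq 0).mem_toFinset
  have h' := hconv.comp_injective (i := ((↑) : ((E : Set (Set.Ici k))ᶜ : Set (Set.Ici k)) → _))
    Subtype.val_injective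
  have hμ : ∀ n : ((E : Set (Set.Ici k))ᶜ : Set (Set.Ici k)), a n.1 ≠ 0 :=
    fun n h => n.2 ((hmem _).2 h)
  obtain ⟨B, hB0, hB⟩ := exists_inv_norm_muSeq_le hsep him k
  refine ⟨E.card, _, h'.differentiable, ?_, ?_, ?_, fun ζ => ?_⟩
  · have : ∀ n, genusOneFactor ((fun n : Set.Ici k => muSeq a n) ∘
        ((↑) : ((E : Set (Set.Ici k))ᶜ : Set (Set.Ici k)) → _)) ((fun n : Set.Ici k => a n) ∘ (↑))
        n 0 = 1 := fun n => by
      simp [genusOneFactor, muSeq_of_ne_zero (hμ n), hμ n]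
    simp only [genusOneProduct, this, tprod_one]
  -- The remaining factors are `(1 - ζ / a n) exp (ζ / a n)`, whose logarithmic derivatives vanish
  -- at the origin; `(B + 1)⁻¹` is a lower bound for `|a n|`.
  · have h1 := h'.logDeriv_product (D := 1) (ε := (B + 1)⁻¹) (ζ := 0)
      (fun n => norm_sub_muSeq_le a n) (by positivity) fun n => by
        have h2 := hB n.1 n.1.2
        rw [muSeq_of_ne_zero (hμ n)] at h2
        rw [Function.comp_apply, sub_zero]
        refine inv_le_of_inv_le₀ (norm_pos_iff.2 (hμ n)) (by linarith)
    rw [logDeriv_apply, div_eq_iff (h'.product_ne_zero hμ)] at h1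
    rw [h1]
    refine mul_eq_zero_of_left ((tsum_congr fun n => ?_).trans tsum_zero) _
    rw [GenusOneConvergent.logDeriv_factor (h'.ne_zero n) (hμ n)]
    simp [muSeq_of_ne_zero (hμ n)]
  · rw [← encard_subtype_eq, ← Set.encard_coe_eq_coe_finsetCard, hE, Set.Finite.coe_toFinset]
  · rw [hconv.product_eq_mul E]
    congr 1
    -- Because `μ n = -1` when `a n = 0`, each such factor is `ζ exp (-ζ)`. These exponentials are
    -- the source of the summand `s` in `β = s + γ`.
    rw [Finset.prod_congr rfl (g := fun _ => ζ * Complex.exp (-ζ)) fun n hn => ?_]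
    · rw [Finset.prod_const, mul_pow, ← Complex.exp_nat_mul, mul_neg]
    · have h0 := (hmem n).1 hn
      simp [genusOneFactor, muSeq, h0, div_neg]

/-- If `S = A exp (B ζ)` times the product, then `S / ζ ^ s = A exp ((B - s) ζ) G` with `G 0 = 1`
and `G' 0 = 0`. Hence `α = A` and `γ = B - s`. -/
theorem IsSineType.exists_principalPart_eq (hS₀ : IsSineType b S₀) (hb : 0 < b)
    (hP : P.degree = (N : WithBot ℕ)) (hz : EnumeratesZeros S₀ (Set.Ici 1) a)
    (hsep : AsymptoticallySeparated a) {k : ℤ}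
    (hzS : EnumeratesZeros (principalPart P S₀) (Set.Ici k) a) :
    ∃ (s : ℕ) (α γ : ℂ), α ≠ 0 ∧ analyticOrderAt (principalPart P S₀) 0 = (s : ℕ∞) ∧
      Tendsto (fun z : ℂ => principalPart P S₀ z / z ^ s) (𝓝[≠] 0) (𝓝 α) ∧
      Tendsto (logDeriv (fun z : ℂ => principalPart P S₀ z / z ^ s)) (𝓝[≠] 0) (𝓝 γ) ∧
      ∀ ζ, principalPart P S₀ ζ = α * Complex.exp ((s + γ) * ζ) *
        genusOneProduct (fun n : Set.Ici k => muSeq a n) (fun n => a n) ζ := by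
  obtain ⟨H, him⟩ := hS₀.exists_abs_im_le hz
  obtain ⟨A, B, hA, hAB⟩ := hS₀.exists_theta_eq (w := 0) (z := a) (k := k) hb hP hz hsep
    MemLp.zero (by rwa [theta_zero]) (by simp)
  rw [theta_zero] at hAB
  obtain ⟨s, G, hG, hG0, hG', hs, hprod⟩ := exists_genusOneProduct_eq_pow_mul hsep him k
  set F : ℂ → ℂ := fun ζ => A * Complex.exp ((B - s) * ζ) * G ζ with hFdef
  have hF : Differentiable ℂ F := by fun_prop
  have hF0 : F 0 = A := by simp [hFdef, hG0]
  have hF' : deriv F 0 = A * (B - s) := by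
    have h1 : HasDerivAt F (A * (Complex.exp ((B - s) * 0) * ((B - s) * 1)) * G 0 +
        A * Complex.exp ((B - s) * 0) * deriv G 0) 0 :=
      ((((hasDerivAt_id (0 : ℂ)).const_mul (B - s)).cexp).const_mul A).mul (hG 0).hasDerivAt
    rw [h1.deriv, hG0, hG']
    simp
  have hSF : ∀ ζ, ζ ≠ 0 → principalPart P S₀ ζ / ζ ^ s = F ζ := by
    intro ζ hζ
    have hζs : ζ ^ s ≠ 0 := pow_ne_zero s hζ
    rw [div_eq_iff hζs, hAB, hprod, hFdef]
    simp only
    rw [sub_mul, sub_eq_add_neg, Complex.exp_add]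
    ring
  refine ⟨s, A, B - s, hA, by rw [← hzS, hs], ?_, ?_, by simpa using hAB⟩
  · have h1 := hF.continuous.tendsto 0
    rw [hF0] at h1
    refine (h1.mono_left nhdsWithin_le_nhds).congr' ?_
    filter_upwards [self_mem_nhdsWithin] with ζ hζ using (hSF ζ hζ).symm
  · have h1 : ContinuousAt (logDeriv F) 0 := by
      refine ContinuousAt.div ?_ hF.continuous.continuousAt (hF0 ▸ hA)
      exact (hF.analyticAt 0).deriv.continuousAt
    have h2 : logDeriv F 0 = B - s := by
      rw [logDeriv_apply, hF', hF0, mul_div_cancel_left₀ _ hA]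
    have h3 := h1.tendsto
    rw [h2] at h3
    refine (h3.mono_left nhdsWithin_le_nhds).congr' ?_
    filter_upwards [self_mem_nhdsWithin] with ζ hζ
    have h4 : (fun z : ℂ => principalPart P S₀ z / z ^ s) =ᶠ[𝓝 ζ] F := by
      filter_upwards [isOpen_ne.mem_nhds hζ] with v hv using hSF v hv
    rw [logDeriv_apply, logDeriv_apply, h4.deriv_eq, h4.eq_of_nhds]

end ProductFormula

/-! ### Uniqueness from all but `N` zeros. -/

section Uniqueness

variable {N : ℕ} {b : ℝ} {P : Polynomial ℂ} {S₀ : ℂ → ℂ} {w w' : ℝ → ℂ} {a z z' : ℤ → ℂ}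

theorem Polynomial.natDegree_prod_Ico_X_sub_C (z : ℤ → ℂ) (N : ℕ) :
    (∏ n ∈ Finset.Ico (1 - (N : ℤ)) 1, (Polynomial.X - Polynomial.C (z n))).natDegree = N := by
  simp

open scoped Classical in
theorem EnumeratesZeros.analyticOrderAt_eq_add {f : ℂ → ℂ} {k l : ℤ} (hkl : k ≤ l)
    (h : EnumeratesZeros f (Set.Ici k) z) (c : ℂ) :
    analyticOrderAt f c = (((Finset.Ico k l).filter (z · = c)).card : ℕ∞) +
      {n : ℤ | n ∈ Set.Ici l ∧ z n = c}.encard := by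
  rw [← h c, ← encard_Ici_eq_add hkl z z c]
  simp only [ite_self]

/-- Two functions `θ` with the same zeros up to `N` of them differ by a rational factor. -/
theorem IsSineType.exists_theta_mul_eq (hS₀ : IsSineType b S₀) (hb : 0 < b)
    (hP : P.degree = (N : WithBot ℕ)) (hz : EnumeratesZeros S₀ (Set.Ici 1) a)
    (hsep : AsymptoticallySeparated a) (hw : MemLp w 2 (volume.restrict (Set.Ioo (-b) b)))
    (hw' : MemLp w' 2 (volume.restrict (Set.Ioo (-b) b)))
    (hzθ : EnumeratesZeros (theta b P S₀ w) (Set.Ici (1 - (N : ℤ))) z)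
    (hzθ' : EnumeratesZeros (theta b P S₀ w') (Set.Ici (1 - (N : ℤ))) z')
    (hzz : ∀ n, 1 ≤ n → z n = z' n) :
    ∃ κ : ℂ, ∀ ζ, theta b P S₀ w ζ *
        (∏ n ∈ Finset.Ico (1 - (N : ℤ)) 1, (Polynomial.X - Polynomial.C (z' n))).eval ζ =
      theta b P S₀ w' ζ *
        (∏ n ∈ Finset.Ico (1 - (N : ℤ)) 1, (Polynomial.X - Polynomial.C (z n))).eval ζ * κ := by
  classical
  have hN : 1 - (N : ℤ) ≤ 1 := by omega
  have hθ := hS₀.differentiable_theta (P := P) hw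
  have hθ' := hS₀.differentiable_theta (P := P) hw'
  have hto := hS₀.analyticOrderAt_theta_ne_top hb hP hz hsep hw'
  set q := ∏ n ∈ Finset.Ico (1 - (N : ℤ)) 1, (Polynomial.X - Polynomial.C (z n)) with hq
  set q' := ∏ n ∈ Finset.Ico (1 - (N : ℤ)) 1, (Polynomial.X - Polynomial.C (z' n)) with hq'
  have hq0 : q ≠ 0 := (Polynomial.monic_prod_X_sub_C _ _).ne_zero
  have hq0' : q' ≠ 0 := (Polynomial.monic_prod_X_sub_C _ _).ne_zero
  have hqo : ∀ c, analyticOrderAt (fun ζ => q.eval ζ) c =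
      (((Finset.Ico (1 - (N : ℤ)) 1).filter (z · = c)).card : ℕ∞) := fun c => by
    rw [← analyticOrderAt_prod_sub]
    simp [hq, Polynomial.eval_prod]
  have hqo' : ∀ c, analyticOrderAt (fun ζ => q'.eval ζ) c =
      (((Finset.Ico (1 - (N : ℤ)) 1).filter (z' · = c)).card : ℕ∞) := fun c => by
    rw [← analyticOrderAt_prod_sub]
    simp [hq', Polynomial.eval_prod]
  have hA : ∀ c, analyticOrderAt (fun ζ => theta b P S₀ w ζ * q'.eval ζ) c =
      analyticOrderAt (theta b P S₀ w) c + analyticOrderAt (fun ζ => q'.eval ζ) c := fun c =>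
    analyticOrderAt_mul (hθ.analyticAt c) (q'.differentiable.analyticAt c)
  have hB : ∀ c, analyticOrderAt (fun ζ => theta b P S₀ w' ζ * q.eval ζ) c =
      analyticOrderAt (theta b P S₀ w') c + analyticOrderAt (fun ζ => q.eval ζ) c := fun c =>
    analyticOrderAt_mul (hθ'.analyticAt c) (q.differentiable.analyticAt c)
  -- Both `θ q'` and `θ' q` vanish on the same multiset: the first `N` zeros of each function and
  -- the common tail.
  have hset : ∀ c, {n : ℤ | n ∈ Set.Ici 1 ∧ z n = c} = {n : ℤ | n ∈ Set.Ici 1 ∧ z' n = c} := by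
    intro c
    ext n
    exact and_congr_right fun hn => by rw [hzz n hn]
  obtain ⟨f, hf, hAf⟩ := exists_differentiable_mul_eq (hθ.mul q'.differentiable)
    (hθ'.mul q.differentiable)
    (fun c => by
      change analyticOrderAt (fun ζ => theta b P S₀ w' ζ * q.eval ζ) c ≠ ⊤
      rw [hB, hqo]
      exact WithTop.add_ne_top.2 ⟨hto c, ENat.natCast_ne_top _⟩)
    (fun c => by
      change analyticOrderAt (fun ζ => theta b P S₀ w' ζ * q.eval ζ) c ≤
        analyticOrderAt (fun ζ => theta b P S₀ w ζ * q'.eval ζ) c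
      rw [hA, hB, hzθ.analyticOrderAt_eq_add hN, hzθ'.analyticOrderAt_eq_add hN, hqo, hqo', hset]
      exact le_of_eq (by ring))
  obtain ⟨δ, hδ, n₀, -, -, hsph⟩ := hsep.exists_sphere_off_discs
  obtain ⟨R₀, hR₀⟩ := hsph (δ / 2) (by positivity) (by linarith)
  obtain ⟨C, R₁, hC, hR₁, hup⟩ := hS₀.exists_norm_theta_le hb hP hw
  obtain ⟨c, R₂, hc, -, hlow⟩ := hS₀.exists_le_norm_theta hb hP hz hsep hw' (half_pos hδ)
  obtain ⟨cq, _, R₃, hcq, -, -, hqb⟩ := q.exists_norm_eval_bounds hq0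
  obtain ⟨_, Cq, R₄, -, hCq, -, hqb'⟩ := q'.exists_norm_eval_bounds hq0'
  rw [Polynomial.natDegree_prod_Ico_X_sub_C] at hqb hqb'
  -- Off the discs `θ` is at most a constant times `θ'`, and `q`, `q'` have the same degree, so the
  -- quotient `f` is bounded; the exponent `0` gives Liouville's hypothesis.
  obtain ⟨M, hM⟩ := exists_norm_le_of_off_discs (half_pos hδ) hR₀ hf (k := 0)
    (R := max (max R₁ R₂) (max R₃ R₄)) (C := C * Cq / (c * cq)) fun ζ hζ hoff => by
      simp only [max_le_iff] at hζ
      have h0 : 0 < ‖ζ‖ := by linarith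
      have h1 := hup ζ hζ.1.1
      have h2 := hlow ζ hζ.1.2 hoff
      have h3 := (hqb ζ hζ.2.1).1
      have h4 := (hqb' ζ hζ.2.2).2
      have h5 := congrArg norm (hAf ζ)
      simp only [Pi.mul_apply, norm_mul] at h5
      set e := Real.exp (b * |ζ.im|)
      have he : 0 < e := Real.exp_pos _
      have h6 : (c * ‖ζ‖ ^ N * e) * (cq * ‖ζ‖ ^ N) * ‖f ζ‖ ≤
          (C * ‖ζ‖ ^ N * e) * (Cq * ‖ζ‖ ^ N) := by
        calc _ ≤ ‖theta b P S₀ w' ζ‖ * ‖q.eval ζ‖ * ‖f ζ‖ := by gcongr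
          _ = ‖theta b P S₀ w ζ‖ * ‖q'.eval ζ‖ := h5.symm
          _ ≤ _ := by gcongr
      rw [pow_zero, mul_one, le_div_iff₀ (by positivity)]
      have h7 : 0 < ‖ζ‖ ^ N * e * ‖ζ‖ ^ N := by positivity
      refine le_of_mul_le_mul_left ?_ h7
      linarith
  obtain ⟨κ, hκ⟩ := hf.exists_const_forall_eq_of_bounded
    (isBounded_iff_forall_norm_le.2 ⟨M, by rintro _ ⟨ζ, rfl⟩; simpa using hM ζ⟩)
  exact ⟨κ, fun ζ => by rw [← hκ ζ]; exact hAf ζ⟩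

/-- The identity `θ q' = κ θ' q` says that `S (q' - κ q)` equals a combination of integral terms
times polynomials of degree `N`, which is `o(|ζ| ^ N exp (b |Im ζ|))`. High on the imaginary axis
this is impossible for a nonzero polynomial `q' - κ q`; since both are monic, `κ = 1`. -/
theorem IsSineType.theta_eq_of_zeros_eq (hS₀ : IsSineType b S₀) (hb : 0 < b)
    (hP : P.degree = (N : WithBot ℕ)) (hz : EnumeratesZeros S₀ (Set.Ici 1) a)
    (hsep : AsymptoticallySeparated a) (hw : MemLp w 2 (volume.restrict (Set.Ioo (-b) b)))
    (hw' : MemLp w' 2 (volume.restrict (Set.Ioo (-b) b)))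
    (hzθ : EnumeratesZeros (theta b P S₀ w) (Set.Ici (1 - (N : ℤ))) z)
    (hzθ' : EnumeratesZeros (theta b P S₀ w') (Set.Ici (1 - (N : ℤ))) z')
    (hzz : ∀ n, 1 ≤ n → z n = z' n) : theta b P S₀ w = theta b P S₀ w' := by
  obtain ⟨H, him⟩ := hS₀.exists_abs_im_le hz
  obtain ⟨κ, hκ⟩ := hS₀.exists_theta_mul_eq hb hP hz hsep hw hw' hzθ hzθ' hzz
  set q := ∏ n ∈ Finset.Ico (1 - (N : ℤ)) 1, (Polynomial.X - Polynomial.C (z n)) with hq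
  set q' := ∏ n ∈ Finset.Ico (1 - (N : ℤ)) 1, (Polynomial.X - Polynomial.C (z' n)) with hq'
  have hqm : q.Monic := Polynomial.monic_prod_X_sub_C _ _
  have hqm' : q'.Monic := Polynomial.monic_prod_X_sub_C _ _
  have hqq : q' = Polynomial.C κ * q := by
    by_contra hne
    have hp0 : q' - Polynomial.C κ * q ≠ 0 := sub_ne_zero.2 hne
    obtain ⟨c₁, _, R₁, hc₁, -, hR₁, hp⟩ := Polynomial.exists_norm_eval_bounds hp0
    obtain ⟨_, Cq, R₃, -, hCq, -, hqb⟩ := q.exists_norm_eval_bounds hqm.ne_zero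
    obtain ⟨_, Cq', R₄, -, hCq', -, hqb'⟩ := q'.exists_norm_eval_bounds hqm'.ne_zero
    rw [Polynomial.natDegree_prod_Ico_X_sub_C] at hqb hqb'
    obtain ⟨c, R₂, hc, -, hlow⟩ := hS₀.exists_le_norm_theta (w := 0) hb hP hz hsep MemLp.zero
      one_pos
    rw [theta_zero] at hlow
    -- Makes the upper bound exactly half of the lower bound.
    set ε := c * c₁ / (2 * (‖κ‖ * Cq + Cq')) with hε
    have hden : 0 < ‖κ‖ * Cq + Cq' := by positivity
    obtain ⟨R₅, hF⟩ := exists_norm_expIntegral_le hw hb (show 0 < ε by positivity)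
    obtain ⟨R₆, hF'⟩ := exists_norm_expIntegral_le hw' hb (show 0 < ε by positivity)
    obtain ⟨y, hy, hoff⟩ := (eventually_off_discs him 1
      (max (max (max R₁ R₂) (max R₃ R₄)) (max R₅ R₆))).exists
    set ζ : ℂ := y * Complex.I
    simp only [max_le_iff] at hy
    have h1 : 1 ≤ ‖ζ‖ := hR₁.trans hy.1.1.1
    have h2 := (hp ζ hy.1.1.1).1
    have h3 := hlow ζ hy.1.1.2 hoff
    have h4 := (hqb ζ hy.1.2.1).2
    have h5 := (hqb' ζ hy.1.2.2).2
    have h6 := hF ζ hy.2.1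
    have h7 := hF' ζ hy.2.2
    have h8 : c₁ ≤ ‖(q' - Polynomial.C κ * q).eval ζ‖ :=
      (le_mul_of_one_le_right hc₁.le (one_le_pow₀ h1)).trans h2
    have h9 : principalPart P S₀ ζ * (q' - Polynomial.C κ * q).eval ζ =
        expIntegral b w' ζ * q.eval ζ * κ - expIntegral b w ζ * q'.eval ζ := by
      have := hκ ζ
      rw [theta_eq, theta_eq] at this
      simp only [Polynomial.eval_sub, Polynomial.eval_mul, Polynomial.eval_C]
      linear_combination this
    set e := Real.exp (b * |ζ.im|)
    have he : 0 < e := Real.exp_pos _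
    have h10 : (c * ‖ζ‖ ^ N * e) * c₁ ≤
        (ε * e) * (Cq * ‖ζ‖ ^ N) * ‖κ‖ + (ε * e) * (Cq' * ‖ζ‖ ^ N) := by
      calc _ ≤ ‖principalPart P S₀ ζ‖ * ‖(q' - Polynomial.C κ * q).eval ζ‖ := by gcongr
        _ = ‖expIntegral b w' ζ * q.eval ζ * κ - expIntegral b w ζ * q'.eval ζ‖ := by
          rw [← norm_mul, h9]
        _ ≤ ‖expIntegral b w' ζ‖ * ‖q.eval ζ‖ * ‖κ‖ + ‖expIntegral b w ζ‖ * ‖q'.eval ζ‖ := by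
          refine (norm_sub_le _ _).trans ?_
          rw [norm_mul, norm_mul, norm_mul]
        _ ≤ _ := by gcongr
    have h11 : (ε * e) * (Cq * ‖ζ‖ ^ N) * ‖κ‖ + (ε * e) * (Cq' * ‖ζ‖ ^ N) =
        (c * ‖ζ‖ ^ N * e) * c₁ / 2 := by
      rw [hε]
      field_simp
    have h12 : 0 < (c * ‖ζ‖ ^ N * e) * c₁ := by positivity
    linarith
  have hκ1 : κ = 1 := by
    have h1 := congrArg Polynomial.leadingCoeff hqq
    rw [Polynomial.leadingCoeff_mul, hqm.leadingCoeff, hqm'.leadingCoeff,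
      Polynomial.leadingCoeff_C, mul_one] at h1
    exact h1.symm
  rw [hκ1, Polynomial.C_1, one_mul] at hqq
  -- The factor `q` can be cancelled only off its roots; continuity does the rest.
  have hdense : Dense {ζ : ℂ | q.IsRoot ζ}ᶜ :=
    (Polynomial.finite_setOfPred_isRoot hqm.ne_zero).countable.dense_compl ℂ
  refine (hS₀.differentiable_theta hw).continuous.ext_on hdense
    (hS₀.differentiable_theta hw').continuous fun ζ hζ => ?_
  have h1 := hκ ζ
  rw [hqq, hκ1, mul_one] at h1
  exact mul_right_cancel₀ hζ h1

end Uniqueness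

/-! ### The main theorem. -/

theorem mainTheorem3 (N : ℕ) (b : ℝ) (hb : 0 < b)
    (P : Polynomial ℂ) (hP : P.degree = (N : WithBot ℕ))
    (S₀ : ℂ → ℂ) (hS₀ : IsSineType b S₀)
    (z₀ : ℤ → ℂ)
    (hzP : EnumeratesZeros (fun z => P.eval z) (Set.Icc (1 - (N : ℤ)) 0) z₀)
    (hzS₀ : EnumeratesZeros S₀ (Set.Ici 1) z₀)
    (hsep : AsymptoticallySeparated z₀) :
    (∀ w w' : ℝ → ℂ,
      MemLp w 2 (volume.restrict (Set.Ioo (-b) b)) →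
      MemLp w' 2 (volume.restrict (Set.Ioo (-b) b)) →
      ∀ z z' : ℤ → ℂ,
        EnumeratesZeros (theta b P S₀ w) (Set.Ici (1 - (N : ℤ))) z →
        EnumeratesZeros (theta b P S₀ w') (Set.Ici (1 - (N : ℤ))) z' →
        (∀ n : ℤ, 1 ≤ n → z n = z' n) →
        theta b P S₀ w = theta b P S₀ w') ∧
    ∃ (s : ℕ) (α γ : ℂ),
      analyticOrderAt (principalPart P S₀) 0 = (s : ℕ∞) ∧
      Tendsto (fun z : ℂ => principalPart P S₀ z / z ^ s) (𝓝[≠] 0) (𝓝 α) ∧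
      Tendsto (logDeriv (fun z : ℂ => principalPart P S₀ z / z ^ s)) (𝓝[≠] 0) (𝓝 γ) ∧
      ∀ w : ℝ → ℂ, MemLp w 2 (volume.restrict (Set.Ioo (-b) b)) →
        (∃ z : ℤ → ℂ,
          EnumeratesZeros (theta b P S₀ w) (Set.Ici (1 - (N : ℤ))) z ∧
          HasZeroAsymptotics N z₀ z) ∧
        ∀ z : ℤ → ℂ,
          EnumeratesZeros (theta b P S₀ w) (Set.Ici (1 - (N : ℤ))) z →
          HasZeroAsymptotics N z₀ z →
          ∀ ζ : ℂ,
            Multipliable (fun n : Set.Ici (1 - (N : ℤ)) => zeroFactor z₀ z ζ n) ∧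
            theta b P S₀ w ζ = α * Complex.exp (((s : ℂ) + γ) * ζ) *
              ∏' n : Set.Ici (1 - (N : ℤ)), zeroFactor z₀ z ζ n := by
  refine ⟨fun w w' hw hw' z z' hz hz' hzz =>
    hS₀.theta_eq_of_zeros_eq hb hP hzS₀ hsep hw hw' hz hz' hzz, ?_⟩
  obtain ⟨H, him⟩ := hS₀.exists_abs_im_le hzS₀
  obtain ⟨s, α, γ, hα, hs, hlim, hlog, hS⟩ := hS₀.exists_principalPart_eq hb hP hzS₀ hsep
    (hS₀.enumeratesZeros_principalPart hzP hzS₀)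
  refine ⟨s, α, γ, hs, hlim, hlog, fun w hw =>
    ⟨hS₀.exists_enumeratesZeros_theta hb hP hzP hzS₀ hsep hw, fun z hz hzas ζ => ?_⟩⟩
  have hsum := hzas.summable_sq hsep him
  exact ⟨(genusOneConvergent_of_summable_sq hsep him hsum).multipliable ζ,
    hS₀.theta_eq_exp_mul_product hb hP hzS₀ hsep hw hz hsum hα hS ζ⟩
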